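/- **Setting.** Let $F$ be a germ of holomorphic diffeomorphism of $(\mathbb C^2,0)$, represented by a map (again denoted $F$) that is holomorphic on an open neighbourhood $U$ of $0$. An irreducible *formal curve* at $0$ is a principal ideal $\Gamma\subset\mathbb C[[x,y]]$ generated by an irreducible series; it is *$F$-invariant* if $h\circ F\in\Gamma$ for all $h\in\Gamma$. A *stable set* of $F$ in $U$ is a set $S\subset U$ with $F(S)\subset S$ such that $F^n(z)\to0$ for every $z\in S$. A *parabolic curve* of $F$ in $U$ is a stable set that is a connected and simply connected, locally closed complex submanifold of pure dimension one and does not contain $0$. A stable set $S$ with $0\notin S$ is *asymptotic to $\Gamma$* if it has iterated tangents (the closure of the inverse image of $S$ under the blow-up of $0$ meets the exceptional divisor in a single point $p_1$, the closure of the inverse image of $S$ under the further blow-up of $p_1$ meets the new exceptional divisor in a single point $p_2$, and so on) and $(p_n)_{n\ge 1}$ is the sequence of infinitely near points of $\Gamma$. An orbit $\{(x_n,y_n)\}_{n\ge0}$ of $F$ in $U$ is asymptotic to $\Gamma$ if the set of its points is. The pair $(F,\Gamma)$ is *in reduced form* in the coordinates $(x,y)$ if, for some integers $k\ge1$, $p\ge0$,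 some $\mu\in\mathbb C$, a polynomial $a$ of degree at most $p$ with $a(0)\ne0$, and $b\in\mathbb C\{x\}$, $$x\circ F=x-x^{k+p+1}+O(x^{k+p+1}y,\,x^{2k+2p+1}),\qquad y\circ F=\mu\left[y+x^ka(x)y+O(x^{k+p+1}y)+b(x)\right],$$ where $O(u,v)$ denotes an element of the ideal $(u,v)$ of $\mathbb C\{x,y\}$, and $\Gamma$ is non-singular with order of contact at least $k+p+2$ with the $x$-axis, i.e. it has a parametrization $(s,\gamma_2(s))$ with $\gamma_2\in\mathbb C[[s]]$ of order at least $k+p+2$. Let $A_0,\dots,A_p\in\mathbb C$ be defined by $$x^k(A_0+A_1x+\dots+A_px^p)=J_{k+p}\bigl(\log(1+x^ka(x))\bigr),$$ where $J_{k+p}$ is truncation at degree $k+p$. The *attracting directions* of $(F,\Gamma)$ are the half-lines $\ell=\xi\mathbb R^+$ with $\xi^{k+p}=1$; $\ell$ is a *node direction* if $$\bigl(\ln|\mu|,\operatorname{Re}(\xi^kA_0),\dots,\operatorname{Re}(\xi^{k+p-1}A_{p-1})\bigr)<0$$ in the lexicographic order, and a *saddle direction* otherwise. **Theorem.** Let $F$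 be a germ of holomorphic diffeomorphism of $(\mathbb C^2,0)$ and $\Gamma$ an irreducible formal invariant curve of $F$ such that $(F,\Gamma)$ is in reduced form in the coordinates $(x,y)$, and let $\ell=\xi\mathbb R^+$, with $\xi^{k+p}=1$, be an attracting direction that is a saddle direction. Then there exist a connected and simply connected open set $R\subset\mathbb C$ with $0\in\partial R$ that contains $\ell$ near $0$ (i.e. $t\xi\in R$ for all sufficiently small $t>0$) and a holomorphic function $\varphi:R\to\mathbb C$ such that $$S=\{(x,\varphi(x)):x\in R\}$$ is a parabolic curve of $F$ in $U$ asymptotic to $\Gamma$. Moreover, if $\{(x_n,y_n)\}$ is an orbit of $F$ in $U$ that is asymptotic to $\Gamma$ and such that $\{x_n\}$ has $\ell$ as tangent direction (i.e. $x_n/|x_n|\to\xi$), then $(x_n,y_n)\in S$ for all sufficiently large $n$. -/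

import Mathlib

open Filter Topology Set

/-! ### Formal plane curves -/

/-- The ring `ℂ[[x, y]]`, with `x = X 0` and `y = X 1`. -/
abbrev FormalSeries : Type := MvPowerSeries (Fin 2) ℂ

/-- An irreducible formal curve at `0 ∈ ℂ²`: a principal ideal of `ℂ[[x, y]]` generated by an
irreducible (in particular non-constant) series. -/
def IsFormalCurve (Γ : Ideal FormalSeries) : Prop :=
  ∃ f : FormalSeries, Irreducible f ∧ Γ = Ideal.span {f}

/-- `γ(s) = (γ 0 (s), γ 1 (s))`, a non-zero pair of series without constant term, is a
parametrization of `Γ`: `h ∈ Γ ↔ h(γ(s)) = 0`. -/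
def IsParametrization (Γ : Ideal FormalSeries) (γ : Fin 2 → PowerSeries ℂ) : Prop :=
  γ ≠ 0 ∧ (∀ i, PowerSeries.constantCoeff (γ i) = 0) ∧
    ∀ h : FormalSeries, h ∈ Γ ↔ (MvPowerSeries.subst γ h : PowerSeries ℂ) = 0

/-- `Γ` is non-singular and its order of contact with the `x`-axis is at least `N` (with `N ≥ 2`):
`Γ` has a parametrization `(s, γ₂(s))` in which `γ₂` has order at least `N`. -/
def HasContactXAxis (Γ : Ideal FormalSeries) (N : ℕ) : Prop :=
  ∃ γ₂ : PowerSeries ℂ, (N : ℕ∞) ≤ γ₂.order ∧ IsParametrization Γ ![PowerSeries.X, γ₂]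

/-! ### Germs of diffeomorphisms of `(ℂ², 0)` -/

/-- `F` is (on the open neighbourhood `U` of `0`) a representative of a germ of holomorphic
diffeomorphism of `(ℂ², 0)`. -/
structure IsDiffeoGerm (F : ℂ × ℂ → ℂ × ℂ) (U : Set (ℂ × ℂ)) : Prop where
  isOpen : IsOpen U
  zero_mem : (0 : ℂ × ℂ) ∈ U
  holomorphic : DifferentiableOn ℂ F U
  map_zero : F 0 = 0
  invertible : ∃ L : (ℂ × ℂ) ≃L[ℂ] (ℂ × ℂ), HasFDerivAt F (L : (ℂ × ℂ) →L[ℂ] (ℂ × ℂ)) 0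

/-- `P` is the Taylor series of `f` at `0`. -/
def IsTaylorSeries (f : ℂ × ℂ → ℂ) (P : FormalSeries) : Prop :=
  ∀ᶠ z in 𝓝 (0 : ℂ × ℂ),
    HasSum (fun m : Fin 2 →₀ ℕ => MvPowerSeries.coeff m P * (z.1 ^ m 0 * z.2 ^ m 1)) (f z)

/-- The formal curve `Γ` is invariant by `F`: `h ∘ F ∈ Γ` for every `h ∈ Γ`. -/
def IsInvariantCurve (F : ℂ × ℂ → ℂ × ℂ) (Γ : Ideal FormalSeries) : Prop :=
  ∃ P Q : FormalSeries, IsTaylorSeries (fun z => (F z).1) P ∧ IsTaylorSeries (fun z => (F z).2) Q ∧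
    ∀ h ∈ Γ, MvPowerSeries.subst ![P, Q] h ∈ Γ

/-! ### Blow-ups and infinitely near points

The exceptional divisor of the blow-up `π` of a point is the projective line, identified with
`OnePoint ℂ`: the point `c : ℂ` is the direction of the line `y = c x`, and `∞` is the direction of
the line `x = 0`. -/

/-- The blow-up `π` of the origin of `ℂ²` read in the standard affine chart centred at the point `c`
of the exceptional divisor. This chart covers a neighbourhood of that point in the blown-up surface.
-/
def blowUpChart : OnePoint ℂ → ℂ × ℂ → ℂ × ℂ
  | OnePoint.some c => fun z => (z.1, z.1 * (z.2 + c))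
  | OnePoint.infty => fun z => (z.1 * z.2, z.2)

/-- The same chart, as a pair of formal series. -/
noncomputable def blowUpSeries : OnePoint ℂ → Fin 2 → FormalSeries
  | OnePoint.some c => ![MvPowerSeries.X 0, MvPowerSeries.X 0 * (MvPowerSeries.X 1 + MvPowerSeries.C c)]
  | OnePoint.infty => ![MvPowerSeries.X 0 * MvPowerSeries.X 1, MvPowerSeries.X 1]

/-- The local equation of the exceptional divisor in the chart centred at `c`. -/
noncomputable def exceptionalEquation : OnePoint ℂ → FormalSeries
  | OnePoint.some _ => MvPowerSeries.X 0
  | OnePoint.infty => MvPowerSeries.X 1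

/-- The direction of the line `a x + b y = 0`, for `(a, b) ≠ (0, 0)`. -/
noncomputable def lineDirection (a b : ℂ) : OnePoint ℂ :=
  open Classical in if b = 0 then OnePoint.infty else OnePoint.some (-a / b)

/-- `c` is the direction of the tangent line of `Γ`: for a generator `f` of multiplicity `ν`, the
initial form `f_ν` is `(a x + b y) ^ ν`, and `c` is the direction of `a x + b y = 0`. -/
def IsTangentDirection (Γ : Ideal FormalSeries) (c : OnePoint ℂ) : Prop :=
  ∃ (f : FormalSeries) (ν : ℕ) (a b : ℂ), Γ = Ideal.span {f} ∧ f.order = (ν : ℕ∞) ∧ (a, b) ≠ 0 ∧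
    MvPowerSeries.homogeneousComponent ν f =
      (MvPowerSeries.C a * MvPowerSeries.X 0 + MvPowerSeries.C b * MvPowerSeries.X 1) ^ ν ∧
    c = lineDirection a b

/-- `Γ'` is the strict transform of `Γ`, in the chart of the blow-up centred at `c`: the formal curve
other than the exceptional divisor that contains `h ∘ π` for all `h ∈ Γ`. -/
def IsStrictTransform (Γ : Ideal FormalSeries) (c : OnePoint ℂ) (Γ' : Ideal FormalSeries) : Prop :=
  IsFormalCurve Γ' ∧ Γ' ≠ Ideal.span {exceptionalEquation c} ∧
    ∀ h ∈ Γ, MvPowerSeries.subst (blowUpSeries c) h ∈ Γ'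

/-- `q` is the sequence of infinitely near points of `Γ`. The point `q n` lies on the exceptional
divisor of the `(n+1)`-st blow-up, whose centre is `q (n-1)` (the origin if `n = 0`); it is read in
the chart centred at the previous point. -/
def IsInfinitelyNearSequence (Γ : Ideal FormalSeries) (q : ℕ → OnePoint ℂ) : Prop :=
  ∃ G : ℕ → Ideal FormalSeries, G 0 = Γ ∧
    ∀ n, IsTangentDirection (G n) (q n) ∧ IsStrictTransform (G n) (q n) (G (n + 1))

/-- The inverse image of `S` after `n` blow-ups with centres `0, q 0, …, q (n-2)`, in the chart
centred at `q (n-1)`. -/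
def iteratedTransform (q : ℕ → OnePoint ℂ) (S : Set (ℂ × ℂ)) : ℕ → Set (ℂ × ℂ)
  | 0 => S
  | n + 1 => blowUpChart (q n) ⁻¹' iteratedTransform q S n

/-- `S` (with `0 ∉ S`) has the property of iterated tangents, with sequence of iterated tangents
`q`: for every `n` the only point of the exceptional divisor of the `(n+1)`-st blow-up that is in the
closure of the inverse image of `S` is `q n`. -/
def HasIteratedTangents (S : Set (ℂ × ℂ)) (q : ℕ → OnePoint ℂ) : Prop :=
  ∀ (n : ℕ) (c : OnePoint ℂ),
    (0 : ℂ × ℂ) ∈ closure (blowUpChart c ⁻¹' iteratedTransform q S n) ↔ c = q n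

/-! ### Stable sets, parabolic curves, asymptotic orbits -/

/-- `S` is a stable set of `F` in `U`: it is invariant and all its orbits converge to `0`. -/
def IsStableSet (F : ℂ × ℂ → ℂ × ℂ) (U S : Set (ℂ × ℂ)) : Prop :=
  S ⊆ U ∧ MapsTo F S S ∧ ∀ z ∈ S, Tendsto (fun n : ℕ => F^[n] z) atTop (𝓝 0)

/-- `S` is a locally closed complex submanifold of `ℂ²` of pure dimension one. -/
def IsComplexCurve (S : Set (ℂ × ℂ)) : Prop :=
  ∀ z ∈ S, ∃ (W : Set (ℂ × ℂ)) (h : ℂ × ℂ → ℂ), IsOpen W ∧ z ∈ W ∧ DifferentiableOn ℂ h W ∧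
    fderiv ℂ h z ≠ 0 ∧ S ∩ W = {w ∈ W | h w = 0}

/-- A parabolic curve of `F` in `U`: a connected and simply connected stable manifold of pure
dimension one that does not contain the origin. -/
def IsParabolicCurve (F : ℂ × ℂ → ℂ × ℂ) (U S : Set (ℂ × ℂ)) : Prop :=
  IsStableSet F U S ∧ IsComplexCurve S ∧ IsConnected S ∧ IsSimplyConnected S ∧ (0 : ℂ × ℂ) ∉ S

/-- `S` is a stable set of `F`, not containing `0`, that is asymptotic to `Γ`: it has the property of
iterated tangents and its sequence of iterated tangents is the sequence of infinitely near points of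
`Γ`. -/
def IsAsymptoticTo (F : ℂ × ℂ → ℂ × ℂ) (U S : Set (ℂ × ℂ)) (Γ : Ideal FormalSeries) : Prop :=
  IsStableSet F U S ∧ (0 : ℂ × ℂ) ∉ S ∧
    ∃ q : ℕ → OnePoint ℂ, HasIteratedTangents S q ∧ IsInfinitelyNearSequence Γ q

/-! ### Reduced pairs and attracting directions -/

/-- The pair `(F, Γ)` is in reduced form in the coordinates `(x, y)`, with principal part
`μ (1 + x ^ k a(x))`. Here `O(u, v)` stands for an element of the ideal generated by `u` and `v` in
the ring of convergent series `ℂ{x, y}`. -/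
structure IsReducedForm (F : ℂ × ℂ → ℂ × ℂ) (Γ : Ideal FormalSeries) (k p : ℕ) (μ : ℂ)
    (a : Polynomial ℂ) : Prop where
  one_le : 1 ≤ k
  natDegree_le : a.natDegree ≤ p
  eval_ne : a.eval 0 ≠ 0
  fst_eq : ∃ g₁ g₂ : ℂ × ℂ → ℂ, AnalyticAt ℂ g₁ 0 ∧ AnalyticAt ℂ g₂ 0 ∧
    ∀ᶠ z : ℂ × ℂ in 𝓝 0, (F z).1 =
      z.1 - z.1 ^ (k + p + 1)
        + (z.1 ^ (k + p + 1) * z.2 * g₁ z + z.1 ^ (2 * k + 2 * p + 1) * g₂ z)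
  snd_eq : ∃ (g : ℂ × ℂ → ℂ) (b : ℂ → ℂ), AnalyticAt ℂ g 0 ∧ AnalyticAt ℂ b 0 ∧
    ∀ᶠ z : ℂ × ℂ in 𝓝 0, (F z).2 =
      μ * (z.2 + z.1 ^ k * a.eval z.1 * z.2 + z.1 ^ (k + p + 1) * z.2 * g z + b z.1)
  contact : HasContactXAxis Γ (k + p + 2)

/-- The coefficient `A_j` of the infinitesimal principal part
`log μ + x ^ k (A_0 + A_1 x + ⋯ + A_p x ^ p) = J_{k+p} (log (μ (1 + x ^ k a(x))))`. -/
noncomputable def infinitesimalCoeff (k : ℕ) (a : Polynomial ℂ) (j : ℕ) : ℂ :=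
  PowerSeries.coeff (k + j)
    (PowerSeries.logOf (1 + PowerSeries.X ^ k * (a : PowerSeries ℂ)))

/-- The half-line `ξ ℝ⁺` is an attracting direction: `ξ ^ (k + p) = 1`. -/
def IsAttractingDirection (k p : ℕ) (ξ : ℂ) : Prop := ξ ^ (k + p) = 1

/-- The attracting direction `ξ ℝ⁺` is a node direction: in the lexicographic order
`(ln |μ|, Re (ξ ^ k A_0), …, Re (ξ ^ (k+p-1) A_{p-1})) < 0`. -/
def IsNodeDirection (k p : ℕ) (μ : ℂ) (a : Polynomial ℂ) (ξ : ℂ) : Prop :=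
  toLex (Fin.cons (Real.log ‖μ‖)
    (fun j : Fin p => (ξ ^ (k + (j : ℕ)) * infinitesimalCoeff k a j).re) : Fin (p + 1) → ℝ)
    < toLex (0 : Fin (p + 1) → ℝ)

/-- An attracting direction that is not a node direction is a saddle direction. -/
def IsSaddleDirection (k p : ℕ) (μ : ℂ) (a : Polynomial ℂ) (ξ : ℂ) : Prop :=
  IsAttractingDirection k p ξ ∧ ¬ IsNodeDirection k p μ a ξ

/-! ### The formal curve `y = c(x)` -/

/-! Put `q = k + p`. Since `Γ` is parametrized by `(s, c(s))`, it is generated by `y - c(x)`, and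
its infinitely near points are the coefficients of `c`. Subtract from `y` a long truncation `γ` of
`c` and pass to `w = 1 / (q x ^ q)`, which sends the attracting direction `ξ` to the right end of
the half-plane. The map becomes `(w, y) ↦ (w + 1 + H, E y + r)`, where `E = μ (1 + x ^ k a(x))`, `H`
is small, and `r` vanishes to high order on `y = 0` because `Γ` is invariant
(`isBigO_invariance_defect`, `exists_normalForm`).

The saddle condition says that `E` does not contract appreciably: `‖E⁻¹‖ ≤ 1 + c / re w`
(`exists_multiplier_bound`). This is where the shape `|im w| ^ q < re w` of the region matters.
There `x` is within `2 / re w` of the half-line `ξ ℝ⁺`, so that `re log E` differs by only `O(1 / re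
w)` from its nonnegative main part on the half-line; a full sector would be too wide when some of
the numbers `Re (ξ ^ (k+j) A_j)` vanish. The region is still large enough to be invariant and to
capture the relevant orbits, whose imaginary part grows at most like `log (re w)`.

A graph `y = φ(w)` is invariant when `φ = E⁻¹ (φ(w + 1 + H) - r)`. In the weight `(re w) ^ (-L)`,
the shift to the right gains a factor `1 - O(L / re w)`, which beats `1 + c / re w` for large `L`
(`inv_add_half_pow_bound`). Hence the iteration from `φ = 0` converges (`FibredMap.exists_fixed`),
and every orbit that stays `(re w) ^ (-L-2)`-close to the zero section lies on the limit graph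
(`FibredMap.eq_of_orbit`).

This uniqueness gives the remaining assertions. The graphs obtained from different `L` agree far to
the right (`InvariantGraph.eventually_eq`), so a single graph has contact of every order with `Γ`,
and thus its iterated tangents. Conversely, an orbit asymptotic to `Γ` is close to `c` to all orders
(`tendsto_of_hasIteratedTangents`), and if tangent to `ξ` it enters the region, so it ends up on the
graph. The region is convex, which makes the petal and its graph simply connected. -/

instance : IsDomain FormalSeries := NoZeroDivisors.to_isDomain _

/-- The series `y - c(x)`. -/
noncomputable def graphEquation (c : PowerSeries ℂ) : FormalSeries :=
  MvPowerSeries.X 1 - PowerSeries.subst (MvPowerSeries.X 0 : FormalSeries) c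

theorem hasSubst_pair {τ : Type*} {a b : MvPowerSeries τ ℂ}
    (ha : MvPowerSeries.constantCoeff a = 0) (hb : MvPowerSeries.constantCoeff b = 0) :
    MvPowerSeries.HasSubst ![a, b] :=
  MvPowerSeries.hasSubst_of_constantCoeff_zero (by intro i; fin_cases i <;> assumption)

theorem subst_pair_X_zero {τ : Type*} {a b : MvPowerSeries τ ℂ}
    (ha : MvPowerSeries.constantCoeff a = 0) (hb : MvPowerSeries.constantCoeff b = 0) :
    MvPowerSeries.subst ![a, b] (MvPowerSeries.X 0 : FormalSeries) = a :=
  MvPowerSeries.subst_X (hasSubst_pair ha hb) 0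

theorem subst_pair_X_one {τ : Type*} {a b : MvPowerSeries τ ℂ}
    (ha : MvPowerSeries.constantCoeff a = 0) (hb : MvPowerSeries.constantCoeff b = 0) :
    MvPowerSeries.subst ![a, b] (MvPowerSeries.X 1 : FormalSeries) = b :=
  MvPowerSeries.subst_X (hasSubst_pair ha hb) 1

theorem subst_pair_subst_X_zero {τ : Type*} {a b : MvPowerSeries τ ℂ}
    (ha : MvPowerSeries.constantCoeff a = 0) (hb : MvPowerSeries.constantCoeff b = 0)
    (c : PowerSeries ℂ) :
    MvPowerSeries.subst ![a, b] (PowerSeries.subst (MvPowerSeries.X 0 : FormalSeries) c) =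
      PowerSeries.subst a c := by
  have h := MvPowerSeries.subst_comp_subst_apply
    (PowerSeries.HasSubst.const (PowerSeries.HasSubst.X (S := ℂ) (0 : Fin 2)))
    (hasSubst_pair ha hb) c
  rw [PowerSeries.subst_def, h, PowerSeries.subst_def]
  congr 1
  funext _
  exact subst_pair_X_zero ha hb

theorem constantCoeff_subst_X_zero {c : PowerSeries ℂ} (hc : PowerSeries.constantCoeff c = 0) :
    MvPowerSeries.constantCoeff (PowerSeries.subst (MvPowerSeries.X 0 : FormalSeries) c) = 0 :=
  PowerSeries.constantCoeff_subst_eq_zero (MvPowerSeries.constantCoeff_X 0) c hc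

theorem subst_graphEquation {τ : Type*} {a b : MvPowerSeries τ ℂ}
    (ha : MvPowerSeries.constantCoeff a = 0) (hb : MvPowerSeries.constantCoeff b = 0)
    (c : PowerSeries ℂ) :
    MvPowerSeries.subst ![a, b] (graphEquation c) = b - PowerSeries.subst a c := by
  rw [graphEquation, MvPowerSeries.subst_sub (hasSubst_pair ha hb), subst_pair_X_one ha hb,
    subst_pair_subst_X_zero ha hb]

theorem coeff_graphEquation (c : PowerSeries ℂ) (m : Fin 2 →₀ ℕ) :
    MvPowerSeries.coeff m (graphEquation c) =
      (if m = Finsupp.single 1 1 then 1 else 0) -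
      (if m = Finsupp.single 0 (m 0) then PowerSeries.coeff (m 0) c else 0) := by
  rw [graphEquation, map_sub, MvPowerSeries.coeff_X, PowerSeries.coeff_subst_single]

/-- Setting `y = 0` in a series. -/
theorem subst_X_zero_eq_zero_iff (g : FormalSeries) :
    MvPowerSeries.subst ![(PowerSeries.X : PowerSeries ℂ), 0] g = 0 ↔
      (MvPowerSeries.X 1 : FormalSeries) ∣ g := by
  have hs : MvPowerSeries.HasSubst ![(PowerSeries.X : PowerSeries ℂ), 0] :=
    hasSubst_pair (MvPowerSeries.constantCoeff_X ()) (map_zero _)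
  have hcoef : ∀ n : ℕ, PowerSeries.coeff n (MvPowerSeries.subst
      ![(PowerSeries.X : PowerSeries ℂ), 0] g : PowerSeries ℂ) =
      MvPowerSeries.coeff (Finsupp.single 0 n) g := by
    intro n
    rw [PowerSeries.coeff, MvPowerSeries.coeff_subst hs,
      finsum_eq_single _ (Finsupp.single 0 n)]
    · rw [Finsupp.prod_single_index (by simp)]
      simp only [Matrix.cons_val_zero, smul_eq_mul]
      have := PowerSeries.coeff_X_pow_self (R := ℂ) n
      rw [PowerSeries.coeff] at this
      rw [this, mul_one]
    · intro d hd
      rw [Finsupp.prod_fintype _ _ (by simp)]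
      simp only [Fin.prod_univ_two, Matrix.cons_val_zero, Matrix.cons_val_one, smul_eq_mul]
      by_cases h1 : d 1 = 0
      · rw [h1, pow_zero, mul_one]
        have := PowerSeries.coeff_X_pow (R := ℂ) n (d 0)
        rw [PowerSeries.coeff] at this
        rw [this, if_neg, mul_zero]
        rintro rfl
        refine hd ?_
        ext i; fin_cases i <;> simp [h1]
      · rw [zero_pow h1, mul_zero, map_zero, mul_zero]
  rw [MvPowerSeries.X_dvd_iff]
  constructor
  · intro h m hm
    have := hcoef (m 0)
    rw [h, map_zero] at this
    have hm' : m = Finsupp.single 0 (m 0) := by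
      ext i; fin_cases i <;> simp [hm]
    rw [hm', ← this]
  · intro h
    ext n
    rw [hcoef, h _ (by simp), map_zero]

/-- The shear `y ↦ y + c(x)` turns `y - c(x)` into `y`, and a series vanishes on `y = 0` exactly
when `y` divides it; the inverse shear carries the factorization back. -/
theorem mem_span_graphEquation {c : PowerSeries ℂ} (hc : PowerSeries.constantCoeff c = 0)
    (h : FormalSeries) : h ∈ Ideal.span {graphEquation c} ↔
      (MvPowerSeries.subst ![PowerSeries.X, c] h : PowerSeries ℂ) = 0 := by
  set c0 : FormalSeries := PowerSeries.subst (MvPowerSeries.X 0 : FormalSeries) c with hc0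
  have k0 : MvPowerSeries.constantCoeff c0 = 0 := constantCoeff_subst_X_zero hc
  have kX : MvPowerSeries.constantCoeff (PowerSeries.X : PowerSeries ℂ) = 0 :=
    MvPowerSeries.constantCoeff_X ()
  have kX0 : MvPowerSeries.constantCoeff (MvPowerSeries.X 0 : FormalSeries) = 0 :=
    MvPowerSeries.constantCoeff_X 0
  have kX1 : MvPowerSeries.constantCoeff (MvPowerSeries.X 1 : FormalSeries) = 0 :=
    MvPowerSeries.constantCoeff_X 1
  have kc : MvPowerSeries.constantCoeff c = 0 := hc
  rw [Ideal.mem_span_singleton]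
  constructor
  · rintro ⟨g, rfl⟩
    rw [MvPowerSeries.subst_mul (hasSubst_pair kX kc), subst_graphEquation kX kc,
      PowerSeries.X_subst, sub_self, zero_mul]
  · intro hh
    have kp : MvPowerSeries.constantCoeff (MvPowerSeries.X 1 + c0 : FormalSeries) = 0 := by
      rw [map_add, kX1, k0, add_zero]
    have km : MvPowerSeries.constantCoeff (MvPowerSeries.X 1 - c0 : FormalSeries) = 0 := by
      rw [map_sub, kX1, k0, sub_zero]
    have hρ := hasSubst_pair kX (map_zero (MvPowerSeries.constantCoeff (σ := Unit) (R := ℂ)))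
    have e1 : MvPowerSeries.subst ![(PowerSeries.X : PowerSeries ℂ), 0]
        (MvPowerSeries.subst ![MvPowerSeries.X 0, MvPowerSeries.X 1 + c0] h) = 0 := by
      rw [MvPowerSeries.subst_comp_subst_apply (hasSubst_pair kX0 kp) hρ]
      refine Eq.trans ?_ hh
      congr 1
      funext i
      fin_cases i
      · exact subst_pair_X_zero kX (map_zero _)
      · simp only [Fin.mk_one, Matrix.cons_val_one, Matrix.cons_val_fin_one]
        rw [MvPowerSeries.subst_add hρ, subst_pair_X_one kX (map_zero _), hc0,
          subst_pair_subst_X_zero kX (map_zero _), PowerSeries.X_subst, zero_add]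
    obtain ⟨g, hg⟩ := (subst_X_zero_eq_zero_iff _).1 e1
    have hτ := hasSubst_pair kX0 km
    have e2 : MvPowerSeries.subst ![MvPowerSeries.X 0, MvPowerSeries.X 1 - c0]
        (MvPowerSeries.subst ![MvPowerSeries.X 0, MvPowerSeries.X 1 + c0] h) = h := by
      rw [MvPowerSeries.subst_comp_subst_apply (hasSubst_pair kX0 kp) hτ]
      have : (fun s => MvPowerSeries.subst ![(MvPowerSeries.X 0 : FormalSeries),
          MvPowerSeries.X 1 - c0] ((![MvPowerSeries.X 0, MvPowerSeries.X 1 + c0] :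
          Fin 2 → FormalSeries) s)) = MvPowerSeries.X := by
        funext i
        fin_cases i
        · exact subst_pair_X_zero kX0 km
        · simp only [Fin.mk_one, Matrix.cons_val_one, Matrix.cons_val_fin_one]
          rw [MvPowerSeries.subst_add hτ, subst_pair_X_one kX0 km, hc0,
            subst_pair_subst_X_zero kX0 km, ← hc0, sub_add_cancel]
      rw [this, MvPowerSeries.subst_self, id]
    rw [hg, MvPowerSeries.subst_mul hτ, subst_pair_X_one kX0 km] at e2
    exact ⟨_, e2.symm⟩

/-- The ideal is the kernel of the substitution `(x, y) = (s, c(s))`, a ring homomorphism into the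
domain `ℂ[[s]]`. -/
theorem prime_graphEquation {c : PowerSeries ℂ} (hc : PowerSeries.constantCoeff c = 0) :
    Prime (graphEquation c) := by
  have kX : MvPowerSeries.constantCoeff (PowerSeries.X : PowerSeries ℂ) = 0 :=
    MvPowerSeries.constantCoeff_X ()
  have hs := hasSubst_pair kX (b := c) hc
  have h0 : graphEquation c ≠ 0 := by
    intro h
    have := coeff_graphEquation c (Finsupp.single 1 1)
    rw [h] at this
    simp at this
  have hker : Ideal.span {graphEquation c} =
      RingHom.ker (MvPowerSeries.substAlgHom (R := ℂ) hs).toRingHom := by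
    ext h
    rw [mem_span_graphEquation hc, RingHom.mem_ker, ← MvPowerSeries.substAlgHom_apply hs]
    rfl
  rw [← Ideal.span_singleton_prime h0, hker]
  exact RingHom.ker_isPrime _

/-- The series `y` is prime as the graph equation of `c = 0`, and exchanging the two variables is an
automorphism. -/
theorem prime_X_zero : Prime (MvPowerSeries.X 0 : FormalSeries) := by
  have kX : MvPowerSeries.constantCoeff (PowerSeries.X : PowerSeries ℂ) = 0 :=
    MvPowerSeries.constantCoeff_X ()
  have k0 := map_zero (MvPowerSeries.constantCoeff (σ := Unit) (R := ℂ))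
  have hs : MvPowerSeries.HasSubst ![(MvPowerSeries.X 1 : FormalSeries), MvPowerSeries.X 0] :=
    hasSubst_pair (MvPowerSeries.constantCoeff_X 1) (MvPowerSeries.constantCoeff_X 0)
  have hp : Prime (MvPowerSeries.X 1 : FormalSeries) := by
    have := prime_graphEquation (c := 0) (map_zero _)
    rwa [graphEquation, ← PowerSeries.coe_substAlgHom (PowerSeries.HasSubst.X (0 : Fin 2)),
      map_zero, sub_zero] at this
  have e2 : ∀ h : FormalSeries, MvPowerSeries.subst ![(MvPowerSeries.X 1 : FormalSeries),
      MvPowerSeries.X 0] (MvPowerSeries.subst ![(MvPowerSeries.X 1 : FormalSeries),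
      MvPowerSeries.X 0] h) = h := by
    intro h
    rw [MvPowerSeries.subst_comp_subst_apply hs hs]
    have : (fun s => MvPowerSeries.subst ![(MvPowerSeries.X 1 : FormalSeries),
        MvPowerSeries.X 0] ((![MvPowerSeries.X 1, MvPowerSeries.X 0] :
        Fin 2 → FormalSeries) s)) = MvPowerSeries.X := by
      funext i
      fin_cases i
      · exact subst_pair_X_one (MvPowerSeries.constantCoeff_X 1) (MvPowerSeries.constantCoeff_X 0)
      · exact subst_pair_X_zero (MvPowerSeries.constantCoeff_X 1) (MvPowerSeries.constantCoeff_X 0)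
    rw [this, MvPowerSeries.subst_self, id]
  have e1 : MvPowerSeries.subst ![(MvPowerSeries.X 1 : FormalSeries),
      MvPowerSeries.X 0] (MvPowerSeries.X 0 : FormalSeries) = MvPowerSeries.X 1 :=
    subst_pair_X_zero (MvPowerSeries.constantCoeff_X 1) (MvPowerSeries.constantCoeff_X 0)
  let E : FormalSeries ≃* FormalSeries :=
    { toFun := MvPowerSeries.subst ![(MvPowerSeries.X 1 : FormalSeries), MvPowerSeries.X 0]
      invFun := MvPowerSeries.subst ![(MvPowerSeries.X 1 : FormalSeries), MvPowerSeries.X 0]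
      left_inv := e2
      right_inv := e2
      map_mul' := MvPowerSeries.subst_mul hs }
  refine (MulEquiv.prime_iff E).1 ?_
  change Prime (MvPowerSeries.subst _ _)
  rwa [e1]

/-- The series `(c - J_n c) / x ^ n`, where `J_n` is truncation at degree `n`. -/
noncomputable def shiftSeries (c : PowerSeries ℂ) (n : ℕ) : PowerSeries ℂ :=
  PowerSeries.mk fun i => if i = 0 then 0 else PowerSeries.coeff (i + n) c

theorem constantCoeff_shiftSeries (c : PowerSeries ℂ) (n : ℕ) :
    PowerSeries.constantCoeff (shiftSeries c n) = 0 := by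
  rw [← PowerSeries.coeff_zero_eq_constantCoeff_apply, shiftSeries, PowerSeries.coeff_mk, if_pos rfl]

theorem shiftSeries_zero {c : PowerSeries ℂ} (hc : PowerSeries.constantCoeff c = 0) :
    shiftSeries c 0 = c := by
  ext n
  rw [shiftSeries, PowerSeries.coeff_mk]
  split_ifs with h
  · rw [h, PowerSeries.coeff_zero_eq_constantCoeff_apply, hc]
  · rfl

theorem shiftSeries_shiftSeries (c : PowerSeries ℂ) (n : ℕ) :
    shiftSeries (shiftSeries c n) 1 = shiftSeries c (n + 1) := by
  ext i
  simp only [shiftSeries, PowerSeries.coeff_mk]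
  split_ifs with h h'
  · rfl
  · exact h'.elim
  · rw [add_assoc, add_comm 1 n]

theorem coeff_one_shiftSeries (c : PowerSeries ℂ) (n : ℕ) :
    PowerSeries.coeff 1 (shiftSeries c n) = PowerSeries.coeff (n + 1) c := by
  simp [shiftSeries, add_comm]

theorem eq_X_mul_shiftSeries {c : PowerSeries ℂ} (hc : PowerSeries.constantCoeff c = 0) :
    c = PowerSeries.X * (shiftSeries c 1 + PowerSeries.C (PowerSeries.coeff 1 c)) := by
  ext n
  cases n with
  | zero => simp [hc]
  | succ n =>
    rw [PowerSeries.coeff_succ_X_mul, map_add, shiftSeries, PowerSeries.coeff_mk,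
      PowerSeries.coeff_C]
    split_ifs with h
    · simp [h]
    · simp

theorem subst_blowUpSeries_graphEquation {c : PowerSeries ℂ}
    (hc : PowerSeries.constantCoeff c = 0) :
    MvPowerSeries.subst (blowUpSeries (OnePoint.some (PowerSeries.coeff 1 c))) (graphEquation c) =
      MvPowerSeries.X 0 * graphEquation (shiftSeries c 1) := by
  have hX := PowerSeries.HasSubst.X (S := ℂ) (0 : Fin 2)
  have h := subst_graphEquation (a := (MvPowerSeries.X 0 : FormalSeries))
    (b := MvPowerSeries.X 0 * (MvPowerSeries.X 1 + MvPowerSeries.C (PowerSeries.coeff 1 c)))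
    (MvPowerSeries.constantCoeff_X 0) (by simp) c
  refine h.trans ?_
  nth_rw 2 [eq_X_mul_shiftSeries hc]
  rw [PowerSeries.subst_mul hX, PowerSeries.subst_add hX, PowerSeries.subst_C,
    PowerSeries.subst_X hX, graphEquation]
  ring

/-! ### Infinitely near points of the curve `y = c(x)` -/

theorem coeff_single_mul_of_constantCoeff {f g : FormalSeries}
    (hf : MvPowerSeries.constantCoeff f = 0) (i : Fin 2) :
    MvPowerSeries.coeff (Finsupp.single i 1) (f * g) =
      MvPowerSeries.coeff (Finsupp.single i 1) f * MvPowerSeries.constantCoeff g := by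
  classical
  rw [MvPowerSeries.coeff_mul, Finsupp.antidiagonal_single, Finset.sum_map]
  rw [Finset.Nat.antidiagonal_succ]
  simp [hf]

theorem order_eq_one_of_coeff {f : FormalSeries} (hf : MvPowerSeries.constantCoeff f = 0)
    (i : Fin 2) (hi : MvPowerSeries.coeff (Finsupp.single i 1) f ≠ 0) : f.order = (1 : ℕ) := by
  refine le_antisymm ?_ ?_
  · refine (MvPowerSeries.order_le hi).trans ?_
    simp
  · rw [Nat.cast_one, MvPowerSeries.one_le_order_iff_constCoeff_eq_zero]
    exact hf

/-- Any other generator is a unit multiple of `y - c(x)`, so it has multiplicity one and a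
proportional linear part; the direction is therefore independent of the generator. -/
theorem isTangentDirection_graphEquation {c : PowerSeries ℂ}
    (hc : PowerSeries.constantCoeff c = 0) (d : OnePoint ℂ) :
    IsTangentDirection (Ideal.span {graphEquation c}) d ↔
      d = OnePoint.some (PowerSeries.coeff 1 c) := by
  have k0 : MvPowerSeries.constantCoeff (graphEquation c) = 0 := by
    rw [graphEquation, map_sub, MvPowerSeries.constantCoeff_X, constantCoeff_subst_X_zero hc,
      sub_zero]
  have k1 : MvPowerSeries.coeff (Finsupp.single 0 1) (graphEquation c) =
      - PowerSeries.coeff 1 c := by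
    rw [coeff_graphEquation]; simp [Finsupp.single_eq_single_iff]
  have k2 : MvPowerSeries.coeff (Finsupp.single 1 1) (graphEquation c) = 1 := by
    rw [coeff_graphEquation]; simp
  constructor
  · rintro ⟨f, ν, a, b, hf, hν, hab, hom, rfl⟩
    obtain ⟨u, hu⟩ := Ideal.span_singleton_eq_span_singleton.1 hf
    have hu0 : MvPowerSeries.constantCoeff (u : FormalSeries) ≠ 0 :=
      (MvPowerSeries.isUnit_iff_constantCoeff.1 u.isUnit).ne_zero
    have f0 : MvPowerSeries.constantCoeff f = 0 := by rw [← hu, map_mul, k0, zero_mul]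
    have f1 : MvPowerSeries.coeff (Finsupp.single 0 1) f =
        - PowerSeries.coeff 1 c * MvPowerSeries.constantCoeff (u : FormalSeries) := by
      rw [← hu, coeff_single_mul_of_constantCoeff k0, k1]
    have f2 : MvPowerSeries.coeff (Finsupp.single 1 1) f =
        MvPowerSeries.constantCoeff (u : FormalSeries) := by
      rw [← hu, coeff_single_mul_of_constantCoeff k0, k2, one_mul]
    have hν1 : ν = 1 := by
      have := order_eq_one_of_coeff f0 1 (by rw [f2]; exact hu0)
      rw [hν] at this
      exact_mod_cast this
    subst hν1
    have g0 := congrArg (MvPowerSeries.coeff (Finsupp.single 0 1)) hom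
    have g1 := congrArg (MvPowerSeries.coeff (Finsupp.single 1 1)) hom
    rw [MvPowerSeries.coeff_homogeneousComponent, if_pos (by simp), f1, pow_one, map_add,
      MvPowerSeries.coeff_C_mul, MvPowerSeries.coeff_C_mul, MvPowerSeries.coeff_X,
      MvPowerSeries.coeff_X] at g0
    rw [MvPowerSeries.coeff_homogeneousComponent, if_pos (by simp), f2, pow_one, map_add,
      MvPowerSeries.coeff_C_mul, MvPowerSeries.coeff_C_mul, MvPowerSeries.coeff_X,
      MvPowerSeries.coeff_X] at g1
    simp [Finsupp.single_eq_single_iff] at g0 g1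
    rw [lineDirection, if_neg (by rw [← g1]; exact hu0), ← g0, ← g1]
    congr 1
    field_simp
  · rintro rfl
    refine ⟨graphEquation c, 1, - PowerSeries.coeff 1 c, 1, rfl,
      order_eq_one_of_coeff k0 1 (by rw [k2]; exact one_ne_zero), by simp, ?_, by
        simp [lineDirection]⟩
    ext m
    rw [MvPowerSeries.coeff_homogeneousComponent, pow_one, map_add, MvPowerSeries.coeff_C_mul,
      MvPowerSeries.coeff_C_mul, MvPowerSeries.coeff_X, MvPowerSeries.coeff_X,
      coeff_graphEquation]
    have hdeg : m.degree = m 0 + m 1 := by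
      rw [Finsupp.degree_eq_sum, Fin.sum_univ_two]
    have e0 : ∀ n, m = Finsupp.single 0 n ↔ m 0 = n ∧ m 1 = 0 := by
      intro n
      constructor
      · intro h; rw [h]; simp
      · rintro ⟨h, h'⟩; ext i; fin_cases i <;> simp [h, h']
    have e1 : ∀ n, m = Finsupp.single 1 n ↔ m 0 = 0 ∧ m 1 = n := by
      intro n
      constructor
      · intro h; rw [h]; simp
      · rintro ⟨h, h'⟩; ext i; fin_cases i <;> simp [h, h']
    simp only [e0, e1, hdeg]
    split_ifs with h1 h2 h3 h4 h5 h6 <;> first | omega | simp_all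

/-- The pull-back of `y - c(x)` factors as `x` times the graph equation of the shifted series. An
irreducible generator dividing this product without defining the exceptional divisor must be
associated to the second factor. -/
theorem isStrictTransform_graphEquation {c : PowerSeries ℂ}
    (hc : PowerSeries.constantCoeff c = 0) (Γ' : Ideal FormalSeries) :
    IsStrictTransform (Ideal.span {graphEquation c})
      (OnePoint.some (PowerSeries.coeff 1 c)) Γ' ↔
      Γ' = Ideal.span {graphEquation (shiftSeries c 1)} := by
  have hp := prime_graphEquation (constantCoeff_shiftSeries c 1)
  have hb : MvPowerSeries.HasSubst (blowUpSeries (OnePoint.some (PowerSeries.coeff 1 c))) :=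
    hasSubst_pair (MvPowerSeries.constantCoeff_X 0) (by simp)
  constructor
  · rintro ⟨⟨f, hf, rfl⟩, hne, hall⟩
    have h := hall _ (Ideal.mem_span_singleton_self _)
    rw [subst_blowUpSeries_graphEquation hc, Ideal.mem_span_singleton] at h
    obtain ⟨g, hg⟩ := h
    rcases prime_X_zero.dvd_or_dvd (a := f) (b := g) ⟨_, hg.symm⟩ with h | h
    · exact absurd (Ideal.span_singleton_eq_span_singleton.2
        ((prime_X_zero.irreducible.associated_of_dvd hf h).symm)) hne
    · obtain ⟨g', rfl⟩ := h
      have h2 : graphEquation (shiftSeries c 1) = f * g' := by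
        refine mul_left_cancel₀ prime_X_zero.ne_zero (hg.trans ?_)
        ring
      refine Ideal.span_singleton_eq_span_singleton.2 ?_
      exact hf.associated_of_dvd hp.irreducible ⟨g', h2⟩
  · rintro rfl
    refine ⟨⟨_, hp.irreducible, rfl⟩, ?_, ?_⟩
    · intro h
      have h1 := (Ideal.span_singleton_le_span_singleton (x := graphEquation (shiftSeries c 1))).1
        (h.le : _ ≤ Ideal.span {(MvPowerSeries.X 0 : FormalSeries)})
      replace h1 : (MvPowerSeries.X 0 : FormalSeries) ∣ _ := h1
      rw [MvPowerSeries.X_dvd_iff] at h1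
      have := h1 (Finsupp.single 1 1) (by simp)
      rw [coeff_graphEquation] at this
      simp at this
    · intro h hh
      obtain ⟨g, rfl⟩ := Ideal.mem_span_singleton.1 hh
      rw [MvPowerSeries.subst_mul hb, subst_blowUpSeries_graphEquation hc]
      exact Ideal.mul_mem_right _ _ (Ideal.mul_mem_left _ _ (Ideal.mem_span_singleton_self _))

theorem isInfinitelyNearSequence_graphEquation {c : PowerSeries ℂ}
    (hc : PowerSeries.constantCoeff c = 0) (q : ℕ → OnePoint ℂ) :
    IsInfinitelyNearSequence (Ideal.span {graphEquation c}) q ↔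
      ∀ n, q n = OnePoint.some (PowerSeries.coeff (n + 1) c) := by
  constructor
  · rintro ⟨G, hG0, hG⟩
    -- The blown-up curves are determined step by step, which is what makes the sequence of
    -- infinitely near points unique.
    have hGn : ∀ n, G n = Ideal.span {graphEquation (shiftSeries c n)} ∧
        q n = OnePoint.some (PowerSeries.coeff (n + 1) c) := by
      intro n
      induction n with
      | zero =>
        have h0 : G 0 = Ideal.span {graphEquation (shiftSeries c 0)} := by
          rw [hG0, shiftSeries_zero hc]
        refine ⟨h0, ?_⟩
        have := (hG 0).1
        rw [hG0, isTangentDirection_graphEquation hc] at this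
        exact this
      | succ n ih =>
        have h1 := (hG n).2
        rw [ih.1, ih.2, ← coeff_one_shiftSeries,
          isStrictTransform_graphEquation (constantCoeff_shiftSeries c n),
          shiftSeries_shiftSeries] at h1
        refine ⟨h1, ?_⟩
        have h2 := (hG (n + 1)).1
        rwa [h1, isTangentDirection_graphEquation (constantCoeff_shiftSeries c _),
          coeff_one_shiftSeries] at h2
    exact fun n => (hGn n).2
  · intro hq
    refine ⟨fun n => Ideal.span {graphEquation (shiftSeries c n)}, ?_, fun n => ?_⟩
    · simp only [shiftSeries_zero hc]
    · have hn := constantCoeff_shiftSeries c n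
      rw [isTangentDirection_graphEquation hn, hq n, ← coeff_one_shiftSeries,
        isStrictTransform_graphEquation hn, shiftSeries_shiftSeries]
      exact ⟨rfl, rfl⟩

theorem eq_span_graphEquation {Γ : Ideal FormalSeries} {c : PowerSeries ℂ}
    (h : IsParametrization Γ ![PowerSeries.X, c]) : Γ = Ideal.span {graphEquation c} := by
  ext f
  rw [mem_span_graphEquation (c := c) (h.2.1 1)]
  exact h.2.2 f

/-! ### Truncations of the invariance equation -/

theorem X_pow_dvd_subst_sub_truncTotal {γ : Fin 2 → PowerSeries ℂ}
    (hγ : ∀ i, PowerSeries.constantCoeff (γ i) = 0) (P : FormalSeries) (M : ℕ) :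
    PowerSeries.X ^ M ∣ (MvPowerSeries.subst γ P : PowerSeries ℂ) -
      MvPolynomial.aeval γ (MvPowerSeries.truncTotal M P) := by
  have hs : MvPowerSeries.HasSubst γ := MvPowerSeries.hasSubst_of_constantCoeff_zero hγ
  rw [← MvPowerSeries.subst_coe, ← MvPowerSeries.subst_sub hs, PowerSeries.X_pow_dvd_iff]
  intro m hm
  refine MvPowerSeries.coeff_of_lt_order ?_
  refine lt_of_lt_of_le ?_ (MvPowerSeries.le_order_subst hs _)
  have h1 : (1 : ℕ∞) ≤ ⨅ i, MvPowerSeries.order (γ i) := by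
    refine le_iInf fun i => ?_
    rw [MvPowerSeries.one_le_order_iff_constCoeff_eq_zero]
    exact hγ i
  have h2 : (M : ℕ∞) ≤ MvPowerSeries.order
      (P - ((MvPowerSeries.truncTotal M P : MvPolynomial (Fin 2) ℂ) : FormalSeries)) := by
    refine MvPowerSeries.le_order fun d hd => ?_
    rw [map_sub, MvPolynomial.coeff_coe, MvPowerSeries.coeff_truncTotal _ (by exact_mod_cast hd),
      sub_self]
  calc ((Finsupp.single () m).degree : ℕ∞) = m := by simp
    _ < M := by exact_mod_cast hm
    _ = 1 * M := (one_mul _).symm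
    _ ≤ _ := mul_le_mul' h1 h2

/-- In the quotient by the ideal of `d` the two evaluation points coincide. -/
theorem dvd_aeval_sub_aeval {A : Type*} [CommRing A] [Algebra ℂ A] {σ : Type*} {a b : σ → A} {d : A}
    (h : ∀ i, d ∣ a i - b i) (p : MvPolynomial σ ℂ) :
    d ∣ MvPolynomial.aeval a p - MvPolynomial.aeval b p := by
  simp only [← Ideal.mem_span_singleton, ← Ideal.Quotient.eq] at h ⊢
  rw [MvPolynomial.map_aeval, MvPolynomial.map_aeval]
  congr 2
  funext i
  exact h i

/-- The invariance equation of the curve `y = c(x)`. -/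
theorem subst_eq_of_invariant {c : PowerSeries ℂ} (hc : PowerSeries.constantCoeff c = 0)
    {P Q : FormalSeries} (hP : MvPowerSeries.constantCoeff P = 0)
    (hQ : MvPowerSeries.constantCoeff Q = 0)
    (hinv : ∀ h ∈ Ideal.span {graphEquation c}, MvPowerSeries.subst ![P, Q] h ∈
      Ideal.span {graphEquation c}) :
    (MvPowerSeries.subst ![PowerSeries.X, c] Q : PowerSeries ℂ) =
      PowerSeries.subst (MvPowerSeries.subst ![PowerSeries.X, c] P : PowerSeries ℂ) c := by
  have kX : MvPowerSeries.constantCoeff (PowerSeries.X : PowerSeries ℂ) = 0 :=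
    MvPowerSeries.constantCoeff_X ()
  have hs := hasSubst_pair kX (b := c) hc
  have h := hinv _ (Ideal.mem_span_singleton_self _)
  rw [subst_graphEquation hP hQ, mem_span_graphEquation hc, MvPowerSeries.subst_sub hs,
    sub_eq_zero] at h
  rw [h, PowerSeries.subst_def, MvPowerSeries.subst_comp_subst_apply
    (PowerSeries.HasSubst.const (PowerSeries.HasSubst.of_constantCoeff_zero hP)) hs]
  rfl

/-- Modulo `X ^ M` the series `c`, `P` and `Q` can be replaced by truncations in the invariance
equation. Composition respects this because the inner series has no constant term. The result is a
congruence between polynomials, which can be evaluated at points even if `c` diverges. -/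
theorem X_pow_dvd_of_invariant {c : PowerSeries ℂ} (hc : PowerSeries.constantCoeff c = 0)
    {P Q : FormalSeries} (hP : MvPowerSeries.constantCoeff P = 0)
    (hQ : MvPowerSeries.constantCoeff Q = 0)
    (hinv : ∀ h ∈ Ideal.span {graphEquation c}, MvPowerSeries.subst ![P, Q] h ∈
      Ideal.span {graphEquation c}) (M : ℕ) :
    Polynomial.X ^ M ∣
      MvPolynomial.aeval ![Polynomial.X, PowerSeries.trunc M c] (MvPowerSeries.truncTotal M Q) -
      (PowerSeries.trunc M c).comp
        (MvPolynomial.aeval ![Polynomial.X, PowerSeries.trunc M c]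
          (MvPowerSeries.truncTotal M P)) := by
  set γ := PowerSeries.trunc M c with hγ
  set d : PowerSeries ℂ := PowerSeries.X ^ M with hd
  have hcγ : d ∣ c - γ := by
    rw [hd, PowerSeries.X_pow_dvd_iff]
    intro m hm
    rw [map_sub, Polynomial.coeff_coe, hγ, PowerSeries.coeff_trunc, if_pos hm, sub_self]
  have hcoe : ∀ p : MvPolynomial (Fin 2) ℂ,
      ((MvPolynomial.aeval ![Polynomial.X, γ] p : Polynomial ℂ) : PowerSeries ℂ) =
      MvPolynomial.aeval ![PowerSeries.X, (γ : PowerSeries ℂ)] p := by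
    intro p
    have h1 := MvPolynomial.comp_aeval_apply ![(Polynomial.X : Polynomial ℂ), γ]
      (Polynomial.coeToPowerSeries.algHom (R := ℂ) ℂ) p
    have h2 : (Polynomial.coeToPowerSeries.algHom (R := ℂ) ℂ)
        (MvPolynomial.aeval ![Polynomial.X, γ] p) =
        ((MvPolynomial.aeval ![Polynomial.X, γ] p : Polynomial ℂ) : PowerSeries ℂ) := by
      rw [Polynomial.coeToPowerSeries.algHom_apply]; simp
    rw [← h2, h1]
    congr 2
    funext i
    fin_cases i <;> simp [Polynomial.coeToPowerSeries.algHom_apply]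
  have hp : ∀ P : FormalSeries,
      d ∣ (MvPowerSeries.subst ![PowerSeries.X, c] P : PowerSeries ℂ) -
      (MvPolynomial.aeval ![Polynomial.X, γ] (MvPowerSeries.truncTotal M P) : Polynomial ℂ) := by
    intro P
    have h1 := X_pow_dvd_subst_sub_truncTotal (γ := ![PowerSeries.X, c])
      (by intro i; fin_cases i <;> simp [hc]) P M
    have h2 : d ∣ MvPolynomial.aeval ![PowerSeries.X, c] (MvPowerSeries.truncTotal M P) -
        MvPolynomial.aeval ![PowerSeries.X, (γ : PowerSeries ℂ)]
          (MvPowerSeries.truncTotal M P) := by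
      refine dvd_aeval_sub_aeval (fun i => ?_) _
      fin_cases i
      · simp
      · simpa using hcγ
    rw [hcoe]
    have := dvd_add h1 h2
    rwa [sub_add_sub_cancel] at this
  set pP := MvPolynomial.aeval ![Polynomial.X, γ] (MvPowerSeries.truncTotal M P)
  set pQ := MvPolynomial.aeval ![Polynomial.X, γ] (MvPowerSeries.truncTotal M Q)
  set P' : PowerSeries ℂ := MvPowerSeries.subst ![PowerSeries.X, c] P with hP'
  set Q' : PowerSeries ℂ := MvPowerSeries.subst ![PowerSeries.X, c] Q with hQ'
  have kP' : PowerSeries.constantCoeff P' = 0 :=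
    MvPowerSeries.constantCoeff_subst_eq_zero
      (hasSubst_pair (MvPowerSeries.constantCoeff_X ()) (b := c) hc)
      (by intro i; fin_cases i; exacts [MvPowerSeries.constantCoeff_X (), hc]) hP
  have hs' : PowerSeries.HasSubst P' := PowerSeries.HasSubst.of_constantCoeff_zero' kP'
  have hinv' : Q' = PowerSeries.subst P' c := subst_eq_of_invariant hc hP hQ hinv
  have e1 : d ∣ PowerSeries.subst P' c - PowerSeries.subst P' (γ : PowerSeries ℂ) := by
    rw [← PowerSeries.subst_sub hs']
    obtain ⟨g, hg⟩ := hcγ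
    rw [hg, PowerSeries.subst_mul hs', hd, PowerSeries.subst_pow hs', PowerSeries.subst_X hs']
    exact Dvd.dvd.mul_right (pow_dvd_pow_of_dvd (PowerSeries.X_dvd_iff.2 kP') M) _
  have e2 : d ∣ PowerSeries.subst P' (γ : PowerSeries ℂ) - (γ.comp pP : Polynomial ℂ) := by
    have h3 : ((γ.comp pP : Polynomial ℂ) : PowerSeries ℂ) =
        Polynomial.aeval (pP : PowerSeries ℂ) γ := by
      have := Polynomial.aeval_algHom_apply (Polynomial.coeToPowerSeries.algHom (R := ℂ) ℂ) pP γ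
      rw [Polynomial.coeToPowerSeries.algHom_apply, Polynomial.coeToPowerSeries.algHom_apply] at this
      simp only [Algebra.algebraMap_self, 
        PowerSeries.map_id, id] at this
      rw [this, Polynomial.comp_eq_aeval]
    rw [PowerSeries.subst_coe hs', h3]
    have h4 := (hp P).trans (Polynomial.sub_dvd_eval_sub P' (pP : PowerSeries ℂ)
      (γ.map (algebraMap ℂ (PowerSeries ℂ))))
    rwa [Polynomial.eval_map_algebraMap, Polynomial.eval_map_algebraMap] at h4
  have e3 : d ∣ (pQ : PowerSeries ℂ) - (γ.comp pP : Polynomial ℂ) := by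
    have h5 := dvd_add (dvd_add ((dvd_neg.2 (hp Q))) (e1)) e2
    rw [← hinv'] at h5
    convert! h5 using 1
    ring
  rw [Polynomial.X_pow_dvd_iff]
  rw [hd, PowerSeries.X_pow_dvd_iff] at e3
  intro m hm
  have := e3 m hm
  rwa [map_sub, Polynomial.coeff_coe, Polynomial.coeff_coe, ← Polynomial.coeff_sub] at this

/-! ### From formal congruences to estimates near the origin -/

theorem isBigO_sub_truncTotal {f : ℂ × ℂ → ℂ} {P : FormalSeries} (h : IsTaylorSeries f P) (M : ℕ) :
    (fun z : ℂ × ℂ => f z - MvPolynomial.eval ![z.1, z.2] (MvPowerSeries.truncTotal M P))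
      =O[𝓝 0] fun z => ‖z‖ ^ M := by
  obtain ⟨ε, hε, hball⟩ := Metric.eventually_nhds_iff.1 h
  set r := ε / 2 with hr
  have hr0 : 0 < r := by positivity
  have hsr := hball (y := ((r : ℂ), (r : ℂ))) (by
    rw [dist_zero_right, Prod.norm_mk, max_self, Complex.norm_real, Real.norm_of_nonneg hr0.le]
    linarith)
  -- The series converges absolutely at `(r, r)`; at `z` each term of degree at least `M` is smaller
  -- by a factor `(‖z‖ / r) ^ M` or better.
  have hsum := hsr.summable.norm
  refine Asymptotics.IsBigO.of_bound ((∑' m, ‖MvPowerSeries.coeff m P *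
    ((r : ℂ) ^ m 0 * (r : ℂ) ^ m 1)‖) / r ^ M) ?_
  filter_upwards [Metric.ball_mem_nhds (0 : ℂ × ℂ) hr0] with z hz
  rw [mem_ball_zero_iff] at hz
  have hz1 := hball (y := z) (by rw [dist_zero_right]; linarith)
  have hz2 : HasSum (fun m : Fin 2 →₀ ℕ => MvPolynomial.coeff m (MvPowerSeries.truncTotal M P) *
      (z.1 ^ m 0 * z.2 ^ m 1)) (MvPolynomial.eval ![z.1, z.2] (MvPowerSeries.truncTotal M P)) := by
    rw [MvPolynomial.eval_eq']
    simp only [Fin.prod_univ_two, Matrix.cons_val_zero, Matrix.cons_val_one]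
    refine hasSum_sum_of_ne_finset_zero fun m hm => ?_
    rw [MvPolynomial.notMem_support_iff.1 hm, zero_mul]
  rw [norm_pow, norm_norm, div_mul_eq_mul_div, mul_div_assoc, ← div_pow, ← tsum_mul_right]
  refine (hz1.sub hz2).norm_le_of_bounded (hsum.mul_right _).hasSum fun m => ?_
  rw [← sub_mul, MvPowerSeries.coeff_truncTotal_eq_ite]
  split_ifs with hm
  · rw [sub_self, zero_mul, norm_zero]; positivity
  · have hdeg : m.degree = m 0 + m 1 := by rw [Finsupp.degree_eq_sum, Fin.sum_univ_two]
    rw [sub_zero]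
    simp only [norm_mul, norm_pow, Complex.norm_real, Real.norm_of_nonneg hr0.le, mul_assoc]
    refine mul_le_mul_of_nonneg_left ?_ (norm_nonneg _)
    have hz1 : ‖z.1‖ ≤ ‖z‖ := norm_fst_le z
    have hz2 : ‖z.2‖ ≤ ‖z‖ := norm_snd_le z
    calc ‖z.1‖ ^ m 0 * ‖z.2‖ ^ m 1 ≤ ‖z‖ ^ m 0 * ‖z‖ ^ m 1 := by gcongr
      _ = r ^ (m 0 + m 1) * (‖z‖ / r) ^ (m 0 + m 1) := by
          rw [← pow_add, ← mul_pow, mul_div_cancel₀ _ hr0.ne']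
      _ ≤ r ^ (m 0 + m 1) * (‖z‖ / r) ^ M := by
          refine mul_le_mul_of_nonneg_left ?_ (by positivity)
          exact pow_le_pow_of_le_one (by positivity) (by rw [div_le_one hr0]; exact hz.le)
            (by omega)
      _ = _ := by rw [pow_add, mul_assoc]

theorem constantCoeff_eq_zero_of_taylor {f : ℂ × ℂ → ℂ} {P : FormalSeries}
    (h : IsTaylorSeries f P) (h0 : f 0 = 0) : MvPowerSeries.constantCoeff P = 0 := by
  have h1 := h.self_of_nhds
  rw [h0] at h1
  have h2 := hasSum_single (f := fun m : Fin 2 →₀ ℕ => MvPowerSeries.coeff m P *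
    ((0 : ℂ × ℂ).1 ^ m 0 * (0 : ℂ × ℂ).2 ^ m 1)) 0 (by
      intro m hm
      have : m 0 ≠ 0 ∨ m 1 ≠ 0 := by
        by_contra hcon
        push Not at hcon
        exact hm (by ext i; fin_cases i; exacts [hcon.1, hcon.2])
      rcases this with h | h <;> simp [h])
  have := h1.unique h2
  simpa using this.symm

/-- The truncation of an invariant formal graph is invariant up to a high order. -/
theorem isBigO_invariance_defect {c : PowerSeries ℂ} (hc : PowerSeries.constantCoeff c = 0)
    {F : ℂ × ℂ → ℂ × ℂ} (hF0 : F 0 = 0) (hF : ContinuousAt F 0)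
    (hinv : IsInvariantCurve F (Ideal.span {graphEquation c})) (M : ℕ) :
    (fun x : ℂ => (F (x, (PowerSeries.trunc M c).eval x)).2 -
      (PowerSeries.trunc M c).eval (F (x, (PowerSeries.trunc M c).eval x)).1)
      =O[𝓝 0] fun x => x ^ M := by
  obtain ⟨P, Q, hP, hQ, hPQ⟩ := hinv
  have kP := constantCoeff_eq_zero_of_taylor hP (by rw [hF0]; rfl)
  have kQ := constantCoeff_eq_zero_of_taylor hQ (by rw [hF0]; rfl)
  have hdvd := X_pow_dvd_of_invariant hc kP kQ hPQ M
  set γ := PowerSeries.trunc M c with hγ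
  set pP := MvPolynomial.aeval ![Polynomial.X, γ] (MvPowerSeries.truncTotal M P) with hpP
  set pQ := MvPolynomial.aeval ![Polynomial.X, γ] (MvPowerSeries.truncTotal M Q) with hpQ
  have hγ0 : γ.eval 0 = 0 := by
    rw [← Polynomial.coeff_zero_eq_eval_zero, hγ, PowerSeries.coeff_trunc]
    split_ifs <;> simp [hc]
  have hγO : (fun x : ℂ => γ.eval x) =O[𝓝 0] fun x => x := by
    have := (γ.differentiable.differentiableAt (x := 0)).isBigO_sub
    simpa [hγ0] using this
  have hzO : (fun x : ℂ => ((x, γ.eval x) : ℂ × ℂ)) =O[𝓝 0] fun x => x :=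
    (Asymptotics.isBigO_refl _ _).prod_left hγO
  have hz0 : Tendsto (fun x : ℂ => ((x, γ.eval x) : ℂ × ℂ)) (𝓝 0) (𝓝 0) := by
    have : Continuous fun x : ℂ => ((x, γ.eval x) : ℂ × ℂ) :=
      continuous_id.prodMk γ.continuous
    have h := this.tendsto 0
    rwa [hγ0] at h
  have heval : ∀ (p : MvPolynomial (Fin 2) ℂ) (x : ℂ),
      MvPolynomial.eval ![x, γ.eval x] p = (MvPolynomial.aeval ![Polynomial.X, γ] p).eval x := by
    intro p x
    have h1 := MvPolynomial.comp_aeval_apply ![(Polynomial.X : Polynomial ℂ), γ]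
      (Polynomial.aeval (R := ℂ) x) p
    rw [Polynomial.coe_aeval_eq_eval] at h1
    rw [h1, ← MvPolynomial.coe_aeval_eq_eval]
    simp only [RingHom.coe_coe]
    congr 2
    funext i
    fin_cases i <;> simp
  have key : ∀ {f : ℂ × ℂ → ℂ} {P : FormalSeries}, IsTaylorSeries f P →
      (fun x : ℂ => f (x, γ.eval x) - (MvPolynomial.aeval ![Polynomial.X, γ]
        (MvPowerSeries.truncTotal M P) : Polynomial ℂ).eval x) =O[𝓝 0] fun x => x ^ M := by
    intro f P h
    have h1 := (isBigO_sub_truncTotal h M).comp_tendsto hz0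
    refine Asymptotics.IsBigO.trans ?_ ((hzO.norm_left).pow M)
    refine h1.congr_left fun x => ?_
    simp only [Function.comp, heval]
  have h1 := key hP
  have h2 := key hQ
  rw [← hpP] at h1
  rw [← hpQ] at h2
  have hF1 : Tendsto (fun x : ℂ => (F (x, γ.eval x)).1) (𝓝 0) (𝓝 0) := by
    have : Tendsto F (𝓝 0) (𝓝 0) := by simpa [ContinuousAt, hF0] using hF
    exact (continuous_fst.tendsto (0 : ℂ × ℂ)).comp (this.comp hz0)
  have hpP0 : Tendsto (fun x : ℂ => pP.eval x) (𝓝 0) (𝓝 0) := by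
    have h3 := pP.continuous.tendsto 0
    have : pP.eval 0 = 0 := by
      rw [hpP, ← heval, hγ0]
      have : (![(0 : ℂ), 0] : Fin 2 → ℂ) = 0 := by funext i; fin_cases i <;> rfl
      rw [this, MvPolynomial.eval_zero, MvPowerSeries.constantCoeff_truncTotal_eq_ite, kP, ite_self]
    rwa [this] at h3
  have h3 : (fun x : ℂ => γ.eval (F (x, γ.eval x)).1 - γ.eval (pP.eval x)) =O[𝓝 0]
      fun x => x ^ M := by
    have hstr : HasStrictDerivAt (fun x => γ.eval x) (γ.derivative.eval 0) 0 :=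
      γ.hasStrictDerivAt 0
    have := hstr.hasStrictFDerivAt.isBigO_sub.comp_tendsto (hF1.prodMk_nhds hpP0)
    exact this.trans h1
  have h4 : (fun x : ℂ => (pQ - γ.comp pP).eval x) =O[𝓝 0] fun x => x ^ M := by
    obtain ⟨g, hg⟩ := hdvd
    rw [hg]
    simp only [Polynomial.eval_mul, Polynomial.eval_pow, Polynomial.eval_X]
    have h5 : (fun x : ℂ => g.eval x) =O[𝓝 0] fun _ => (1 : ℂ) :=
      g.continuous.continuousAt.isBigO_one ℂ
    simpa using (Asymptotics.isBigO_refl (fun x : ℂ => x ^ M) (𝓝 0)).mul h5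
  -- The defect is the error in the second component, minus the error in the first transported by
  -- `γ`, plus the polynomial defect.
  refine ((h2.sub h3).add h4).congr_left fun x => ?_
  rw [Polynomial.eval_sub, Polynomial.eval_comp]
  ring

/-! ### Invariant graphs of a fibred map -/

/-- This is the source of every contraction below. A shift by `1 / 2` multiplies `s⁻¹ ^ L` by
roughly `1 - L / (2 s)`, while the fibre expansion and the error terms cost only a bounded multiple
of `1 / s`. -/
theorem inv_add_half_pow_bound {c s : ℝ} {L : ℕ} (hc : 0 ≤ c) (hs : 0 < s)
    (hL : 4 * c + 28 ≤ L) (hLs : (L : ℝ) ≤ 2 * s) :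
    (1 + c / s) * ((s + 1 / 2)⁻¹ ^ L * (1 + 2 / s) + 5 / s * s⁻¹ ^ L) ≤ s⁻¹ ^ L := by
  set u := s⁻¹ with hu
  have hu0 : 0 < u := inv_pos.2 hs
  have hsu : s * u = 1 := mul_inv_cancel₀ hs.ne'
  have hLu : (L : ℝ) * u ≤ 2 := by nlinarith
  have hber : 1 + (L : ℝ) * (u / 2) ≤ (1 + u / 2) ^ L :=
    one_add_mul_le_pow (by linarith) L
  have hLu0 : 0 ≤ (L : ℝ) * u := by positivity
  have h1 : (s + 1 / 2)⁻¹ ^ L ≤ u ^ L * (1 - L * u / 4) := by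
    have : (s + 1 / 2)⁻¹ = u * (1 + u / 2)⁻¹ := by
      rw [hu, ← mul_inv]; congr 1; field_simp
    rw [this, mul_pow]
    refine mul_le_mul_of_nonneg_left ?_ (by positivity)
    rw [inv_pow, inv_le_iff_one_le_mul₀ (by positivity)]
    -- With `t = L u` the product is `1 + t / 4 - t ^ 2 / 8`, at least `1` precisely because `t ≤
    -- 2`.
    calc (1 : ℝ) ≤ (1 - L * u / 4) * (1 + L * (u / 2)) := by nlinarith
      _ ≤ _ := mul_le_mul_of_nonneg_left hber (by linarith)
  have e1 : c / s = c * u := rfl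
  have e2 : 2 / s = 2 * u := rfl
  have e3 : 5 / s = 5 * u := rfl
  rw [e1, e2, e3]
  have hcu : 0 ≤ c * u := by positivity
  -- The gain `L u / 4` has to absorb `2 u`, `5 u` and `c u`, whence the requirement `L ≥ 4 c + 28`.
  have hb : (1 - L * u / 4) * (1 + 2 * u) + 5 * u ≤ 1 - c * u := by nlinarith
  calc (1 + c * u) * ((s + 1 / 2)⁻¹ ^ L * (1 + 2 * u) + 5 * u * u ^ L)
      ≤ (1 + c * u) * (u ^ L * (1 - L * u / 4) * (1 + 2 * u) + 5 * u * u ^ L) := by gcongr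
    _ = u ^ L * ((1 + c * u) * ((1 - L * u / 4) * (1 + 2 * u) + 5 * u)) := by ring
    _ ≤ u ^ L * ((1 + c * u) * (1 - c * u)) := by gcongr
    _ ≤ u ^ L * 1 := by gcongr; nlinarith
    _ = _ := mul_one _

/-- A map `(w, y) ↦ (w + 1 + H w y, y')`, with `y = e w * (y' - r w y)`, over a convex region `W` of a
right half-plane, that expands the fibres up to a factor `1 + O(1 / re w)` and leaves the zero section
almost invariant. -/
structure FibredMap (W : Set ℂ) (e : ℂ → ℂ) (H r : ℂ → ℂ → ℂ) (c s₀ : ℝ) (L : ℕ) : Prop where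
  isOpen : IsOpen W
  one_le : 4 ≤ s₀
  c_nonneg : 0 ≤ c
  c_le : 4 * c + 28 ≤ L
  L_le : (L : ℝ) + 2 ≤ 2 * s₀
  lt_re : ∀ w ∈ W, s₀ < w.re
  mapsTo : ∀ w ∈ W, ∀ y : ℂ, ‖y‖ ≤ w.re⁻¹ ^ (L + 2) →
    w + 1 + H w y ∈ W ∧ w.re + 1 / 2 ≤ (w + 1 + H w y).re
  norm_e : ∀ w ∈ W, ‖e w‖ ≤ 1 + c / w.re
  lip_e : ∀ w ∈ W, ∀ w' ∈ W, ‖e w - e w'‖ ≤ ‖w - w'‖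
  lip_H : ∀ s, s₀ ≤ s → ∀ w ∈ W, ∀ w' ∈ W, s ≤ w.re → s ≤ w'.re → ∀ y y' : ℂ,
    ‖y‖ ≤ s⁻¹ ^ (L + 2) → ‖y'‖ ≤ s⁻¹ ^ (L + 2) →
    ‖H w y - H w' y'‖ ≤ s⁻¹ * ‖w - w'‖ + s * ‖y - y'‖
  norm_r : ∀ w ∈ W, ‖r w 0‖ ≤ w.re⁻¹ ^ (L + 3)
  lip_r : ∀ s, s₀ ≤ s → ∀ w ∈ W, ∀ w' ∈ W, s ≤ w.re → s ≤ w'.re → ∀ y y' : ℂ,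
    ‖y‖ ≤ s⁻¹ ^ (L + 2) → ‖y'‖ ≤ s⁻¹ ^ (L + 2) →
    ‖r w y - r w' y'‖ ≤ s⁻¹ * ‖y - y'‖ + s⁻¹ ^ (L + 2) * ‖w - w'‖
  diff_e : DifferentiableOn ℂ e W
  diff_comp : ∀ φ : ℂ → ℂ, DifferentiableOn ℂ φ W → (∀ w ∈ W, ‖φ w‖ ≤ w.re⁻¹ ^ (L + 2)) →
    DifferentiableOn ℂ (fun w => H w (φ w)) W ∧ DifferentiableOn ℂ (fun w => r w (φ w)) W

/-- Small functions with small Lipschitz constant. -/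
structure SlowGraph (W : Set ℂ) (s₀ : ℝ) (L : ℕ) (φ : ℂ → ℂ) : Prop where
  diff : DifferentiableOn ℂ φ W
  norm_le : ∀ w ∈ W, ‖φ w‖ ≤ w.re⁻¹ ^ (L + 2)
  lip : ∀ s, s₀ ≤ s → ∀ w ∈ W, ∀ w' ∈ W, s ≤ w.re → s ≤ w'.re →
    ‖φ w - φ w'‖ ≤ s⁻¹ ^ L * ‖w - w'‖

/-- The graph transform: the preimage of the graph of `φ`, computed with the fibre coordinate `φ w`. -/
def graphTransform (e : ℂ → ℂ) (H r : ℂ → ℂ → ℂ) (φ : ℂ → ℂ) (w : ℂ) : ℂ :=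
  e w * (φ (w + 1 + H w (φ w)) - r w (φ w))

namespace FibredMap

variable {W : Set ℂ} {e : ℂ → ℂ} {H r : ℂ → ℂ → ℂ} {c s₀ : ℝ} {L : ℕ}

theorem s₀_pos (D : FibredMap W e H r c s₀ L) : 0 < s₀ := by linarith [D.one_le]

theorem re_pos (D : FibredMap W e H r c s₀ L) {w : ℂ} (hw : w ∈ W) : 0 < w.re :=
  D.s₀_pos.trans (D.lt_re w hw)

theorem slowGraph_zero (D : FibredMap W e H r c s₀ L) : SlowGraph W s₀ L 0 where
  diff := differentiableOn_const 0
  norm_le w hw := by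
    have := D.re_pos hw
    simp only [Pi.zero_apply, norm_zero]; positivity
  lip s hs w _ w' _ _ _ := by
    have : 0 < s := D.s₀_pos.trans_le hs
    simp only [Pi.zero_apply, sub_self, norm_zero]; positivity

theorem inv_pow_le {s x : ℝ} (hs : 0 < s) (hx : s ≤ x) (n : ℕ) : x⁻¹ ^ n ≤ s⁻¹ ^ n := by
  have : 0 < x := hs.trans_le hx
  gcongr

/-- One step of the fibred map, compared with a slow graph. -/
theorem transform_sub_le (D : FibredMap W e H r c s₀ L) {φ : ℂ → ℂ} (hφ : SlowGraph W s₀ L φ)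
    {w : ℂ} (hw : w ∈ W) {y : ℂ} (hy : ‖y‖ ≤ w.re⁻¹ ^ (L + 2)) (Y : ℂ) :
    ‖graphTransform e H r φ w - e w * (Y - r w y)‖ ≤
      (1 + c / w.re) * (‖φ (w + 1 + H w y) - Y‖ + 2 / w.re * ‖φ w - y‖) := by
  have hs := D.re_pos hw
  set s := w.re with hsdef
  have hs0 : s₀ ≤ s := (D.lt_re w hw).le
  have hφw := hφ.norm_le w hw
  obtain ⟨m1, m1'⟩ := D.mapsTo w hw _ hφw
  obtain ⟨m2, m2'⟩ := D.mapsTo w hw _ hy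
  have h1 := hφ.lip s hs0 _ m1 _ m2 (by linarith) (by linarith)
  have h2 := D.lip_H s hs0 w hw w hw le_rfl le_rfl _ _ hφw hy
  have h3 := D.lip_r s hs0 w hw w hw le_rfl le_rfl _ _ hφw hy
  simp only [sub_self, norm_zero, mul_zero, zero_add, add_zero] at h2 h3
  -- Here `s⁻¹ ^ L` is the Lipschitz constant of `φ`, and `s` that of `H` along the fibre.
  have h4 : s⁻¹ ^ L * s ≤ s⁻¹ := by
    have hL : 2 ≤ L := by
      have := D.c_le; have := D.c_nonneg
      have : (28 : ℝ) ≤ L := by linarith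
      have : 28 ≤ L := by exact_mod_cast this
      omega
    have h1s : s⁻¹ ≤ 1 := inv_le_one_of_one_le₀ (by linarith [D.one_le])
    calc s⁻¹ ^ L * s ≤ s⁻¹ ^ 2 * s :=
          mul_le_mul_of_nonneg_right (pow_le_pow_of_le_one (by positivity) h1s hL) hs.le
      _ = s⁻¹ := by field_simp
  have h5 : ‖φ (w + 1 + H w (φ w)) - φ (w + 1 + H w y)‖ ≤ s⁻¹ * ‖φ w - y‖ := by
    refine h1.trans ?_
    rw [add_sub_add_left_eq_sub]
    calc s⁻¹ ^ L * ‖H w (φ w) - H w y‖ ≤ s⁻¹ ^ L * (s * ‖φ w - y‖) := by gcongr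
      _ = s⁻¹ ^ L * s * ‖φ w - y‖ := by ring
      _ ≤ _ := by gcongr
  have key : graphTransform e H r φ w - e w * (Y - r w y) =
      e w * ((φ (w + 1 + H w (φ w)) - φ (w + 1 + H w y)) + (φ (w + 1 + H w y) - Y)
        - (r w (φ w) - r w y)) := by
    unfold graphTransform; ring
  rw [key, norm_mul]
  have hc := D.c_nonneg
  refine mul_le_mul (D.norm_e w hw) ?_ (norm_nonneg _) (by positivity)
  refine (norm_sub_le _ _).trans ((add_le_add (norm_add_le _ _) le_rfl).trans ?_)
  have : 2 / s * ‖φ w - y‖ = s⁻¹ * ‖φ w - y‖ + s⁻¹ * ‖φ w - y‖ := by rw [div_eq_mul_inv]; ring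
  linarith

theorem slowGraph_transform (D : FibredMap W e H r c s₀ L) {φ : ℂ → ℂ}
    (hφ : SlowGraph W s₀ L φ) : SlowGraph W s₀ L (graphTransform e H r φ) := by
  have hc := D.c_nonneg
  have hr : ∀ s, s₀ ≤ s → ∀ w ∈ W, s ≤ w.re →
      ‖r w (φ w)‖ ≤ 2 * s⁻¹ * s⁻¹ ^ (L + 2) := by
    intro s hs w hw hsw
    have hs0 : 0 < s := D.s₀_pos.trans_le hs
    have hφw := (hφ.norm_le w hw).trans (inv_pow_le hs0 hsw _)
    have h0 := (D.norm_r w hw).trans (inv_pow_le hs0 hsw _)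
    have h1 := D.lip_r s hs w hw w hw hsw hsw _ 0 hφw (by simp; positivity)
    simp only [sub_self, norm_zero, mul_zero, add_zero, sub_zero] at h1
    calc ‖r w (φ w)‖ = ‖(r w (φ w) - r w 0) + r w 0‖ := by ring_nf
      _ ≤ s⁻¹ * s⁻¹ ^ (L + 2) + s⁻¹ ^ (L + 3) := by
          refine (norm_add_le _ _).trans (add_le_add (h1.trans ?_) h0); gcongr
      _ = _ := by ring
  have hf : ∀ s, s₀ ≤ s → ∀ w ∈ W, s ≤ w.re →
      ‖φ (w + 1 + H w (φ w))‖ ≤ (s + 1 / 2)⁻¹ ^ (L + 2) := by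
    intro s hs w hw hsw
    have hs0 : 0 < s := D.s₀_pos.trans_le hs
    obtain ⟨m1, m2⟩ := D.mapsTo w hw _ (hφ.norm_le w hw)
    exact (hφ.norm_le _ m1).trans (inv_pow_le (by linarith) (by linarith) _)
  refine ⟨?_, ?_, ?_⟩
  · obtain ⟨d1, d2⟩ := D.diff_comp φ hφ.diff hφ.norm_le
    refine D.diff_e.mul (DifferentiableOn.sub ?_ d2)
    refine hφ.diff.comp ((differentiableOn_id.add_const 1).add d1) ?_
    intro w hw
    exact (D.mapsTo w hw _ (hφ.norm_le w hw)).1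
  · intro w hw
    have hs := D.re_pos hw
    have hs0 := (D.lt_re w hw).le
    have h1 := hf w.re hs0 w hw le_rfl
    have h2 := hr w.re hs0 w hw le_rfl
    unfold graphTransform
    rw [norm_mul]
    have hL := D.L_le
    -- The size is controlled with exponent `L + 2` and the Lipschitz constant, further on, with
    -- exponent `L`. The margin pays for the variation of `e`, which multiplies the function itself.
    have key := inv_add_half_pow_bound (L := L + 2) hc hs
      (by push_cast; linarith [D.c_le]) (by push_cast; linarith)
    refine le_trans ?_ key
    refine mul_le_mul (D.norm_e w hw) ?_ (norm_nonneg _) (by positivity)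
    refine (norm_sub_le _ _).trans (add_le_add (h1.trans ?_) (h2.trans ?_))
    · exact le_mul_of_one_le_right (by positivity) (by simp; positivity)
    · rw [div_eq_mul_inv]; gcongr; norm_num
  · intro s hs w hw w' hw' hsw hsw'
    have hs0 : 0 < s := D.s₀_pos.trans_le hs
    have hs4 : 4 ≤ s := D.one_le.trans hs
    have hφw := (hφ.norm_le w hw).trans (inv_pow_le hs0 hsw _)
    have hφw' := (hφ.norm_le w' hw').trans (inv_pow_le hs0 hsw' _)
    set d := ‖w - w'‖ with hd
    have hL : 2 ≤ L := by
      have := D.c_le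
      have : (28 : ℝ) ≤ L := by linarith
      have : 28 ≤ L := by exact_mod_cast this
      omega
    have h1s : s⁻¹ ≤ 1 := inv_le_one_of_one_le₀ (by linarith)
    have hφd := hφ.lip s hs w hw w' hw' hsw hsw'
    have hH := D.lip_H s hs w hw w' hw' hsw hsw' _ _ hφw hφw'
    have hR := D.lip_r s hs w hw w' hw' hsw hsw' _ _ hφw hφw'
    have hsL : s * s⁻¹ ^ L ≤ s⁻¹ := by
      calc s * s⁻¹ ^ L ≤ s * s⁻¹ ^ 2 :=
            mul_le_mul_of_nonneg_left (pow_le_pow_of_le_one (by positivity) h1s hL) hs0.le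
        _ = s⁻¹ := by field_simp
    have hHd : ‖H w (φ w) - H w' (φ w')‖ ≤ 2 * s⁻¹ * d := by
      calc _ ≤ s⁻¹ * d + s * (s⁻¹ ^ L * d) := hH.trans (by gcongr)
        _ = s⁻¹ * d + s * s⁻¹ ^ L * d := by ring
        _ ≤ s⁻¹ * d + s⁻¹ * d := by gcongr
        _ = _ := by ring
    have hRd : ‖r w (φ w) - r w' (φ w')‖ ≤ 2 * s⁻¹ * s⁻¹ ^ L * d := by
      have : s⁻¹ ^ (L + 2) ≤ s⁻¹ ^ (L + 1) :=
        pow_le_pow_of_le_one (by positivity) h1s (by omega)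
      calc _ ≤ s⁻¹ * (s⁻¹ ^ L * d) + s⁻¹ ^ (L + 1) * d := hR.trans (by gcongr)
        _ = _ := by ring
    obtain ⟨m1, m1'⟩ := D.mapsTo w hw _ (hφ.norm_le w hw)
    obtain ⟨m2, m2'⟩ := D.mapsTo w' hw' _ (hφ.norm_le w' hw')
    have hfd : ‖φ (w + 1 + H w (φ w)) - φ (w' + 1 + H w' (φ w'))‖ ≤
        (s + 1 / 2)⁻¹ ^ L * ((1 + 2 / s) * d) := by
      refine (hφ.lip (s + 1 / 2) (by linarith) _ m1 _ m2 (by linarith) (by linarith)).trans ?_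
      gcongr
      calc ‖w + 1 + H w (φ w) - (w' + 1 + H w' (φ w'))‖
          = ‖(w - w') + (H w (φ w) - H w' (φ w'))‖ := by ring_nf
        _ ≤ d + 2 * s⁻¹ * d := (norm_add_le _ _).trans (add_le_add le_rfl hHd)
        _ = _ := by rw [div_eq_mul_inv]; ring
    have e0 : graphTransform e H r φ w - graphTransform e H r φ w' =
        (e w - e w') * (φ (w + 1 + H w (φ w)) - r w (φ w)) +
        e w' * ((φ (w + 1 + H w (φ w)) - φ (w' + 1 + H w' (φ w')))
          - (r w (φ w) - r w' (φ w'))) := by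
      unfold graphTransform; ring
    have b1 : ‖φ (w + 1 + H w (φ w)) - r w (φ w)‖ ≤ s⁻¹ * s⁻¹ ^ L := by
      have a1 := hf s hs w hw hsw
      have a2 := hr s hs w hw hsw
      have a3 : (s + 1 / 2)⁻¹ ^ (L + 2) ≤ s⁻¹ ^ (L + 2) := inv_pow_le hs0 (by linarith) _
      have a4 : 4 * s⁻¹ ≤ 1 := by
        rw [← div_eq_mul_inv, div_le_one hs0]; exact hs4
      have a5 : s⁻¹ ^ (L + 2) = s⁻¹ * (s⁻¹ * s⁻¹ ^ L) := by ring
      have a6 : 0 < s⁻¹ * s⁻¹ ^ L := by positivity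
      refine (norm_sub_le _ _).trans ?_
      rw [a5] at a3 a2
      have a7 : 0 < s⁻¹ := by positivity
      have a8 := mul_le_mul_of_nonneg_right a4 a6.le
      have a9 := mul_le_mul_of_nonneg_right a4 (mul_pos a7 a6).le
      nlinarith
    have b2 : ‖e w'‖ ≤ 1 + c / s := (D.norm_e w' hw').trans (by gcongr)
    rw [e0]
    refine (norm_add_le _ _).trans ?_
    rw [norm_mul, norm_mul]
    have b3 : 1 ≤ 1 + c / s := by simp; positivity
    have key := inv_add_half_pow_bound (L := L) hc hs0 D.c_le (by linarith [D.L_le])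
    calc _ ≤ d * (s⁻¹ * s⁻¹ ^ L) + (1 + c / s) * ((s + 1 / 2)⁻¹ ^ L * ((1 + 2 / s) * d) +
            2 * s⁻¹ * s⁻¹ ^ L * d) := by
          refine add_le_add (mul_le_mul (D.lip_e w hw w' hw') b1 (norm_nonneg _) (norm_nonneg _)) ?_
          exact mul_le_mul b2 ((norm_sub_le _ _).trans (add_le_add hfd hRd)) (norm_nonneg _)
            (by positivity)
      _ ≤ (1 + c / s) * (d * (s⁻¹ * s⁻¹ ^ L)) + (1 + c / s) * ((s + 1 / 2)⁻¹ ^ L * ((1 + 2 / s) * d)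
            + 2 * s⁻¹ * s⁻¹ ^ L * d) := by
          exact add_le_add (le_mul_of_one_le_left (by positivity) b3) le_rfl
      _ = (1 + c / s) * ((s + 1 / 2)⁻¹ ^ L * (1 + 2 / s) + 3 / s * s⁻¹ ^ L) * d := by
          rw [div_eq_mul_inv 3]; ring
      _ ≤ (1 + c / s) * ((s + 1 / 2)⁻¹ ^ L * (1 + 2 / s) + 5 / s * s⁻¹ ^ L) * d := by
          gcongr; norm_num
      _ ≤ _ := by gcongr

theorem slowGraph_iterate (D : FibredMap W e H r c s₀ L) (n : ℕ) :
    SlowGraph W s₀ L ((graphTransform e H r)^[n] 0) := by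
  induction n with
  | zero => exact D.slowGraph_zero
  | succ n ih => rw [Function.iterate_succ_apply']; exact D.slowGraph_transform ih

/-- The weight `L` makes the step non-expanding, and the additional factor of exponent two records
the displacement: each increment is governed by the previous one at a point at least `1 / 2` further
right. After `n` steps this yields the decay `n ^ (-2)`, hence summability. -/
theorem norm_iterate_sub_le (D : FibredMap W e H r c s₀ L) (n : ℕ) : ∀ w ∈ W,
    ‖(graphTransform e H r)^[n + 1] 0 w - (graphTransform e H r)^[n] 0 w‖ ≤
      2 * w.re⁻¹ ^ L * (w.re + n / 2)⁻¹ ^ 2 := by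
  induction n with
  | zero =>
    intro w hw
    have hs := D.re_pos hw
    have h := (D.slowGraph_iterate 1).norm_le w hw
    have e0 : (graphTransform e H r)^[0] 0 w = 0 := rfl
    rw [e0, sub_zero, zero_add]
    refine h.trans ?_
    have : 0 ≤ w.re⁻¹ ^ (L + 2) := by positivity
    calc w.re⁻¹ ^ (L + 2) ≤ 2 * w.re⁻¹ ^ (L + 2) := by linarith
      _ = _ := by simp; ring
  | succ n ih =>
    intro w hw
    have hs := D.re_pos hw
    have hc := D.c_nonneg
    set φ₁ := (graphTransform e H r)^[n + 1] 0 with hφ1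
    set φ₀ := (graphTransform e H r)^[n] 0 with hφ0
    have g1 : SlowGraph W s₀ L φ₁ := D.slowGraph_iterate _
    have g0 : SlowGraph W s₀ L φ₀ := D.slowGraph_iterate _
    have h := D.transform_sub_le g1 hw (g0.norm_le w hw) (φ₀ (w + 1 + H w (φ₀ w)))
    rw [Function.iterate_succ_apply' _ (n + 1), ← hφ1]
    have e1 : φ₁ w = e w * (φ₀ (w + 1 + H w (φ₀ w)) - r w (φ₀ w)) := by
      rw [hφ1, Function.iterate_succ_apply']; rfl
    rw [← e1] at h
    refine h.trans ?_
    obtain ⟨m1, m2⟩ := D.mapsTo w hw _ (g0.norm_le w hw)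
    set s := w.re
    set T : ℝ := (s + (n + 1 : ℕ) / 2)⁻¹ ^ 2 with hT
    have hTp : 0 < T := by positivity
    have i1 : ‖φ₁ (w + 1 + H w (φ₀ w)) - φ₀ (w + 1 + H w (φ₀ w))‖ ≤
        2 * (s + 1 / 2)⁻¹ ^ L * T := by
      refine (ih _ m1).trans ?_
      have : s + (n + 1 : ℕ) / 2 ≤ (w + 1 + H w (φ₀ w)).re + n / 2 := by push_cast; linarith
      have m3 : s + 1 / 2 ≤ (w + 1 + H w (φ₀ w)).re := m2
      rw [hT]
      exact mul_le_mul (mul_le_mul_of_nonneg_left (inv_pow_le (by linarith) m3 L) (by norm_num))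
        (inv_pow_le (by positivity) this 2) (by positivity) (by positivity)
    have i2 : ‖φ₁ w - φ₀ w‖ ≤ 2 * s⁻¹ ^ L * (2 * T) := by
      refine (ih _ hw).trans ?_
      have hn : (0 : ℝ) ≤ n := Nat.cast_nonneg n
      have h4 : 4 ≤ s := D.one_le.trans (D.lt_re w hw).le
      -- This error term is evaluated at `w` itself and gains nothing from the displacement; since
      -- `s ≥ 4`, replacing the weight by the next one costs at most a factor `2`.
      have : (s + (n : ℝ) / 2)⁻¹ ^ 2 ≤ 2 * T := by
        rw [hT, inv_pow, inv_pow, inv_le_iff_one_le_mul₀ (by positivity), ← div_eq_mul_inv,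
          div_mul_eq_mul_div, one_le_div (by positivity)]
        push_cast
        nlinarith
      gcongr
    have key := inv_add_half_pow_bound (L := L) hc hs D.c_le (by linarith [D.L_le, D.lt_re w hw])
    calc _ ≤ (1 + c / s) * (2 * (s + 1 / 2)⁻¹ ^ L * T + 2 / s * (2 * s⁻¹ ^ L * (2 * T))) := by
          gcongr
      _ = (1 + c / s) * ((s + 1 / 2)⁻¹ ^ L * 1 + 4 / s * s⁻¹ ^ L) * (2 * T) := by ring
      _ ≤ (1 + c / s) * ((s + 1 / 2)⁻¹ ^ L * (1 + 2 / s) + 5 / s * s⁻¹ ^ L) * (2 * T) := by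
          have : (1 : ℝ) ≤ 1 + 2 / s := by simp; positivity
          gcongr; norm_num
      _ ≤ s⁻¹ ^ L * (2 * T) := by gcongr
      _ = _ := by ring

/-- The graph transform has a slow fixed graph. -/
theorem exists_fixed (D : FibredMap W e H r c s₀ L) :
    ∃ φ, SlowGraph W s₀ L φ ∧ ∀ w ∈ W, graphTransform e H r φ w = φ w := by
  set T := graphTransform e H r with hT
  have hbound : ∀ (n : ℕ) (w : ℂ), w ∈ W →
      ‖(T^[n + 1] 0) w - (T^[n] 0) w‖ ≤ 8 * (1 / ((n : ℝ) + 1) ^ 2) := by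
    intro n w hw
    have hs := D.re_pos hw
    have h4 : 4 ≤ w.re := D.one_le.trans (D.lt_re w hw).le
    refine (D.norm_iterate_sub_le n w hw).trans ?_
    have h1 : w.re⁻¹ ^ L ≤ 1 :=
      pow_le_one₀ (by positivity) (inv_le_one_of_one_le₀ (by linarith))
    have h2 : (w.re + n / 2)⁻¹ ^ 2 ≤ 4 * (1 / ((n : ℝ) + 1) ^ 2) := by
      have : 0 ≤ (n : ℝ) := Nat.cast_nonneg n
      rw [inv_pow, inv_le_iff_one_le_mul₀ (by positivity), mul_one_div, div_mul_eq_mul_div,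
        one_le_div (by positivity)]
      nlinarith
    calc _ ≤ 2 * 1 * (4 * (1 / ((n : ℝ) + 1) ^ 2)) := by gcongr
      _ = _ := by ring
  have hsum : Summable fun n : ℕ => 8 * (1 / ((n : ℝ) + 1) ^ 2) := by
    refine Summable.mul_left _ ?_
    have := (summable_nat_add_iff 1).2 (Real.summable_one_div_nat_pow.2 (one_lt_two))
    simpa using this
  have hu := tendstoUniformlyOn_tsum_nat hsum hbound
  set φ : ℂ → ℂ := fun w => ∑' n, ((T^[n + 1] 0) w - (T^[n] 0) w) with hφ
  have hu' : TendstoUniformlyOn (fun n => T^[n] 0) φ atTop W := by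
    refine hu.congr (Eventually.of_forall fun n w _ => ?_)
    simp only
    rw [Finset.sum_range_sub (fun n => (T^[n] 0) w)]
    simp
  have hpt : ∀ w ∈ W, Tendsto (fun n => (T^[n] 0) w) atTop (𝓝 (φ w)) := fun w hw =>
    hu'.tendsto_at hw
  have hφs : SlowGraph W s₀ L φ := by
    refine ⟨?_, ?_, ?_⟩
    · exact hu'.tendstoLocallyUniformlyOn.differentiableOn
        (Eventually.of_forall fun n => (D.slowGraph_iterate n).diff) D.isOpen
    · intro w hw
      exact le_of_tendsto (hpt w hw).norm
        (Eventually.of_forall fun n => (D.slowGraph_iterate n).norm_le w hw)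
    · intro s hs w hw w' hw' h h'
      exact le_of_tendsto ((hpt w hw).sub (hpt w' hw')).norm
        (Eventually.of_forall fun n => (D.slowGraph_iterate n).lip s hs w hw w' hw' h h')
  refine ⟨φ, hφs, fun w hw => ?_⟩
  have hs := D.re_pos hw
  -- The image point `w + 1 + H w (φₙ w)` moves with `n`, so pointwise convergence would not suffice
  -- there; the tail of the dominating series bounds `φ - φₙ` uniformly on `W`.
  have hlim : Tendsto (fun n => (T^[n + 1] 0) w) atTop (𝓝 (T φ w)) := by
    rw [tendsto_iff_norm_sub_tendsto_zero]
    have hz : Tendsto (fun n => (1 + c / w.re) * ((8 * ∑' k, (1 / (((k + n : ℕ) : ℝ) + 1) ^ 2)) +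
        2 / w.re * ‖φ w - (T^[n] 0) w‖)) atTop (𝓝 ((1 + c / w.re) * (8 * 0 + 2 / w.re * 0))) := by
      refine Tendsto.const_mul _ (Tendsto.add (Tendsto.const_mul _ ?_) (Tendsto.const_mul _ ?_))
      · exact tendsto_sum_nat_add (fun k : ℕ => 1 / ((k : ℝ) + 1) ^ 2)
      · rw [← norm_zero (E := ℂ), ← sub_self (φ w)]
        exact (tendsto_const_nhds.sub (hpt w hw)).norm
    rw [mul_zero, mul_zero, add_zero, mul_zero] at hz
    refine squeeze_zero (fun _ => norm_nonneg _) (fun n => ?_) hz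
    have gn := D.slowGraph_iterate n
    have h := D.transform_sub_le hφs hw (gn.norm_le w hw) ((T^[n] 0) (w + 1 + H w ((T^[n] 0) w)))
    rw [norm_sub_rev, Function.iterate_succ_apply']
    refine h.trans ?_
    have hc := D.c_nonneg
    gcongr
    obtain ⟨m, -⟩ := D.mapsTo w hw _ (gn.norm_le w hw)
    set w' := w + 1 + H w ((T^[n] 0) w)
    have hs1 : Summable fun k : ℕ => (T^[k + 1] 0) w' - (T^[k] 0) w' :=
      Summable.of_norm_bounded hsum fun k => hbound k w' m
    have e1 : φ w' - (T^[n] 0) w' = ∑' k, ((T^[k + n + 1] 0) w' - (T^[k + n] 0) w') := by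
      rw [hφ]
      simp only
      rw [← hs1.sum_add_tsum_nat_add n, Finset.sum_range_sub (fun n => (T^[n] 0) w')]
      simp
    rw [e1, ← tsum_mul_left]
    refine tsum_of_norm_bounded ((summable_nat_add_iff n).2 hsum).hasSum fun k => ?_
    exact hbound (k + n) w' m
  exact tendsto_nhds_unique hlim ((tendsto_add_atTop_iff_nat 1).2 (hpt w hw))

/-- An orbit that stays close to the zero section lies on the fixed graph. -/
theorem eq_of_orbit (D : FibredMap W e H r c s₀ L) {φ : ℂ → ℂ} (hφ : SlowGraph W s₀ L φ)
    (hfix : ∀ w ∈ W, graphTransform e H r φ w = φ w) {w y : ℕ → ℂ} (hw : ∀ n, w n ∈ W)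
    (hy : ∀ n, ‖y n‖ ≤ (w n).re⁻¹ ^ (L + 2)) (hw' : ∀ n, w (n + 1) = w n + 1 + H (w n) (y n))
    (hy' : ∀ n, y n = e (w n) * (y (n + 1) - r (w n) (y n))) : y 0 = φ (w 0) := by
  have hc := D.c_nonneg
  set u : ℕ → ℝ := fun n => ‖φ (w n) - y n‖ with hu
  have hre : ∀ n, (w n).re + 1 / 2 ≤ (w (n + 1)).re := fun n => by
    rw [hw' n]; exact (D.mapsTo _ (hw n) _ (hy n)).2
  have hgrow : ∀ n : ℕ, (n : ℝ) / 2 ≤ (w n).re := by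
    intro n
    induction n with
    | zero => simpa using (D.re_pos (hw 0)).le
    | succ n ih => push_cast; linarith [hre n]
  -- Measured in the weight `re ^ L`, the distance to the fixed graph cannot decrease along the
  -- orbit. Both the orbit and the graph are of size `re ^ (-L-2)`, so the weighted distance also
  -- tends to `0`, and it must vanish from the beginning.
  have hmono : ∀ n, u 0 * (w 0).re ^ L ≤ u n * (w n).re ^ L := by
    intro n
    induction n with
    | zero => exact le_rfl
    | succ n ih =>
      refine ih.trans ?_
      have h := D.transform_sub_le hφ (hw n) (hy n) (y (n + 1))
      rw [hfix _ (hw n), ← hy' n, ← hw' n] at h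
      have hs := D.re_pos (hw n)
      set s := (w n).re
      have key := inv_add_half_pow_bound (L := L) hc hs D.c_le
        (by linarith [D.L_le, D.lt_re _ (hw n)])
      change u n ≤ (1 + c / s) * (u (n + 1) + 2 / s * u n) at h
      have hun : 0 ≤ u n := norm_nonneg _
      have hun1 : 0 ≤ u (n + 1) := norm_nonneg _
      set P := s ^ L with hP
      set Q := (s + 1 / 2) ^ L with hQ
      have hPp : 0 < P := by positivity
      have hQp : 0 < Q := by positivity
      have hQw : Q ≤ (w (n + 1)).re ^ L := pow_le_pow_left₀ (by positivity) (hre n) _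
      rw [inv_pow, inv_pow, ← hP, ← hQ] at key
      by_contra hcon
      push Not at hcon
      have h1 : u (n + 1) * Q < u n * P := lt_of_le_of_lt (by gcongr) hcon
      have h2 : u (n + 1) < u n * P * Q⁻¹ := by
        rw [← div_eq_mul_inv, lt_div_iff₀ hQp]; exact h1
      have hpos : 0 < 1 + c / s := by positivity
      have h3 : u n < (1 + c / s) * (u n * P * Q⁻¹ + 2 / s * u n) :=
        h.trans_lt (by gcongr)
      have h4 : (1 + c / s) * (u n * P * Q⁻¹ + 2 / s * u n) ≤
          (1 + c / s) * (Q⁻¹ * (1 + 2 / s) + 5 / s * P⁻¹) * (u n * P) := by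
        have : (1 + c / s) * (Q⁻¹ * (1 + 2 / s) + 5 / s * P⁻¹) * (u n * P) =
          (1 + c / s) * (u n * P * Q⁻¹ * (1 + 2 / s) + 5 / s * u n) := by
          field_simp
        rw [this]
        have : u n * P * Q⁻¹ ≤ u n * P * Q⁻¹ * (1 + 2 / s) :=
          le_mul_of_one_le_right (by positivity) (by simp; positivity)
        gcongr; norm_num
      have h5 : (1 + c / s) * (Q⁻¹ * (1 + 2 / s) + 5 / s * P⁻¹) * (u n * P) ≤ P⁻¹ * (u n * P) := by
        gcongr
      have h6 : P⁻¹ * (u n * P) = u n := by field_simp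
      linarith
  have hlim : Tendsto (fun n : ℕ => 2 * ((n : ℝ) / 2)⁻¹ ^ 2) atTop (𝓝 0) := by
    have h2 : Tendsto (fun n : ℕ => (n : ℝ) / 2) atTop atTop :=
      tendsto_natCast_atTop_atTop.atTop_div_const (by norm_num)
    have := ((tendsto_inv_atTop_zero.comp h2).pow 2).const_mul 2
    simpa using this
  have hle : u 0 * (w 0).re ^ L ≤ 0 := by
    refine ge_of_tendsto hlim ?_
    filter_upwards [eventually_gt_atTop 0] with n hn
    refine (hmono n).trans ?_
    have hs := D.re_pos (hw n)
    have h1 : u n ≤ 2 * (w n).re⁻¹ ^ (L + 2) := by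
      refine (norm_sub_le _ _).trans ?_
      linarith [hφ.norm_le _ (hw n), hy n]
    have hn' : (0 : ℝ) < n := by exact_mod_cast hn
    calc u n * (w n).re ^ L ≤ 2 * (w n).re⁻¹ ^ (L + 2) * (w n).re ^ L := by gcongr
      _ = 2 * (w n).re⁻¹ ^ 2 * ((w n).re⁻¹ * (w n).re) ^ L := by rw [mul_pow]; ring
      _ = 2 * (w n).re⁻¹ ^ 2 := by rw [inv_mul_cancel₀ hs.ne', one_pow, mul_one]
      _ ≤ _ := by gcongr; exact hgrow n
  have hs := D.re_pos (hw 0)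
  have : u 0 = 0 := le_antisymm (by
    by_contra hcon
    push Not at hcon
    have : 0 < u 0 * (w 0).re ^ L := by positivity
    linarith) (norm_nonneg _)
  exact (sub_eq_zero.1 (norm_eq_zero.1 this)).symm

end FibredMap

/-! ### Local estimates for analytic functions -/

theorem eventually_small_of_eventually_nhds {E : Type*} [SeminormedAddCommGroup E] {P : E → Prop}
    (h : ∀ᶠ z in 𝓝 (0 : E), P z) : ∀ᶠ ρ in 𝓝[>] (0 : ℝ), ∀ z, ‖z‖ < ρ → P z := by
  obtain ⟨ε, hε, hball⟩ := Metric.eventually_nhds_iff.1 h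
  filter_upwards [Ioo_mem_nhdsGT hε] with ρ hρ z hz
  exact hball (by rw [dist_zero_right]; exact hz.trans hρ.2)

theorem AnalyticAt.eventually_lipschitz {E : Type*} [NormedAddCommGroup E] [NormedSpace ℂ E]
    {G : Type*} [NormedAddCommGroup G] [NormedSpace ℂ G] [CompleteSpace G]
    {f : E → G} (hf : AnalyticAt ℂ f 0) : ∃ C : ℝ, 0 ≤ C ∧ ∀ᶠ ρ in 𝓝[>] (0 : ℝ),
      ∀ z z', ‖z‖ < ρ → ‖z'‖ < ρ → ‖f z - f z'‖ ≤ C * ‖z - z'‖ := by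
  obtain ⟨K, s, hs, hK⟩ := hf.hasStrictFDerivAt.exists_lipschitzOnWith
  refine ⟨K, K.2, ?_⟩
  filter_upwards [eventually_small_of_eventually_nhds (P := (· ∈ s)) hs] with ρ hρ z z' hz hz'
  rw [← dist_eq_norm, ← dist_eq_norm]
  exact hK.dist_le_mul z (hρ z hz) z' (hρ z' hz')

theorem AnalyticAt.eventually_norm_le {E : Type*} [NormedAddCommGroup E] [NormedSpace ℂ E]
    {G : Type*} [NormedAddCommGroup G] [NormedSpace ℂ G]
    {f : E → G} (hf : AnalyticAt ℂ f 0) : ∃ C : ℝ, 0 ≤ C ∧ ∀ᶠ ρ in 𝓝[>] (0 : ℝ),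
      ∀ z, ‖z‖ < ρ → ‖f z‖ ≤ C := by
  refine ⟨‖f 0‖ + 1, by positivity, eventually_small_of_eventually_nhds ?_⟩
  filter_upwards [Tendsto.eventually_lt_const (lt_add_one _) hf.continuousAt.norm] with z hz using hz.le

theorem AnalyticAt.eventually_differentiableOn {E : Type*} [NormedAddCommGroup E]
    [NormedSpace ℂ E] {G : Type*} [NormedAddCommGroup G] [NormedSpace ℂ G] [CompleteSpace G]
    {f : E → G} (hf : AnalyticAt ℂ f 0) : ∀ᶠ ρ in 𝓝[>] (0 : ℝ),
      ∀ z, ‖z‖ < ρ → DifferentiableAt ℂ f z := by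
  refine eventually_small_of_eventually_nhds ?_
  filter_upwards [hf.eventually_analyticAt] with z hz using hz.differentiableAt

/-- The mixed second difference of an analytic function of two variables. -/
theorem AnalyticAt.eventually_mixed_difference {f : ℂ × ℂ → ℂ} (hf : AnalyticAt ℂ f 0) :
    ∃ C : ℝ, 0 ≤ C ∧ ∀ᶠ ρ in 𝓝[>] (0 : ℝ), ∀ x x' y : ℂ, ‖x‖ < ρ → ‖x'‖ < ρ → ‖y‖ < ρ →
      ‖(f (x, y) - f (x, 0)) - (f (x', y) - f (x', 0))‖ ≤ C * ‖y‖ * ‖x - x'‖ := by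
  -- The mean value inequality in `x` is applied to `f (·, y) - f (·, 0)`, whose derivative is
  -- `O(‖y‖)` because `fderiv ℂ f` is Lipschitz.
  obtain ⟨C, hC, h⟩ := hf.fderiv.eventually_lipschitz
  refine ⟨C, hC, ?_⟩
  filter_upwards [h, hf.eventually_differentiableOn] with ρ h1 h2 x x' y hx hx' hy
  have hdist : ∀ t : ℂ, ‖(t, y) - ((t, 0) : ℂ × ℂ)‖ = ‖y‖ := by
    intro t; simp [Prod.norm_def]
  have hmem : ∀ t ∈ Metric.ball (0 : ℂ) ρ, ‖((t, y) : ℂ × ℂ)‖ < ρ ∧ ‖((t, 0) : ℂ × ℂ)‖ < ρ := by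
    intro t ht
    rw [mem_ball_zero_iff] at ht
    simp only [Prod.norm_mk, norm_zero, max_lt_iff]
    exact ⟨⟨ht, hy⟩, ht, lt_of_le_of_lt (norm_nonneg _) ht⟩
  have hder : ∀ t ∈ Metric.ball (0 : ℂ) ρ, HasDerivWithinAt (fun t => f (t, y) - f (t, 0))
      ((fderiv ℂ f (t, y) - fderiv ℂ f (t, 0)) (1, 0)) (Metric.ball (0 : ℂ) ρ) t := by
    intro t ht
    obtain ⟨m1, m2⟩ := hmem t ht
    have key : ∀ u : ℂ, DifferentiableAt ℂ f (t, u) →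
        HasDerivAt (fun t => f (t, u)) (fderiv ℂ f (t, u) (1, 0)) t := by
      intro u hu
      exact hu.hasFDerivAt.comp_hasDerivAt t ((hasDerivAt_id t).prodMk (hasDerivAt_const t u))
    exact ((key y (h2 _ m1)).sub (key 0 (h2 _ m2))).hasDerivWithinAt
  refine Convex.norm_image_sub_le_of_norm_hasDerivWithin_le hder (fun t ht => ?_)
    (convex_ball _ _) (mem_ball_zero_iff.2 hx') (mem_ball_zero_iff.2 hx)
  obtain ⟨m1, m2⟩ := hmem t ht
  have h3 := h1 _ _ m1 m2
  rw [hdist] at h3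
  refine (ContinuousLinearMap.le_opNorm _ _).trans ?_
  have : ‖((1, 0) : ℂ × ℂ)‖ = 1 := by simp [Prod.norm_def]
  rw [this, mul_one]
  exact h3

/-- Cauchy's estimate on discs of radius `t` centred in the disc of radius `t`: they stay within
radius `2 t`, so the derivative is at most `C (2 t) ^ (m + 1) / t`. -/
theorem lipschitz_of_norm_le_pow {f : ℂ → ℂ} {C ρ : ℝ} {m : ℕ}
    (hd : ∀ x, ‖x‖ < ρ → DifferentiableAt ℂ f x) (hf : ∀ x, ‖x‖ < ρ → ‖f x‖ ≤ C * ‖x‖ ^ (m + 1))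
    {t : ℝ} (ht : 0 < t) (htρ : 2 * t < ρ) {x x' : ℂ} (hx : ‖x‖ ≤ t) (hx' : ‖x'‖ ≤ t) :
    ‖f x - f x'‖ ≤ C * 2 ^ (m + 1) * t ^ m * ‖x - x'‖ := by
  have hC : 0 ≤ C := by
    have h := (norm_nonneg _).trans (hf (t : ℂ) (by
      rw [Complex.norm_real, Real.norm_of_nonneg ht.le]; linarith))
    rw [Complex.norm_real, Real.norm_of_nonneg ht.le] at h
    exact nonneg_of_mul_nonneg_left h (by positivity)
  have hin : ∀ z ∈ Metric.closedBall (0 : ℂ) t, ∀ u ∈ Metric.closedBall z t, ‖u‖ ≤ 2 * t := by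
    intro z hz u hu
    rw [mem_closedBall_zero_iff] at hz
    rw [mem_closedBall_iff_norm] at hu
    calc ‖u‖ = ‖(u - z) + z‖ := by ring_nf
      _ ≤ _ := (norm_add_le _ _).trans (by linarith)
  refine Convex.norm_image_sub_le_of_norm_deriv_le (s := Metric.closedBall 0 t)
    (fun z hz => hd z ?_) (fun z hz => ?_) (convex_closedBall _ _)
    (mem_closedBall_zero_iff.2 hx') (mem_closedBall_zero_iff.2 hx)
  · rw [mem_closedBall_zero_iff] at hz; linarith
  · have h1 := Complex.norm_deriv_le_of_forall_mem_sphere_norm_le (c := z) (R := t)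
      (C := C * (2 * t) ^ (m + 1)) (f := f) ht ?_ ?_
    · refine h1.trans_eq ?_
      field_simp
      ring
    · refine DifferentiableOn.diffContOnCl fun u hu => ?_
      rw [closure_ball z ht.ne'] at hu
      exact (hd u (by linarith [hin z hz u hu])).differentiableWithinAt
    · intro u hu
      have := hin z hz u (Metric.sphere_subset_closedBall hu)
      refine (hf u (by linarith)).trans ?_
      gcongr

/-- This is the expansion `(1 - v) ^ (-q) = 1 + q v + O(v ^ 2)` with the remainder in closed form;
it computes how `(q x ^ q)⁻¹` changes when `x` becomes `x (1 - v)`. -/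
theorem exists_polynomial_one_sub_pow (q : ℕ) : ∃ p : Polynomial ℂ, ∀ v : ℂ,
    (1 + q * v) * (1 - v) ^ q = 1 - v ^ 2 * p.eval v := by
  induction q with
  | zero => exact ⟨0, fun v => by simp⟩
  | succ q ih =>
    obtain ⟨p, hp⟩ := ih
    obtain ⟨g, hg⟩ := sub_dvd_pow_sub_pow (1 - Polynomial.X : Polynomial ℂ) 1 (q + 1)
    refine ⟨p * (1 - Polynomial.X) + g, fun v => ?_⟩
    have hg' : (1 - v) ^ (q + 1) - 1 = -v * g.eval v := by
      have := congrArg (Polynomial.eval v) hg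
      simpa using this
    simp only [Polynomial.eval_add, Polynomial.eval_mul, Polynomial.eval_sub, Polynomial.eval_one,
      Polynomial.eval_X]
    push_cast
    linear_combination (1 - v) * hp v + v * hg'

/-! ### Normal form along a truncated invariant curve -/

/-- The map `F` in the coordinates `((q x ^ q)⁻¹, y - γ(x))`, `q = k + p`. -/
structure NormalForm (F : ℂ × ℂ → ℂ × ℂ) (U : Set (ℂ × ℂ)) (k p m : ℕ) (μ : ℂ) (a γ : Polynomial ℂ)
    (H r : ℂ × ℂ → ℂ) (C ρ : ℝ) : Prop where
  ρ_pos : 0 < ρ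
  C_nonneg : 0 ≤ C
  mem : ∀ x y : ℂ, ‖x‖ < ρ → ‖y‖ < ρ → (x, y + γ.eval x) ∈ U
  fst_sub : ∀ x y : ℂ, ‖x‖ < ρ → ‖y‖ < ρ →
    ‖(F (x, y + γ.eval x)).1 - x‖ ≤ C * ‖x‖ ^ (k + p + 1)
  coord : ∀ x y : ℂ, ‖x‖ < ρ → ‖y‖ < ρ → x ≠ 0 →
    (((k + p : ℕ) : ℂ) * (F (x, y + γ.eval x)).1 ^ (k + p))⁻¹ =
      (((k + p : ℕ) : ℂ) * x ^ (k + p))⁻¹ + 1 + H (x, y)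
  snd : ∀ x y : ℂ, (F (x, y + γ.eval x)).2 =
      γ.eval (F (x, y + γ.eval x)).1 + (μ * (1 + x ^ k * a.eval x) * y + r (x, y))
  diff_H : ∀ z, ‖z‖ < ρ → DifferentiableAt ℂ H z
  diff_r : ∀ z, ‖z‖ < ρ → DifferentiableAt ℂ r z
  norm_H : ∀ x y : ℂ, ‖x‖ < ρ → ‖y‖ < ρ → ‖H (x, y)‖ ≤ C * (‖x‖ ^ (k + p) + ‖y‖)
  lip_H : ∀ x y x' y' : ℂ, ‖x‖ < ρ → ‖y‖ < ρ → ‖x'‖ < ρ → ‖y'‖ < ρ →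
    ‖H (x, y) - H (x', y')‖ ≤ C * (‖x - x'‖ + ‖y - y'‖)
  norm_r : ∀ x : ℂ, ‖x‖ < ρ → ‖r (x, 0)‖ ≤ C * ‖x‖ ^ (m + 1)
  lip_r_snd : ∀ x y y' : ℂ, ‖x‖ < ρ → ‖y‖ < ρ → ‖y'‖ < ρ →
    ‖r (x, y) - r (x, y')‖ ≤ C * ‖x‖ ^ (k + p + 1) * ‖y - y'‖
  mixed_r : ∀ x x' y : ℂ, ‖x‖ < ρ → ‖x'‖ < ρ → ‖y‖ < ρ →
    ‖(r (x, y) - r (x, 0)) - (r (x', y) - r (x', 0))‖ ≤ C * ‖y‖ * ‖x - x'‖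

theorem norm_prod_lt {x y : ℂ} {ρ : ℝ} (hx : ‖x‖ < ρ) (hy : ‖y‖ < ρ) : ‖((x, y) : ℂ × ℂ)‖ < ρ := by
  rw [Prod.norm_mk]; exact max_lt hx hy

theorem norm_prod_sub_le (x y x' y' : ℂ) :
    ‖((x, y) : ℂ × ℂ) - (x', y')‖ ≤ ‖x - x'‖ + ‖y - y'‖ := by
  rw [Prod.mk_sub_mk, Prod.norm_mk]
  exact max_le (by linarith [norm_nonneg (y - y')]) (by linarith [norm_nonneg (x - x')])

theorem eval_zero_of_X_pow_dvd {q : ℕ} (hq : q ≠ 0) {γ : Polynomial ℂ}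
    (hγ : Polynomial.X ^ q ∣ γ) : γ.eval 0 = 0 := by
  obtain ⟨g, rfl⟩ := hγ
  simp [zero_pow hq]

theorem analyticAt_graph_shear (γ : Polynomial ℂ) :
    AnalyticAt ℂ (fun z : ℂ × ℂ => (z.1, z.2 + γ.eval z.1)) 0 := by
  have h : AnalyticAt ℂ (fun z : ℂ × ℂ => γ.eval z.1) 0 := by
    simpa [Polynomial.coe_aeval_eq_eval] using
      (analyticAt_fst (𝕜 := ℂ) (p := (0 : ℂ × ℂ))).aeval_polynomial γ
  exact analyticAt_fst.prod (analyticAt_snd.add h)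

theorem analyticAt_eval_fst (γ : Polynomial ℂ) :
    AnalyticAt ℂ (fun z : ℂ × ℂ => γ.eval z.1) 0 := by
  simpa [Polynomial.coe_aeval_eq_eval] using
    (analyticAt_fst (𝕜 := ℂ) (p := (0 : ℂ × ℂ))).aeval_polynomial γ

/-- If `x` becomes `x (1 - V)` with `V = x ^ q (1 - T)`, then `(q x ^ q)⁻¹` increases by `V / x ^ q
= 1 - T` plus a remainder of order `x ^ q`. Hence the translation by `1`, with error `O(x ^ q, y)`.
-/
theorem exists_fst_normalForm {F : ℂ × ℂ → ℂ × ℂ} {q : ℕ} (hq : 1 ≤ q)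
    (hF : ∃ g₁ g₂ : ℂ × ℂ → ℂ, AnalyticAt ℂ g₁ 0 ∧ AnalyticAt ℂ g₂ 0 ∧
      ∀ᶠ z : ℂ × ℂ in 𝓝 0, (F z).1 =
        z.1 - z.1 ^ (q + 1) + (z.1 ^ (q + 1) * z.2 * g₁ z + z.1 ^ (2 * q + 1) * g₂ z))
    {γ : Polynomial ℂ} (hγ : Polynomial.X ^ q ∣ γ) :
    ∃ (H : ℂ × ℂ → ℂ) (C : ℝ), AnalyticAt ℂ H 0 ∧ 0 ≤ C ∧ ∀ᶠ ρ in 𝓝[>] (0 : ℝ),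
      ∀ x y : ℂ, ‖x‖ < ρ → ‖y‖ < ρ →
        ‖(F (x, y + γ.eval x)).1 - x‖ ≤ C * ‖x‖ ^ (q + 1) ∧
        ‖H (x, y)‖ ≤ C * (‖x‖ ^ q + ‖y‖) ∧
        (x ≠ 0 → ((q : ℂ) * (F (x, y + γ.eval x)).1 ^ q)⁻¹ = ((q : ℂ) * x ^ q)⁻¹ + 1 + H (x, y)) := by
  obtain ⟨g₁, g₂, hg₁, hg₂, hF⟩ := hF
  have hq0 : q ≠ 0 := by omega
  have hγ0 := eval_zero_of_X_pow_dvd hq0 hγ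
  obtain ⟨γ', hγ'⟩ := hγ
  set σ : ℂ × ℂ → ℂ × ℂ := fun z => (z.1, z.2 + γ.eval z.1) with hσ
  have hσa : AnalyticAt ℂ σ 0 := analyticAt_graph_shear γ
  have hσ0 : σ 0 = 0 := by simp [hσ, hγ0]
  have hσt : Tendsto σ (𝓝 0) (𝓝 0) := by
    have h := hσa.continuousAt.tendsto
    rwa [hσ0] at h
  obtain ⟨P, hP⟩ := exists_polynomial_one_sub_pow q
  set G₁ : ℂ × ℂ → ℂ := fun z => g₁ (σ z) with hG1
  set G₂ : ℂ × ℂ → ℂ := fun z => g₂ (σ z) with hG2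
  have aG1 : AnalyticAt ℂ G₁ 0 := AnalyticAt.comp (by rwa [hσ0]) hσa
  have aG2 : AnalyticAt ℂ G₂ 0 := AnalyticAt.comp (by rwa [hσ0]) hσa
  have ax : AnalyticAt ℂ (fun z : ℂ × ℂ => z.1) 0 := analyticAt_fst
  have ay : AnalyticAt ℂ (fun z : ℂ × ℂ => z.2) 0 := analyticAt_snd
  set T : ℂ × ℂ → ℂ := fun z => (z.2 + γ.eval z.1) * G₁ z + z.1 ^ q * G₂ z with hT
  have aT : AnalyticAt ℂ T 0 :=
    ((ay.add (analyticAt_eval_fst γ)).mul aG1).add ((ax.pow q).mul aG2)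
  set V : ℂ × ℂ → ℂ := fun z => z.1 ^ q * (1 - T z) with hV
  have aV : AnalyticAt ℂ V 0 := (ax.pow q).mul (analyticAt_const.sub aT)
  have hV0 : V 0 = 0 := by simp [hV, zero_pow hq0]
  have aPV : AnalyticAt ℂ (fun z => P.eval (V z)) 0 := by
    simpa [Polynomial.coe_aeval_eq_eval] using aV.aeval_polynomial P
  set B : ℂ × ℂ → ℂ := fun z => (1 - V z) ^ q with hB
  have aB : AnalyticAt ℂ B 0 := (analyticAt_const.sub aV).pow q
  have hqB : (q : ℂ) * B 0 ≠ 0 := by simp [hB, hV0, hq0]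
  set R : ℂ × ℂ → ℂ := fun z => (1 - T z) ^ 2 * P.eval (V z) / (q * B z) with hR
  have aR : AnalyticAt ℂ R 0 :=
    (((analyticAt_const.sub aT).pow 2).mul aPV).div (analyticAt_const.mul aB) hqB
  -- Since `γ = x ^ q γ'`, the part of `-T` coming from `γ` also carries `x ^ q`. Only `-y G₁` lacks
  -- that factor, and `K` gathers the rest.
  set K : ℂ × ℂ → ℂ := fun z => R z - γ'.eval z.1 * G₁ z - G₂ z with hK
  have aK : AnalyticAt ℂ K 0 := (aR.sub ((analyticAt_eval_fst γ').mul aG1)).sub aG2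
  obtain ⟨C1, hC1, b1⟩ := aG1.eventually_norm_le
  obtain ⟨C2, hC2, b2⟩ := aK.eventually_norm_le
  obtain ⟨C3, hC3, b3⟩ := (analyticAt_const.sub aT : AnalyticAt ℂ (fun z => 1 - T z) 0).eventually_norm_le
  have hV1 : ∀ᶠ z in 𝓝 (0 : ℂ × ℂ), V z ≠ 1 :=
    aV.continuousAt.eventually_ne (by rw [hV0]; exact zero_ne_one)
  refine ⟨fun z => -(z.2 * G₁ z) + z.1 ^ q * K z, C1 + C2 + C3,
    ((ay.mul aG1).neg).add ((ax.pow q).mul aK), by positivity, ?_⟩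
  filter_upwards [b1, b2, b3, eventually_small_of_eventually_nhds hV1,
    eventually_small_of_eventually_nhds (hσt.eventually hF)] with ρ b1 b2 b3 hV1 hF x y hx hy
  have hz := norm_prod_lt hx hy
  have hFz : (F (x, y + γ.eval x)).1 = x * (1 - V (x, y)) := by
    refine (hF _ hz).trans ?_
    simp only [hV, hT, hσ, hG1, hG2]
    ring
  refine ⟨?_, ?_, ?_⟩
  · have : (F (x, y + γ.eval x)).1 - x = -(1 - T (x, y)) * x ^ (q + 1) := by
      rw [hFz]; simp only [hV]; ring
    rw [this, norm_mul, norm_neg, norm_pow]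
    have h3 : ‖1 - T (x, y)‖ ≤ C3 := b3 _ hz
    gcongr
    linarith
  · refine (norm_add_le _ _).trans ?_
    rw [norm_neg, norm_mul, norm_mul, norm_pow]
    have h1 := mul_le_mul_of_nonneg_left (b1 _ hz) (norm_nonneg y)
    have h2 := mul_le_mul_of_nonneg_left (b2 _ hz) (pow_nonneg (norm_nonneg x) q)
    have h3 : 0 ≤ ‖x‖ ^ q := by positivity
    have h4 : 0 ≤ ‖y‖ := norm_nonneg y
    nlinarith [mul_nonneg hC1 h3, mul_nonneg hC2 h4, mul_nonneg hC3 h3, mul_nonneg hC3 h4]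
  · intro hx0
    have hne : 1 - V (x, y) ≠ 0 := sub_ne_zero.2 (Ne.symm (hV1 _ hz))
    have hA : x ^ q ≠ 0 := pow_ne_zero _ hx0
    have hBne : (1 - V (x, y)) ^ q ≠ 0 := pow_ne_zero _ hne
    have hqc : (q : ℂ) ≠ 0 := by exact_mod_cast hq0
    have hp := hP (V (x, y))
    have hVz : V (x, y) = x ^ q * (1 - T (x, y)) := rfl
    have hTz : T (x, y) = (y + γ.eval x) * G₁ (x, y) + x ^ q * G₂ (x, y) := rfl
    have hγx : γ.eval x = x ^ q * γ'.eval x := by rw [hγ']; simp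
    have hH : -(y * G₁ (x, y)) + x ^ q * K (x, y) = -T (x, y) + x ^ q *
        ((1 - T (x, y)) ^ 2 * P.eval (V (x, y)) / (q * (1 - V (x, y)) ^ q)) := by
      rw [hTz, hγx]
      simp only [hK, hR, hB, hT, hγx]
      ring
    rw [hFz, hH, mul_pow]
    field_simp
    generalize (1 - V (x, y)) ^ q = b at *
    generalize P.eval (V (x, y)) = c at *
    rw [hVz] at hp
    generalize T (x, y) = t at *
    generalize x ^ q = A at *
    linear_combination -hp

/-- The remainder `r` is what is left of the second component after the translation by `γ` and the
removal of the linear fibre part. On `y = 0` it is the invariance defect of the truncated curve,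
hence `O(x ^ (m + 1))`. -/
theorem exists_normalForm {F : ℂ × ℂ → ℂ × ℂ} {U : Set (ℂ × ℂ)} (hF : IsDiffeoGerm F U)
    {c : PowerSeries ℂ} {k p : ℕ} {μ : ℂ} {a : Polynomial ℂ}
    (hinv : IsInvariantCurve F (Ideal.span {graphEquation c}))
    (hred : IsReducedForm F (Ideal.span {graphEquation c}) k p μ a)
    (hc : ((k + p + 2 : ℕ) : ℕ∞) ≤ c.order) (m : ℕ) :
    ∃ (H r : ℂ × ℂ → ℂ) (C ρ : ℝ),
      NormalForm F U k p m μ a (PowerSeries.trunc (m + 1) c) H r C ρ := by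
  have hq : 1 ≤ k + p := le_trans hred.one_le (Nat.le_add_right _ _)
  have hc0 : PowerSeries.constantCoeff c = 0 := by
    rw [← PowerSeries.coeff_zero_eq_constantCoeff_apply]
    exact PowerSeries.coeff_of_lt_order 0 (lt_of_lt_of_le (by exact_mod_cast Nat.succ_pos _) hc)
  have hdef := isBigO_invariance_defect hc0 hF.map_zero
    (hF.holomorphic.continuousOn.continuousAt (hF.isOpen.mem_nhds hF.zero_mem)) hinv (m + 1)
  set γ := PowerSeries.trunc (m + 1) c with hγ
  have hγdvd : Polynomial.X ^ (k + p) ∣ γ := by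
    rw [Polynomial.X_pow_dvd_iff]
    intro d hd
    rw [hγ, PowerSeries.coeff_trunc]
    split_ifs
    · exact PowerSeries.coeff_of_lt_order d (lt_of_lt_of_le (by exact_mod_cast (by omega)) hc)
    · rfl
  have hγ0 := eval_zero_of_X_pow_dvd (by omega) hγdvd
  obtain ⟨H, C1, aH, hC1, b1⟩ := exists_fst_normalForm hq (by simpa only [mul_add] using hred.fst_eq) hγdvd
  obtain ⟨g₁, g₂, hg₁, hg₂, hF1⟩ := hred.fst_eq
  obtain ⟨g, b, hg, hb, hF2⟩ := hred.snd_eq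
  set σ : ℂ × ℂ → ℂ × ℂ := fun z => (z.1, z.2 + γ.eval z.1) with hσ
  have hσa : AnalyticAt ℂ σ 0 := analyticAt_graph_shear γ
  have hσ0 : σ 0 = 0 := by simp [hσ, hγ0]
  have hσt : Tendsto σ (𝓝 0) (𝓝 0) := by
    have h := hσa.continuousAt.tendsto
    rwa [hσ0] at h
  have ax : AnalyticAt ℂ (fun z : ℂ × ℂ => z.1) 0 := analyticAt_fst
  have ay : AnalyticAt ℂ (fun z : ℂ × ℂ => z.2) 0 := analyticAt_snd
  have aF1 : AnalyticAt ℂ (fun z => (F z).1) 0 := by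
    refine AnalyticAt.congr ?_ (hF1.mono fun z hz => hz.symm)
    exact ((ax.sub (ax.pow _)).add ((((ax.pow _).mul ay).mul hg₁).add ((ax.pow _).mul hg₂)))
  have ab : AnalyticAt ℂ (fun z : ℂ × ℂ => b z.1) 0 := AnalyticAt.comp (f := Prod.fst) (by exact hb) ax
  have aE : AnalyticAt ℂ (fun z : ℂ × ℂ => μ * (1 + z.1 ^ k * a.eval z.1)) 0 :=
    analyticAt_const.mul (analyticAt_const.add ((ax.pow k).mul (analyticAt_eval_fst a)))
  have aF2 : AnalyticAt ℂ (fun z => (F z).2) 0 := by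
    refine AnalyticAt.congr ?_ (hF2.mono fun z hz => hz.symm)
    exact analyticAt_const.mul (((ay.add (((ax.pow k).mul (analyticAt_eval_fst a)).mul ay)).add
      (((ax.pow _).mul ay).mul hg)).add ab)
  have aF1σ : AnalyticAt ℂ (fun z => (F (σ z)).1) 0 :=
    AnalyticAt.comp (g := fun z => (F z).1) (by rwa [hσ0]) hσa
  have aF2σ : AnalyticAt ℂ (fun z => (F (σ z)).2) 0 :=
    AnalyticAt.comp (g := fun z => (F z).2) (by rwa [hσ0]) hσa
  set r : ℂ × ℂ → ℂ := fun z => (F (σ z)).2 - γ.eval (F (σ z)).1 -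
    μ * (1 + z.1 ^ k * a.eval z.1) * z.2 with hr
  have ar : AnalyticAt ℂ r 0 := by
    refine (aF2σ.sub ?_).sub (aE.mul ay)
    simpa [Polynomial.coe_aeval_eq_eval] using aF1σ.aeval_polynomial γ
  obtain ⟨C2, hC2, b2⟩ := aH.eventually_lipschitz
  obtain ⟨C3, hC3, b3⟩ := ar.eventually_mixed_difference
  obtain ⟨C4, hC4, b4⟩ := hdef.exists_pos
  rw [Asymptotics.IsBigOWith] at b4
  have aγ : AnalyticAt ℂ (fun x : ℂ => γ.eval x) 0 := by
    simpa [Polynomial.coe_aeval_eq_eval] using (analyticAt_id (𝕜 := ℂ) (z := (0 : ℂ))).aeval_polynomial γ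
  obtain ⟨C5, hC5, b5⟩ := aγ.eventually_lipschitz
  obtain ⟨C6, hC6, b6⟩ := (((ay.mul hg)) : AnalyticAt ℂ (fun z : ℂ × ℂ => z.2 * g z) 0).eventually_lipschitz
  obtain ⟨C7, hC7, b7⟩ := ((ay.mul hg₁).add ((ax.pow (k + p)).mul hg₂) :
    AnalyticAt ℂ (fun z : ℂ × ℂ => z.2 * g₁ z + z.1 ^ (k + p) * g₂ z) 0).eventually_lipschitz
  -- These radii are fixed before `ρ`: the corresponding Lipschitz bounds are applied at the points
  -- `σ z` and `(F (σ z)).1`, which a smaller `ρ` then forces into range.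
  obtain ⟨ρ₅, b5, hρ5⟩ := (b5.and self_mem_nhdsWithin).exists
  obtain ⟨ρ₆, b6, hρ6⟩ := (b6.and self_mem_nhdsWithin).exists
  obtain ⟨ρ₇, b7, hρ7⟩ := (b7.and self_mem_nhdsWithin).exists
  have s5 : ∀ᶠ z in 𝓝 (0 : ℂ × ℂ), ‖(F (σ z)).1‖ < ρ₅ := by
    have h := aF1σ.continuousAt.norm
    refine Tendsto.eventually_lt_const ?_ h
    simpa [hσ0, hF.map_zero] using hρ5
  have s67 : ∀ᶠ z in 𝓝 (0 : ℂ × ℂ), ‖σ z‖ < min ρ₆ ρ₇ := by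
    refine Tendsto.eventually_lt_const ?_ hσa.continuousAt.norm
    simpa [hσ0] using ⟨hρ6, hρ7⟩
  have sU : ∀ᶠ z in 𝓝 (0 : ℂ × ℂ), σ z ∈ U := hσt.eventually (hF.isOpen.mem_nhds hF.zero_mem)
  obtain ⟨ρ, ⟨b1, b2, b3, b4, s5, s67, sU, e1, e2, dH, dr⟩, hρ⟩ :=
    ((b1.and (b2.and (b3.and ((eventually_small_of_eventually_nhds b4).and
      ((eventually_small_of_eventually_nhds s5).and ((eventually_small_of_eventually_nhds s67).and
      ((eventually_small_of_eventually_nhds sU).and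
      ((eventually_small_of_eventually_nhds (hσt.eventually hF1)).and
      ((eventually_small_of_eventually_nhds (hσt.eventually hF2)).and
      (aH.eventually_differentiableOn.and ar.eventually_differentiableOn)))))))))).and
      self_mem_nhdsWithin).exists
  set C := C1 + C2 + C3 + C4 + (‖μ‖ * C6 + C5 * C7) with hC
  have h1C : C1 ≤ C := by rw [hC]; linarith [mul_nonneg (norm_nonneg μ) hC6, mul_nonneg hC5 hC7]
  have h2C : C2 ≤ C := by rw [hC]; linarith [mul_nonneg (norm_nonneg μ) hC6, mul_nonneg hC5 hC7]
  have h3C : C3 ≤ C := by rw [hC]; linarith [mul_nonneg (norm_nonneg μ) hC6, mul_nonneg hC5 hC7]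
  have h4C : C4 ≤ C := by rw [hC]; linarith [mul_nonneg (norm_nonneg μ) hC6, mul_nonneg hC5 hC7]
  have h5C : ‖μ‖ * C6 + C5 * C7 ≤ C := by rw [hC]; linarith
  refine ⟨H, r, C, ρ, ⟨hρ, hC1.trans h1C, ?_, ?_, ?_, ?_, dH, dr, ?_, ?_, ?_, ?_, ?_⟩⟩
  · exact fun x y hx hy => sU _ (norm_prod_lt hx hy)
  · intro x y hx hy
    exact (b1 x y hx hy).1.trans (by gcongr)
  · exact fun x y hx hy => (b1 x y hx hy).2.2
  · intro x y
    simp only [hr, hσ]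
    ring
  · intro x y hx hy
    exact (b1 x y hx hy).2.1.trans (by gcongr)
  · intro x y x' y' hx hy hx' hy'
    refine (b2 _ _ (norm_prod_lt hx hy) (norm_prod_lt hx' hy')).trans ?_
    exact mul_le_mul h2C (norm_prod_sub_le _ _ _ _) (norm_nonneg _) (hC1.trans h1C)
  · intro x hx
    have h := b4 x hx
    rw [norm_pow] at h
    have : r (x, 0) = (F (x, γ.eval x)).2 - γ.eval (F (x, γ.eval x)).1 := by
      simp [hr, hσ]
    rw [this]
    exact h.trans (by gcongr)
  · intro x y y' hx hy hy'
    have hz := norm_prod_lt hx hy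
    have hz' := norm_prod_lt hx hy'
    -- In the first component all the dependence on `y` carries the factor `x ^ (k + p + 1)`; in the
    -- second, so does all of it beyond the linear part. Both therefore contribute this factor to
    -- the Lipschitz constant of `r` in `y`.
    have f1 : ∀ y, ‖((x, y) : ℂ × ℂ)‖ < ρ → (F (σ (x, y))).1 = x - x ^ (k + p + 1) + x ^ (k + p + 1) *
        ((σ (x, y)).2 * g₁ (σ (x, y)) + (σ (x, y)).1 ^ (k + p) * g₂ (σ (x, y))) := by
      intro y hz
      rw [e1 _ hz]
      simp only [hσ]
      ring
    have f2 : ∀ y, ‖((x, y) : ℂ × ℂ)‖ < ρ → (F (σ (x, y))).2 = μ * (1 + x ^ k * a.eval x) *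
        (y + γ.eval x) + μ * x ^ (k + p + 1) * ((σ (x, y)).2 * g (σ (x, y))) + μ * b x := by
      intro y hz
      rw [e2 _ hz]
      simp only [hσ]
      ring
    have hd : ‖σ (x, y) - σ (x, y')‖ ≤ ‖y - y'‖ := by
      simp [hσ, Prod.norm_def]
    have i1 := b5 _ _ (s5 _ hz) (s5 _ hz')
    have i2 := b7 _ _ ((s67 _ hz).trans_le (min_le_right _ _)) ((s67 _ hz').trans_le (min_le_right _ _))
    have i3 := b6 _ _ ((s67 _ hz).trans_le (min_le_left _ _)) ((s67 _ hz').trans_le (min_le_left _ _))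
    rw [f1 y hz, f1 y' hz'] at i1
    rw [add_sub_add_left_eq_sub, ← mul_sub, norm_mul, norm_pow] at i1
    have e : r (x, y) - r (x, y') = μ * x ^ (k + p + 1) * ((σ (x, y)).2 * g (σ (x, y)) -
        (σ (x, y')).2 * g (σ (x, y'))) - (γ.eval (F (σ (x, y))).1 - γ.eval (F (σ (x, y'))).1) := by
      simp only [hr]
      rw [f2 y hz, f2 y' hz']
      ring
    rw [e, f1 y hz, f1 y' hz']
    refine (norm_sub_le _ _).trans ?_
    rw [norm_mul, norm_mul, norm_pow]
    calc _ ≤ ‖μ‖ * ‖x‖ ^ (k + p + 1) * (C6 * ‖y - y'‖) +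
          C5 * (‖x‖ ^ (k + p + 1) * (C7 * ‖y - y'‖)) := by
          refine add_le_add ?_ (i1.trans ?_)
          · exact mul_le_mul_of_nonneg_left (i3.trans (by gcongr)) (by positivity)
          · refine mul_le_mul_of_nonneg_left ?_ hC5
            exact mul_le_mul_of_nonneg_left (i2.trans (by gcongr)) (by positivity)
      _ = (‖μ‖ * C6 + C5 * C7) * ‖x‖ ^ (k + p + 1) * ‖y - y'‖ := by ring
      _ ≤ _ := by gcongr
  · intro x x' y hx hx' hy
    exact (b3 x x' y hx hx' hy).trans (by gcongr)

/-! ### The parabolic region and its coordinate -/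

/-- The region `{w | s < re w, |im w| ^ q < re w}`. -/
def parabolicRegion (q : ℕ) (s : ℝ) : Set ℂ := {w | s < w.re ∧ |w.im| ^ q < w.re}

/-- The inverse of `x ↦ (q x ^ q)⁻¹` near the direction `ξ`. -/
noncomputable def sectorRoot (q : ℕ) (ξ w : ℂ) : ℂ :=
  ξ * Complex.exp (-(Complex.log (q * w) / q))

theorem isOpen_parabolicRegion (q : ℕ) (s : ℝ) : IsOpen (parabolicRegion q s) :=
  (isOpen_lt continuous_const Complex.continuous_re).inter
    (isOpen_lt (Complex.continuous_im.abs.pow q) Complex.continuous_re)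

/-- The second condition is the strict epigraph of the convex function `|im w| ^ q`. Convexity is
what gives the simple connectedness of the petals. -/
theorem convex_parabolicRegion (q : ℕ) (s : ℝ) : Convex ℝ (parabolicRegion q s) := by
  refine (convex_halfSpace_re_gt s).inter ?_
  have h1 : ConvexOn ℝ univ fun w : ℂ => |w.im| ^ q := by
    have h2 : ConvexOn ℝ univ fun w : ℂ => ‖Complex.imCLM w‖ :=
      (convexOn_norm convex_univ).comp_linearMap (Complex.imCLM : ℂ →L[ℝ] ℝ).toLinearMap
    have := h2.pow (fun _ _ => norm_nonneg _) q
    simpa using! this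
  intro x hx y hy u v hu hv huv
  have h := h1.2 (mem_univ x) (mem_univ y) hu hv huv
  replace hx : |x.im| ^ q < x.re := hx
  replace hy : |y.im| ^ q < y.re := hy
  refine lt_of_le_of_lt h ?_
  simp only [smul_eq_mul, Complex.add_re, Complex.real_smul, Complex.mul_re, Complex.ofReal_re,
    Complex.ofReal_im, zero_mul, sub_zero]
  rcases hu.eq_or_lt with rfl | hu'
  · have hv1 : v = 1 := by linarith
    subst hv1; linarith
  · have h1 := mul_lt_mul_of_pos_left hx hu'
    have h2 := mul_le_mul_of_nonneg_left hy.le hv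
    linarith

theorem ofReal_mem_parabolicRegion {q : ℕ} (hq : q ≠ 0) {s t : ℝ} (hs : 0 ≤ s) (h : s < t) :
    (t : ℂ) ∈ parabolicRegion q s := by
  simp [parabolicRegion, hq, h, lt_of_le_of_lt hs h]

theorem parabolicRegion_mono (q : ℕ) {s s' : ℝ} (h : s ≤ s') :
    parabolicRegion q s' ⊆ parabolicRegion q s := fun _ hw => ⟨h.trans_lt hw.1, hw.2⟩

theorem norm_le_of_mem_parabolicRegion {q : ℕ} (hq : q ≠ 0) {s : ℝ} (hs : 1 ≤ s) {w : ℂ}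
    (hw : w ∈ parabolicRegion q s) : ‖w‖ ≤ 2 * w.re := by
  have h1 : 1 < w.re := hs.trans_lt hw.1
  have h2 : |w.im| ≤ w.re := by
    by_contra hcon
    push Not at hcon
    have : |w.im| ≤ |w.im| ^ q := le_self_pow₀ (by linarith) hq
    linarith [hw.2]
  calc ‖w‖ ≤ |w.re| + |w.im| := Complex.norm_le_abs_re_add_abs_im w
    _ ≤ _ := by rw [abs_of_pos (by linarith)]; linarith

section SectorRoot

variable {q : ℕ} {ξ : ℂ}

theorem norm_eq_one_of_isAttracting (hq : q ≠ 0) (hξ : ξ ^ q = 1) : ‖ξ‖ = 1 :=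
  Complex.norm_eq_one_of_pow_eq_one hξ hq

theorem root_ne_zero (hq : q ≠ 0) (hξ : ξ ^ q = 1) : ξ ≠ 0 := by
  rintro rfl
  simp [zero_pow hq] at hξ

theorem sectorRoot_ne_zero (hq : q ≠ 0) (hξ : ξ ^ q = 1) (w : ℂ) : sectorRoot q ξ w ≠ 0 :=
  mul_ne_zero (root_ne_zero hq hξ) (Complex.exp_ne_zero _)

theorem sectorRoot_pow (hq : q ≠ 0) (hξ : ξ ^ q = 1) {w : ℂ} (hw : w ≠ 0) :
    sectorRoot q ξ w ^ q = (q * w)⁻¹ := by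
  have hqc : (q : ℂ) ≠ 0 := by exact_mod_cast hq
  rw [sectorRoot, mul_pow, hξ, one_mul, ← Complex.exp_nat_mul]
  have : (q : ℂ) * -(Complex.log (q * w) / q) = -Complex.log (q * w) := by field_simp
  rw [this, Complex.exp_neg, Complex.exp_log (mul_ne_zero hqc hw)]

theorem inv_mul_sectorRoot_pow (hq : q ≠ 0) (hξ : ξ ^ q = 1) {w : ℂ} (hw : w ≠ 0) :
    ((q : ℂ) * sectorRoot q ξ w ^ q)⁻¹ = w := by
  have hqc : (q : ℂ) ≠ 0 := by exact_mod_cast hq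
  rw [sectorRoot_pow hq hξ hw]
  field_simp

theorem ne_zero_of_re_pos {w : ℂ} (hw : 0 < w.re) : w ≠ 0 := by
  rintro rfl; simp at hw

theorem norm_sectorRoot_pow (hq : q ≠ 0) (hξ : ξ ^ q = 1) {w : ℂ} (hw : w ≠ 0) :
    ‖sectorRoot q ξ w‖ ^ q = (q * ‖w‖)⁻¹ := by
  rw [← norm_pow, sectorRoot_pow hq hξ hw]
  simp

theorem norm_sectorRoot_pow_le (hq : q ≠ 0) (hξ : ξ ^ q = 1) {w : ℂ} (hw : 0 < w.re) :
    ‖sectorRoot q ξ w‖ ^ q ≤ w.re⁻¹ := by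
  rw [norm_sectorRoot_pow hq hξ (ne_zero_of_re_pos hw)]
  have h1 : (1 : ℝ) ≤ q := by exact_mod_cast Nat.one_le_iff_ne_zero.2 hq
  have h2 : w.re ≤ ‖w‖ := Complex.re_le_norm w
  refine inv_anti₀ hw ?_
  nlinarith [norm_nonneg w]

theorem inv_re_le_norm_sectorRoot_pow (hq : q ≠ 0) (hξ : ξ ^ q = 1) {s : ℝ} (hs : 1 ≤ s) {w : ℂ}
    (hw : w ∈ parabolicRegion q s) : w.re⁻¹ ≤ 2 * q * ‖sectorRoot q ξ w‖ ^ q := by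
  have h0 : 0 < w.re := by linarith [hw.1]
  have hw0 := ne_zero_of_re_pos h0
  have h1 := norm_le_of_mem_parabolicRegion hq hs hw
  have hq0 : (0 : ℝ) < q := by exact_mod_cast Nat.pos_of_ne_zero hq
  have h2 : 0 < ‖w‖ := norm_pos_iff.2 hw0
  rw [norm_sectorRoot_pow hq hξ hw0]
  have : 2 * (q : ℝ) * (q * ‖w‖)⁻¹ = (‖w‖ / 2)⁻¹ := by field_simp
  rw [this]
  exact inv_anti₀ (by positivity) (by linarith)

/-- Half-planes far to the right are mapped close to `0`. -/
theorem eventually_norm_sectorRoot_le (hq : q ≠ 0) (hξ : ξ ^ q = 1) {κ : ℝ} (hκ : 0 < κ) :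
    ∀ᶠ s in atTop, ∀ w : ℂ, s ≤ w.re → ‖sectorRoot q ξ w‖ ≤ κ := by
  filter_upwards [eventually_ge_atTop (κ ^ q)⁻¹, eventually_gt_atTop 0] with s hs hs0 w hw
  have h := norm_sectorRoot_pow_le hq hξ (hs0.trans_le hw)
  have h2 : w.re⁻¹ ≤ κ ^ q := by
    rw [inv_le_comm₀ (hs0.trans_le hw) (by positivity)]
    exact hs.trans hw
  exact le_of_pow_le_pow_left₀ hq hκ.le (h.trans h2)

theorem hasDerivAt_sectorRoot (hq : q ≠ 0) {w : ℂ} (hw : 0 < w.re) :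
    HasDerivAt (sectorRoot q ξ) (-(sectorRoot q ξ w * (q * w)⁻¹)) w := by
  have hqc : (q : ℂ) ≠ 0 := by exact_mod_cast hq
  have hw0 := ne_zero_of_re_pos hw
  have hslit : (q : ℂ) * w ∈ Complex.slitPlane := by
    refine Or.inl ?_
    rw [← Complex.ofReal_natCast, Complex.re_ofReal_mul]
    have : (0 : ℝ) < q := by exact_mod_cast Nat.pos_of_ne_zero hq
    positivity
  have h1 : HasDerivAt (fun w : ℂ => (q : ℂ) * w) q w := by
    simpa using (hasDerivAt_id w).const_mul (q : ℂ)
  have h2 := ((((h1.clog hslit).div_const (q : ℂ)).fun_neg).cexp).const_mul ξ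
  refine h2.congr_deriv ?_
  rw [sectorRoot]
  field_simp

theorem lipschitz_sectorRoot (hq : q ≠ 0) {s κ : ℝ} (hs : 0 < s)
    (hκ : ∀ w : ℂ, s ≤ w.re → ‖sectorRoot q ξ w‖ ≤ κ) {w w' : ℂ} (hw : s ≤ w.re)
    (hw' : s ≤ w'.re) :
    ‖sectorRoot q ξ w - sectorRoot q ξ w'‖ ≤ κ * s⁻¹ * ‖w - w'‖ := by
  refine Convex.norm_image_sub_le_of_norm_hasDerivWithin_le (s := {w : ℂ | s ≤ w.re})
    (fun z hz => (hasDerivAt_sectorRoot hq (hs.trans_le hz)).hasDerivWithinAt)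
    (fun z hz => ?_) (convex_halfSpace_re_ge s) hw' hw
  rw [norm_neg, norm_mul, norm_inv, norm_mul, Complex.norm_natCast]
  have h1 : (1 : ℝ) ≤ q := by exact_mod_cast Nat.one_le_iff_ne_zero.2 hq
  have h2 : s ≤ ‖z‖ := le_trans hz (Complex.re_le_norm z)
  have h3 : s ≤ q * ‖z‖ := by nlinarith
  exact mul_le_mul (hκ z hz) (inv_anti₀ hs h3) (by positivity) ((norm_nonneg _).trans (hκ z hz))

/-- The bound on `l.im` keeps the imaginary part of `-q l` within `(-π, π)`, where the principal
logarithm inverts the exponential. -/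
theorem sectorRoot_inv_mul_exp_pow (hq : q ≠ 0) (hξ : ξ ^ q = 1) {l : ℂ}
    (hl : |l.im| < Real.pi / q) :
    sectorRoot q ξ (((q : ℂ) * (ξ * Complex.exp l) ^ q)⁻¹) = ξ * Complex.exp l := by
  have hqc : (q : ℂ) ≠ 0 := by exact_mod_cast hq
  have hq0 : (0 : ℝ) < q := by exact_mod_cast Nat.pos_of_ne_zero hq
  rw [sectorRoot]
  have e1 : (q : ℂ) * (((q : ℂ) * (ξ * Complex.exp l) ^ q)⁻¹) = Complex.exp (-(q * l)) := by
    rw [mul_pow, hξ, one_mul, ← Complex.exp_nat_mul, Complex.exp_neg]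
    field_simp
  rw [lt_div_iff₀ hq0] at hl
  have hl1 := le_abs_self l.im
  have hl2 := neg_abs_le l.im
  have him : (-((q : ℂ) * l)).im = -(q * l.im) := by
    rw [Complex.neg_im, ← Complex.ofReal_natCast, Complex.im_ofReal_mul]
  rw [e1, Complex.log_exp]
  · congr 2; field_simp
  · rw [him]; nlinarith
  · rw [him]; nlinarith

/-- Jordan's inequality applied to `sin (arg w) = im w / ‖w‖`, together with `π / 2 ≤ 2`. -/
theorem abs_arg_natCast_mul_le (hq : q ≠ 0) {w : ℂ} (hw : 0 < w.re) :
    |(Complex.log (q * w)).im| < Real.pi / 2 ∧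
      |(Complex.log (q * w)).im| ≤ 2 * |w.im| / w.re := by
  have hq0 : (0 : ℝ) < q := by exact_mod_cast Nat.pos_of_ne_zero hq
  rw [Complex.log_im, ← Complex.ofReal_natCast, Complex.arg_real_mul w hq0]
  have h1 : |w.arg| < Real.pi / 2 := Complex.abs_arg_lt_pi_div_two_iff.2 (Or.inl hw)
  refine ⟨h1, ?_⟩
  have h2 := Real.mul_abs_le_abs_sin h1.le
  rw [Complex.sin_arg, abs_div, abs_norm, ← le_div_iff₀' (by positivity)] at h2
  refine h2.trans ?_
  have h3 : w.re ≤ ‖w‖ := Complex.re_le_norm w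
  have hpi := Real.pi_pos
  calc |w.im| / ‖w‖ / (2 / Real.pi) = |w.im| / ‖w‖ * (Real.pi / 2) := by field_simp
    _ ≤ |w.im| / w.re * 2 := by
        have := Real.pi_le_four
        gcongr; linarith
    _ = _ := by ring

/-- In the parabolic region, `sectorRoot` stays very close to the half-line `ξ ℝ⁺`. -/
theorem norm_sectorRoot_sub_le (hq : q ≠ 0) (hξ : ξ ^ q = 1) {s : ℝ} (hs : 0 ≤ s) {w : ℂ}
    (hw : w ∈ parabolicRegion q s) :
    ‖sectorRoot q ξ w - ξ * ‖sectorRoot q ξ w‖‖ ≤ 2 / w.re := by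
  have hre : 0 < w.re := hs.trans_lt hw.1
  have hw0 := ne_zero_of_re_pos hre
  have hq0 : (0 : ℝ) < q := by exact_mod_cast Nat.pos_of_ne_zero hq
  have h1q : (1 : ℝ) ≤ q := by exact_mod_cast Nat.one_le_iff_ne_zero.2 hq
  set l := -(Complex.log (q * w) / q) with hl
  have hnorm : ‖sectorRoot q ξ w‖ = Real.exp l.re := by
    rw [sectorRoot, norm_mul, norm_eq_one_of_isAttracting hq hξ, one_mul, Complex.norm_exp]
  have him : |l.im| ≤ 2 * |w.im| / w.re := by
    have h := (abs_arg_natCast_mul_le hq hre).2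
    have : l.im = -((Complex.log (q * w)).im / q) := by
      rw [hl, Complex.neg_im, ← Complex.ofReal_natCast, Complex.div_ofReal_im]
    rw [this, abs_neg, abs_div, abs_of_pos hq0]
    exact (div_le_self (abs_nonneg _) h1q).trans h
  have e1 : sectorRoot q ξ w - ξ * ‖sectorRoot q ξ w‖ =
      ξ * ‖sectorRoot q ξ w‖ * (Complex.exp (Complex.I * l.im) - 1) := by
    have : sectorRoot q ξ w = ξ * ‖sectorRoot q ξ w‖ * Complex.exp (Complex.I * l.im) := by
      rw [hnorm, sectorRoot, mul_assoc, Complex.ofReal_exp, ← Complex.exp_add]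
      congr 2
      rw [mul_comm Complex.I, Complex.re_add_im]
    nth_rw 1 [this]
    ring
  -- This is the purpose of the exponent `q` in the region: `‖x‖ ^ q ≤ 1 / re w` and `|im w| ^ q <
  -- re w` balance exactly, so the angular deviation, of order `|im w| / re w`, moves `x` by only
  -- `O(1 / re w)`.
  have h3 : ‖sectorRoot q ξ w‖ * |w.im| ≤ 1 := by
    refine le_of_pow_le_pow_left₀ hq zero_le_one ?_
    rw [mul_pow, one_pow]
    calc ‖sectorRoot q ξ w‖ ^ q * |w.im| ^ q ≤ w.re⁻¹ * w.re :=
          mul_le_mul (norm_sectorRoot_pow_le hq hξ hre) hw.2.le (by positivity) (by positivity)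
      _ = 1 := inv_mul_cancel₀ hre.ne'
  rw [e1, norm_mul, norm_mul, norm_eq_one_of_isAttracting hq hξ, one_mul, Complex.norm_real,
    norm_norm]
  calc ‖sectorRoot q ξ w‖ * ‖Complex.exp (Complex.I * l.im) - 1‖
      ≤ ‖sectorRoot q ξ w‖ * (2 * |w.im| / w.re) := by
        refine mul_le_mul_of_nonneg_left ?_ (norm_nonneg _)
        exact Real.norm_exp_I_mul_ofReal_sub_one_le.trans him
    _ = 2 * (‖sectorRoot q ξ w‖ * |w.im|) / w.re := by ring
    _ ≤ 2 * 1 / w.re := by gcongr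
    _ = _ := by ring

/-- The parabolic region is invariant under perturbations of the translation by `1`. -/
theorem eventually_add_one_mem_parabolicRegion (hq : q ≠ 0) {C : ℝ} (hC : 0 ≤ C) :
    ∀ᶠ s in atTop, ∀ w ∈ parabolicRegion q s, ∀ h : ℂ, ‖h‖ ≤ C / w.re →
      w + 1 + h ∈ parabolicRegion q s ∧ w.re + 1 / 2 ≤ (w + 1 + h).re := by
  -- `V` separates small from large imaginary parts; it makes `q C 2 ^ q / V ≤ 1 / 2` in the second
  -- range.
  set V : ℝ := 2 + 2 * q * C * 2 ^ q with hV
  filter_upwards [eventually_ge_atTop (4 * C), eventually_ge_atTop (2 * q * C * V ^ (q - 1)),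
    eventually_ge_atTop 1] with s h1 h2 h3 w hw h hh
  set η := C / w.re with hη
  have hre : s < w.re := hw.1
  have hre0 : 0 < w.re := by linarith
  have hη0 : 0 ≤ η := by positivity
  have hη1 : η ≤ 1 / 4 := by
    rw [hη, div_le_iff₀ hre0]; linarith
  have hhre : |h.re| ≤ η := (Complex.abs_re_le_norm h).trans hh
  have hhim : |h.im| ≤ η := (Complex.abs_im_le_norm h).trans hh
  have ere : (w + 1 + h).re = w.re + 1 + h.re := by simp
  have eim : (w + 1 + h).im = w.im + h.im := by simp
  have hr := (abs_le.1 hhre).1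
  have hre' : w.re + 1 / 2 ≤ (w + 1 + h).re := by rw [ere]; linarith
  refine ⟨⟨by linarith, ?_⟩, hre'⟩
  set t := |w.im| + η with ht
  have ht0 : 0 ≤ t := by positivity
  have him : |(w + 1 + h).im| ≤ t := by
    rw [eim]; exact (abs_add_le _ _).trans (add_le_add le_rfl hhim)
  have hV2 : 2 ≤ V := by rw [hV]; simp; positivity
  -- The possible growth of `|im| ^ q` must be at most the guaranteed growth `1 / 2` of the real
  -- part. For `t ≤ V` it is small because `re w` is large; for `t > V` one writes `t ^ (q - 1) ≤ t
  -- ^ q / V` and uses `|im w| ^ q < re w`.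
  have hkey : q * η * t ^ (q - 1) ≤ 1 / 2 := by
    rcases le_or_gt t V with htV | htV
    · calc q * η * t ^ (q - 1) ≤ q * η * V ^ (q - 1) := by gcongr
        _ = (q * C * V ^ (q - 1)) / w.re := by rw [hη]; ring
        _ ≤ 1 / 2 := by rw [div_le_iff₀ hre0]; linarith
    · have hb : t ≤ 2 * |w.im| := by linarith
      have htp : 0 < t := by linarith
      have h5 : t * t ^ (q - 1) ≤ 2 ^ q * w.re := by
        rw [← pow_succ', Nat.sub_add_cancel (Nat.one_le_iff_ne_zero.2 hq)]
        calc t ^ q ≤ (2 * |w.im|) ^ q := by gcongr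
          _ = 2 ^ q * |w.im| ^ q := mul_pow _ _ _
          _ ≤ _ := by gcongr; exact hw.2.le
      have h6 : V * t ^ (q - 1) ≤ 2 ^ q * w.re :=
        le_trans (mul_le_mul_of_nonneg_right htV.le (by positivity)) h5
      have hVp : 0 < V := by linarith
      have h7 : t ^ (q - 1) ≤ 2 ^ q * w.re / V := by
        rw [le_div_iff₀ hVp]; linarith
      calc q * η * t ^ (q - 1) ≤ q * η * (2 ^ q * w.re / V) := by gcongr
        _ = q * C * 2 ^ q / V := by rw [hη]; field_simp
        _ ≤ 1 / 2 := by rw [div_le_iff₀ hVp]; linarith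
  -- Bernoulli's inequality for `(1 - η / t) ^ q`, after writing `|im w| = t (1 - η / t)`.
  have hbern : t ^ q - q * η * t ^ (q - 1) ≤ |w.im| ^ q := by
    rcases ht0.eq_or_lt with h0 | h0
    · rw [← h0, zero_pow hq]
      have : 0 ≤ |w.im| ^ q := by positivity
      have : 0 ≤ q * η * (0 : ℝ) ^ (q - 1) := by positivity
      linarith
    · have hb := one_add_mul_le_pow (a := -(η / t)) (by
        have : η / t ≤ 1 := by rw [div_le_one h0, ht]; linarith [abs_nonneg w.im]
        linarith) q
      have e : |w.im| = t * (1 + -(η / t)) := by rw [ht] at h0 ⊢; field_simp; ring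
      rw [e, mul_pow]
      calc t ^ q - q * η * t ^ (q - 1) = t ^ q * (1 + q * -(η / t)) := by
            have : t ^ q = t ^ (q - 1) * t := by
              rw [← pow_succ, Nat.sub_add_cancel (Nat.one_le_iff_ne_zero.2 hq)]
            rw [this]; field_simp; ring
        _ ≤ _ := by gcongr
  calc |(w + 1 + h).im| ^ q ≤ t ^ q := by gcongr
    _ ≤ |w.im| ^ q + 1 / 2 := by linarith
    _ < w.re + 1 / 2 := by linarith [hw.2]
    _ ≤ _ := hre'

end SectorRoot

/-! ### Recovering `x` from `w`, entry of orbits into the region, and the multiplier -/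

section SectorRoot

variable {q : ℕ} {ξ : ℂ}

/-- The argument of `exp l` and that of `u` each use at most half of the admissible opening `π / q`.
-/
theorem eventually_sectorRoot_inverse (hq : q ≠ 0) (hξ : ξ ^ q = 1) :
    ∀ᶠ u in 𝓝 (1 : ℂ), ∀ l : ℂ, |l.im| < Real.pi / (2 * q) →
      sectorRoot q ξ (((q : ℂ) * (ξ * Complex.exp l * u) ^ q)⁻¹) = ξ * Complex.exp l * u := by
  have hq0 : (0 : ℝ) < q := by exact_mod_cast Nat.pos_of_ne_zero hq
  have h1 : Tendsto (fun u => |Complex.arg u|) (𝓝 1) (𝓝 0) := by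
    have h := (Complex.continuousAt_arg Complex.one_mem_slitPlane).abs.tendsto
    simpa using h
  have hpos : 0 < Real.pi / (2 * q) := by have := Real.pi_pos; positivity
  filter_upwards [Tendsto.eventually_lt_const hpos h1, eventually_ne_nhds one_ne_zero]
    with u hu hu0 l hl
  have e : ξ * Complex.exp l * u = ξ * Complex.exp (l + Complex.log u) := by
    rw [Complex.exp_add, Complex.exp_log hu0, mul_assoc]
  rw [e]
  refine sectorRoot_inv_mul_exp_pow hq hξ ?_
  rw [Complex.add_im, Complex.log_im]
  have h2 : Real.pi / q = Real.pi / (2 * q) + Real.pi / (2 * q) := by field_simp; ring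
  rw [h2]
  exact lt_of_le_of_lt (abs_add_le _ _) (add_lt_add hl hu)

theorem eventually_sectorRoot_mul (hq : q ≠ 0) (hξ : ξ ^ q = 1) :
    ∀ᶠ u in 𝓝 (1 : ℂ), ∀ w : ℂ, 0 < w.re →
      sectorRoot q ξ (((q : ℂ) * (sectorRoot q ξ w * u) ^ q)⁻¹) = sectorRoot q ξ w * u := by
  have hq0 : (0 : ℝ) < q := by exact_mod_cast Nat.pos_of_ne_zero hq
  filter_upwards [eventually_sectorRoot_inverse hq hξ] with u hu w hw
  refine hu _ ?_
  rw [Complex.neg_im, abs_neg, ← Complex.ofReal_natCast, Complex.div_ofReal_im, abs_div,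
    abs_of_pos hq0, div_lt_iff₀ hq0, Complex.ofReal_natCast]
  refine (abs_arg_natCast_mul_le hq hw).1.trans_eq ?_
  field_simp

/-- Write `x = ξ ‖x‖ u`, where `u = ξ⁻¹ x / ‖x‖` tends to `1`. -/
theorem eventually_sectorRoot_of_tendsto (hq : q ≠ 0) (hξ : ξ ^ q = 1) {x : ℕ → ℂ}
    (hx : Tendsto (fun n => x n / (‖x n‖ : ℂ)) atTop (𝓝 ξ)) :
    ∀ᶠ n in atTop, x n ≠ 0 ∧ sectorRoot q ξ (((q : ℂ) * x n ^ q)⁻¹) = x n := by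
  have hξ0 := root_ne_zero hq hξ
  have h1 : Tendsto (fun n => ξ⁻¹ * (x n / (‖x n‖ : ℂ))) atTop (𝓝 1) := by
    have := hx.const_mul ξ⁻¹
    rwa [inv_mul_cancel₀ hξ0] at this
  have hpos : 0 < Real.pi / (2 * q) := by
    have := Real.pi_pos
    have hq0 : (0 : ℝ) < q := by exact_mod_cast Nat.pos_of_ne_zero hq
    positivity
  filter_upwards [h1.eventually (eventually_sectorRoot_inverse hq hξ),
    hx.eventually_ne hξ0] with n hn hne
  have hx0 : x n ≠ 0 := by
    intro h; rw [h] at hne; simp at hne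
  refine ⟨hx0, ?_⟩
  have hn0 : (‖x n‖ : ℂ) ≠ 0 := by exact_mod_cast (norm_pos_iff.2 hx0).ne'
  have e : ξ * Complex.exp (Real.log ‖x n‖ : ℝ) * (ξ⁻¹ * (x n / (‖x n‖ : ℂ))) = x n := by
    rw [← Complex.ofReal_exp, Real.exp_log (norm_pos_iff.2 hx0)]
    field_simp
  have h := hn (Real.log ‖x n‖ : ℝ) (by simpa using hpos)
  rwa [e] at h

/-- Orbits of a perturbation of the translation by `1` enter the parabolic regions. -/
theorem eventually_mem_parabolicRegion {w : ℕ → ℂ} {C : ℝ} (hC : 0 ≤ C)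
    (hstep : ∀ᶠ n in atTop, ‖w (n + 1) - w n - 1‖ ≤ C / ‖w n‖)
    (hre : Tendsto (fun n => (w n).re) atTop atTop) (s : ℝ) :
    ∀ᶠ n in atTop, w n ∈ parabolicRegion q s := by
  obtain ⟨n₀, hn₀⟩ := eventually_atTop.1
    ((hstep.and (hre.eventually_ge_atTop (2 * C))).and (hre.eventually_ge_atTop 1))
  have hstep' : ∀ n ≥ n₀, (w n).re + 1 / 2 ≤ (w (n + 1)).re ∧
      |(w (n + 1)).im| ≤ |(w n).im| + C / (w n).re := by
    intro n hn
    obtain ⟨⟨h1, h2⟩, h3⟩ := hn₀ n hn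
    have h4 : ‖w (n + 1) - w n - 1‖ ≤ C / (w n).re :=
      h1.trans (by gcongr; exact Complex.re_le_norm _)
    have h5 : C / (w n).re ≤ 1 / 2 := by rw [div_le_iff₀ (by linarith)]; linarith
    have hr := (Complex.abs_re_le_norm _).trans h4
    have hi := (Complex.abs_im_le_norm _).trans h4
    simp only [Complex.sub_re, Complex.sub_im, Complex.one_re, Complex.one_im, sub_zero] at hr hi
    refine ⟨by linarith [(abs_le.1 hr).1], ?_⟩
    calc |(w (n + 1)).im| = |(w n).im + ((w (n + 1)).im - (w n).im)| := by ring_nf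
      _ ≤ _ := (abs_add_le _ _).trans (by linarith)
  set K := |(w n₀).im| with hK
  -- The real part increases by at least `1 / 2`, so `log (re w)` increases by at least `1 / (4 re
  -- w)`, while the imaginary part moves by at most `C / re w`. Thus the imaginary part is at most
  -- logarithmic in the real part, and every power of the logarithm is negligible.
  have hlog : ∀ n ≥ n₀, |(w n).im| ≤ K + 4 * C * Real.log (w n).re := by
    intro n hn
    induction n, hn using Nat.le_induction with
    | base =>
      have := Real.log_nonneg (hn₀ n₀ le_rfl).2
      have : 0 ≤ 4 * C * Real.log (w n₀).re := by positivity
      linarith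
    | succ n hn ih =>
      obtain ⟨h1, h2⟩ := hstep' n hn
      have h3 : 1 ≤ (w n).re := (hn₀ n hn).2
      have hp : 0 < (w n).re := by linarith
      have hp' : 0 < (w (n + 1)).re := by linarith
      have h4 := Real.one_sub_inv_le_log_of_pos (div_pos hp' hp)
      rw [Real.log_div hp'.ne' hp.ne', inv_div] at h4
      have h5 : 1 / (4 * (w n).re) ≤ 1 - (w n).re / (w (n + 1)).re := by
        have : (w n).re / (w (n + 1)).re ≤ (w n).re / ((w n).re + 1 / 2) := by gcongr
        have h6 : (w n).re / ((w n).re + 1 / 2) ≤ 1 - 1 / (4 * (w n).re) := by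
          rw [div_le_iff₀ (by positivity)]
          have e : (1 - 1 / (4 * (w n).re)) * ((w n).re + 1 / 2) =
              (w n).re + 1 / 4 - 1 / (8 * (w n).re) := by field_simp; ring
          rw [e]
          have : 1 / (8 * (w n).re) ≤ 1 / 4 := by
            rw [div_le_div_iff₀ (by positivity) (by positivity)]; linarith
          linarith
        linarith
      have h7 : C / (w n).re = 4 * C * (1 / (4 * (w n).re)) := by field_simp
      have h8 : 4 * C * (1 / (4 * (w n).re)) ≤
          4 * C * (Real.log (w (n + 1)).re - Real.log (w n).re) := by
        gcongr; linarith
      linarith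
  have hlit : ∀ᶠ t : ℝ in atTop, (K + 4 * C * Real.log t) ^ q < t := by
    have hK0 : 0 ≤ K := abs_nonneg _
    have h := (Real.isLittleO_pow_log_id_atTop (n := q)).def
      (c := ((K + 4 * C) ^ q + 1)⁻¹ / 2) (by positivity)
    filter_upwards [h, Real.tendsto_log_atTop.eventually_ge_atTop 1, eventually_gt_atTop 0]
      with t ht hlt ht0
    rw [id, Real.norm_of_nonneg (by positivity), Real.norm_of_nonneg ht0.le] at ht
    calc (K + 4 * C * Real.log t) ^ q ≤ ((K + 4 * C) * Real.log t) ^ q := by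
          gcongr; nlinarith
      _ = (K + 4 * C) ^ q * Real.log t ^ q := mul_pow _ _ _
      _ ≤ ((K + 4 * C) ^ q + 1) * (((K + 4 * C) ^ q + 1)⁻¹ / 2 * t) := by
          gcongr; linarith
      _ = t / 2 := by field_simp
      _ < t := by linarith
  filter_upwards [hre.eventually_gt_atTop s, hre.eventually hlit, eventually_ge_atTop n₀]
    with n h1 h2 h3
  refine ⟨h1, lt_of_le_of_lt ?_ h2⟩
  exact pow_le_pow_left₀ (abs_nonneg _) (hlog n h3) q

/-! ### The saddle condition -/

/-- The first nonzero coefficient is positive and dominates the sum for small `t > 0`; the zero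
vector gives `0`. -/
theorem eventually_sum_nonneg_of_lex {n : ℕ} {v : Fin n → ℝ} (hv : toLex 0 ≤ toLex v) :
    ∀ᶠ t in 𝓝[>] (0 : ℝ), 0 ≤ ∑ j, v j * t ^ (j : ℕ) := by
  by_cases h : ∃ i, v i ≠ 0
  · obtain ⟨i, hi, hmin⟩ := WellFounded.has_min (wellFounded_lt (α := Fin n)) {i | v i ≠ 0} h
    have hlt : ∀ j < i, v j = 0 := fun j hj => by
      by_contra hcon; exact hmin j hcon hj
    have hi0 : 0 < v i := lt_of_le_of_ne
      (Pi.apply_le_of_toLex hv fun j hj => (hlt j hj).symm) (Ne.symm hi)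
    -- The terms with `j < i` are removed explicitly, since there the truncated subtraction `j - i`
    -- would give the exponent `0`.
    have hlim : Tendsto (fun t : ℝ => ∑ j : Fin n, if j < i then 0 else v j * t ^ ((j : ℕ) - i))
        (𝓝 0) (𝓝 (v i)) := by
      have hc : Continuous fun t : ℝ =>
          ∑ j : Fin n, if j < i then 0 else v j * t ^ ((j : ℕ) - i) := by
        refine continuous_finsetSum _ fun j _ => ?_
        split_ifs
        · exact continuous_const
        · fun_prop
      have h0 := hc.tendsto 0
      rw [Finset.sum_eq_single i] at h0
      · simpa using h0
      · intro j _ hj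
        split_ifs with hji
        · rfl
        · have : (j : ℕ) - i ≠ 0 := by
            have h1 : i < j := lt_of_le_of_ne (not_lt.1 hji) (Ne.symm hj)
            have : (i : ℕ) < j := h1
            omega
          rw [zero_pow this, mul_zero]
      · simp
    filter_upwards [nhdsWithin_le_nhds (hlim.eventually_const_lt hi0), self_mem_nhdsWithin]
      with t ht ht0
    have e : ∑ j, v j * t ^ (j : ℕ) =
        t ^ (i : ℕ) * ∑ j : Fin n, if j < i then 0 else v j * t ^ ((j : ℕ) - i) := by
      rw [Finset.mul_sum]
      refine Finset.sum_congr rfl fun j _ => ?_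
      split_ifs with hji
      · rw [hlt j hji]; simp
      · have : (i : ℕ) ≤ j := not_lt.1 hji
        have h2 : t ^ (j : ℕ) = t ^ (i : ℕ) * t ^ ((j : ℕ) - i) := by
          rw [← pow_add, Nat.add_sub_cancel' this]
        rw [h2]; ring
    rw [e]
    have : (0 : ℝ) < t := ht0
    positivity
  · push Not at h
    simp [h]

theorem eval_trunc_log (n : ℕ) (z : ℂ) :
    (PowerSeries.trunc n (PowerSeries.log ℂ)).eval z = Complex.logTaylor n z := by
  rw [Polynomial.eval, PowerSeries.eval₂_trunc_eq_sum_range, Complex.logTaylor]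
  refine Finset.sum_congr rfl fun j _ => ?_
  rw [RingHom.id_apply, PowerSeries.coeff_log]
  split_ifs with h
  · simp [h]
  · simp; ring

/-- The logarithm of `1 + x ^ k a(x)` up to order `k + p`. -/
theorem isBigO_log_sub {k p : ℕ} (hk : 1 ≤ k) (a : Polynomial ℂ) :
    (fun x : ℂ => Complex.log (1 + x ^ k * a.eval x) -
      ∑ j : Fin p, infinitesimalCoeff k a j * x ^ (k + (j : ℕ))) =O[𝓝 0] fun x => x ^ (k + p) := by
  set n := k + p with hn
  set u : Polynomial ℂ := Polynomial.X ^ k * a with hu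
  -- `P` mediates between the analytic logarithm and the formal one: both are compared with the
  -- truncated logarithm series composed with `x ^ k a(x)`.
  set P : Polynomial ℂ := (PowerSeries.trunc (n + 1) (PowerSeries.log ℂ)).comp u with hP
  have hux : ∀ x, u.eval x = x ^ k * a.eval x := fun x => by simp [hu]
  have hu0 : u.eval 0 = 0 := by rw [hux, zero_pow (by omega), zero_mul]
  have huO : (fun x => u.eval x) =O[𝓝 0] fun x : ℂ => x := by
    have := (u.differentiable.differentiableAt (x := 0)).isBigO_sub
    simpa [hu0] using this
  have h1 : (fun x : ℂ => Complex.log (1 + u.eval x) - P.eval x) =O[𝓝 0] fun x => x ^ n := by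
    have hb : (fun z : ℂ => Complex.log (1 + z) - Complex.logTaylor (n + 1) z) =O[𝓝 0]
        fun z => z ^ (n + 1) := by
      refine Asymptotics.IsBigO.of_bound 2 ?_
      filter_upwards [Metric.ball_mem_nhds (0 : ℂ) (ε := 1 / 2) (by norm_num)] with z hz
      rw [mem_ball_zero_iff] at hz
      refine (Complex.norm_log_sub_logTaylor_le n (by linarith)).trans ?_
      rw [norm_pow]
      have h2 : (1 - ‖z‖)⁻¹ ≤ 2 := by
        rw [inv_le_comm₀ (by linarith) (by norm_num)]; linarith
      calc ‖z‖ ^ (n + 1) * (1 - ‖z‖)⁻¹ / (n + 1) ≤ ‖z‖ ^ (n + 1) * (1 - ‖z‖)⁻¹ := by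
            refine div_le_self (mul_nonneg (by positivity) (inv_nonneg.2 (by linarith))) ?_
            have : (0 : ℝ) ≤ n := Nat.cast_nonneg n
            linarith
        _ ≤ ‖z‖ ^ (n + 1) * 2 := by gcongr
        _ = _ := mul_comm _ _
    have ht : Tendsto (fun x => u.eval x) (𝓝 0) (𝓝 0) := by
      have := u.continuous.tendsto 0
      rwa [hu0] at this
    have h3 := (hb.comp_tendsto ht).trans (huO.pow (n + 1))
    refine (h3.congr_left fun x => ?_).trans ?_
    · simp only [Function.comp, hP, Polynomial.eval_comp, eval_trunc_log]
    · refine Asymptotics.IsBigO.of_bound 1 ?_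
      filter_upwards [Metric.ball_mem_nhds (0 : ℂ) one_pos] with x hx
      rw [mem_ball_zero_iff] at hx
      rw [one_mul, pow_succ, norm_mul]
      exact mul_le_of_le_one_right (norm_nonneg _) hx.le
  -- The sum stops before `A_p`: its term has degree `k + p` and belongs to the error.
  set S : Polynomial ℂ := ∑ j : Fin p, Polynomial.C (infinitesimalCoeff k a j) *
    Polynomial.X ^ (k + (j : ℕ)) with hS
  have hSx : ∀ x, S.eval x = ∑ j : Fin p, infinitesimalCoeff k a j * x ^ (k + (j : ℕ)) := by
    intro x; simp [hS, Polynomial.eval_finsetSum]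
  have hdvd : Polynomial.X ^ n ∣ P - S := by
    have hs : PowerSeries.HasSubst (u : PowerSeries ℂ) := by
      refine PowerSeries.HasSubst.of_constantCoeff_zero' ?_
      rw [← PowerSeries.coeff_zero_eq_constantCoeff_apply, Polynomial.coeff_coe,
        Polynomial.coeff_zero_eq_eval_zero, hu0]
    have hA : ∀ j, infinitesimalCoeff k a j = PowerSeries.coeff (k + j)
        (PowerSeries.subst (u : PowerSeries ℂ) (PowerSeries.log ℂ)) := by
      intro j
      rw [infinitesimalCoeff, PowerSeries.logOf_eq, add_sub_cancel_left]
      congr 2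
      rw [hu]; simp
    have hX : PowerSeries.X ^ k ∣ (u : PowerSeries ℂ) := ⟨a, by rw [hu]; simp⟩
    have hsub : PowerSeries.X ^ n ∣ PowerSeries.subst (u : PowerSeries ℂ) (PowerSeries.log ℂ) -
        (P : PowerSeries ℂ) := by
      have hd : PowerSeries.X ^ (n + 1) ∣ PowerSeries.log ℂ -
          (PowerSeries.trunc (n + 1) (PowerSeries.log ℂ) : PowerSeries ℂ) := by
        rw [PowerSeries.X_pow_dvd_iff]
        intro m hm
        rw [map_sub, Polynomial.coeff_coe, PowerSeries.coeff_trunc, if_pos hm, sub_self]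
      obtain ⟨g, hg⟩ := hd
      have e : (P : PowerSeries ℂ) = PowerSeries.subst (u : PowerSeries ℂ)
          (PowerSeries.trunc (n + 1) (PowerSeries.log ℂ) : PowerSeries ℂ) := by
        have := Polynomial.aeval_algHom_apply (Polynomial.coeToPowerSeries.algHom (R := ℂ) ℂ) u
          (PowerSeries.trunc (n + 1) (PowerSeries.log ℂ))
        rw [Polynomial.coeToPowerSeries.algHom_apply,
          Polynomial.coeToPowerSeries.algHom_apply] at this
        simp only [Algebra.algebraMap_self, PowerSeries.map_id, id] at this
        rw [PowerSeries.subst_coe hs, this, hP, Polynomial.comp_eq_aeval]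
      rw [e, ← PowerSeries.subst_sub hs, hg, PowerSeries.subst_mul hs, PowerSeries.subst_pow hs,
        PowerSeries.subst_X hs]
      refine Dvd.dvd.mul_right ?_ _
      refine dvd_trans ?_ (pow_dvd_pow_of_dvd hX (n + 1))
      rw [← pow_mul]
      exact pow_dvd_pow _ (by nlinarith)
    rw [PowerSeries.X_pow_dvd_iff] at hsub
    rw [Polynomial.X_pow_dvd_iff]
    intro d hd
    have h4 := hsub d hd
    rw [map_sub, sub_eq_zero, Polynomial.coeff_coe] at h4
    rw [Polynomial.coeff_sub, ← h4, hS, Polynomial.finsetSum_coeff]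
    simp only [Polynomial.coeff_C_mul, Polynomial.coeff_X_pow]
    rcases lt_or_ge d k with hdk | hdk
    · rw [Finset.sum_eq_zero (fun j _ => by rw [if_neg (by omega), mul_zero]), sub_zero]
      have h5 : PowerSeries.X ^ k ∣
          PowerSeries.subst (u : PowerSeries ℂ) (PowerSeries.log ℂ) := by
        obtain ⟨g, hg⟩ := PowerSeries.X_dvd_iff.2 (PowerSeries.constantCoeff_log (A := ℂ))
        rw [hg, PowerSeries.subst_mul hs, PowerSeries.subst_X hs]
        exact Dvd.dvd.mul_right hX _
      exact PowerSeries.X_pow_dvd_iff.1 h5 d hdk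
    · rw [Finset.sum_eq_single (⟨d - k, by omega⟩ : Fin p)]
      · simp only
        rw [if_pos (by omega), mul_one, hA, Nat.add_sub_cancel' hdk, sub_self]
      · intro j _ hj
        rw [if_neg, mul_zero]
        intro h
        refine hj (Fin.ext ?_)
        simp only; omega
      · simp
  obtain ⟨g, hg⟩ := hdvd
  have h2 : (fun x : ℂ => (P - S).eval x) =O[𝓝 0] fun x => x ^ n := by
    rw [hg]
    simp only [Polynomial.eval_mul, Polynomial.eval_pow, Polynomial.eval_X]
    have h5 : (fun x : ℂ => g.eval x) =O[𝓝 0] fun _ => (1 : ℂ) :=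
      g.continuous.continuousAt.isBigO_one ℂ
    simpa using (Asymptotics.isBigO_refl (fun x : ℂ => x ^ n) (𝓝 0)).mul h5
  refine (h1.add h2).congr_left fun x => ?_
  rw [Polynomial.eval_sub, hux, hSx]
  ring

end SectorRoot

theorem norm_pow_sub_pow_le_of_norm_le_one {x y : ℂ} (hx : ‖x‖ ≤ 1) (hy : ‖y‖ ≤ 1) (m : ℕ) :
    ‖x ^ m - y ^ m‖ ≤ m * ‖x - y‖ := by
  induction m with
  | zero => simp
  | succ m ih =>
    have e : x ^ (m + 1) - y ^ (m + 1) = x ^ m * (x - y) + (x ^ m - y ^ m) * y := by ring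
    rw [e]
    refine (norm_add_le _ _).trans ?_
    rw [norm_mul, norm_mul, norm_pow]
    have h1 : ‖x‖ ^ m ≤ 1 := pow_le_one₀ (norm_nonneg _) hx
    have h2 : ‖x‖ ^ m * ‖x - y‖ ≤ ‖x - y‖ := mul_le_of_le_one_left (norm_nonneg _) h1
    have h3 : ‖x ^ m - y ^ m‖ * ‖y‖ ≤ ‖x ^ m - y ^ m‖ := mul_le_of_le_one_right (norm_nonneg _) hy
    push_cast
    linarith

theorem IsSaddleDirection.log_norm_nonneg {k p : ℕ} {μ ξ : ℂ} {a : Polynomial ℂ}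
    (h : IsSaddleDirection k p μ a ξ) : 0 ≤ Real.log ‖μ‖ :=
  Pi.apply_le_of_toLex (i := (0 : Fin (p + 1))) (not_lt.1 h.2)
    (fun j hj => absurd hj (Fin.not_lt_zero j))

/-- When the first entry of the tuple is `0`, the tail decides the lexicographic comparison. -/
theorem IsSaddleDirection.lex_nonneg {k p : ℕ} {μ ξ : ℂ} {a : Polynomial ℂ}
    (h : IsSaddleDirection k p μ a ξ) (hμ : Real.log ‖μ‖ = 0) :
    toLex 0 ≤ toLex fun j : Fin p => (ξ ^ (k + (j : ℕ)) * infinitesimalCoeff k a j).re := by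
  refine not_lt.1 fun hlt => h.2 ?_
  obtain ⟨i, h1, h2⟩ := hlt
  refine ⟨i.succ, fun j hj => ?_, h2⟩
  refine Fin.cases (fun _ => hμ) (fun j hj => ?_) j hj
  exact h1 j (Fin.succ_lt_succ_iff.1 hj)

/-- The inverse of the multiplier is at most `1 + O(1 / re w)` along a saddle direction. -/
theorem exists_multiplier_bound {k p : ℕ} (hk : 1 ≤ k) {μ ξ : ℂ} {a : Polynomial ℂ} (hμ : μ ≠ 0)
    (h : IsSaddleDirection k p μ a ξ) : ∃ c : ℝ, 0 ≤ c ∧ ∀ᶠ s in atTop,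
      ∀ w ∈ parabolicRegion (k + p) s,
        ‖(μ * (1 + sectorRoot (k + p) ξ w ^ k * a.eval (sectorRoot (k + p) ξ w)))⁻¹‖ ≤
          1 + c / w.re := by
  have hq : k + p ≠ 0 := by omega
  have hξ : ξ ^ (k + p) = 1 := h.1
  have hcont : Continuous fun x : ℂ => 1 + x ^ k * a.eval x := by fun_prop
  have hlim : Tendsto (fun x : ℂ => 1 + x ^ k * a.eval x) (𝓝 0) (𝓝 1) := by
    have := hcont.tendsto 0
    simpa [zero_pow (show k ≠ 0 by omega)] using this
  rcases h.log_norm_nonneg.eq_or_lt with h0 | h0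
  · have hμ1 : ‖μ‖ = 1 := by
      have := Real.exp_log (norm_pos_iff.2 hμ)
      rw [← h0, Real.exp_zero] at this
      exact this.symm
    have hlex := h.lex_nonneg h0.symm
    set d : Fin p → ℝ := fun j => (ξ ^ (k + (j : ℕ)) * infinitesimalCoeff k a j).re with hd
    obtain ⟨C, hC, hlog⟩ := (isBigO_log_sub (p := p) hk a).exists_pos
    rw [Asymptotics.IsBigOWith] at hlog
    obtain ⟨t₀, ht₀, ht₀'⟩ := mem_nhdsGT_iff_exists_Ioo_subset.1 (eventually_sum_nonneg_of_lex hlex)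
    have ht₀' : ∀ t : ℝ, 0 < t → t < t₀ → 0 ≤ ∑ j, d j * t ^ (j : ℕ) := fun t h1 h2 => ht₀' ⟨h1, h2⟩
    obtain ⟨ρ, ⟨h1, h2⟩, hρ⟩ := (((eventually_small_of_eventually_nhds hlog).and
      (eventually_small_of_eventually_nhds
        (hlim.eventually_ne one_ne_zero))).and self_mem_nhdsWithin).exists
    have hρ : 0 < ρ := hρ
    have ht₀ : 0 < t₀ := ht₀
    -- The factor `2` is the constant of `norm_sectorRoot_sub_le`, and `k + j` the Lipschitz
    -- constant of the power on the unit disc.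
    set C' : ℝ := ∑ j : Fin p, ‖infinitesimalCoeff k a j‖ * ((k + (j : ℕ) : ℕ) * 2) with hC'
    have hC'0 : 0 ≤ C' := Finset.sum_nonneg fun j _ => by positivity
    refine ⟨2 * (C + C'), by positivity, ?_⟩
    set κ := min (ρ / 2) (min (t₀ / 2) 1) with hκ
    have hκ0 : 0 < κ := by positivity
    filter_upwards [eventually_norm_sectorRoot_le hq hξ hκ0, eventually_ge_atTop (C + C'),
      eventually_ge_atTop 1] with s hs1 hs2 hs3 w hw
    set x := sectorRoot (k + p) ξ w with hx
    have hre : 0 < w.re := by linarith [hw.1]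
    have hxκ := hs1 w hw.1.le
    rw [← hx] at hxκ
    have hxρ : ‖x‖ < ρ := by
      have := hxκ.trans (min_le_left _ _); linarith
    have hxt : ‖x‖ < t₀ := by
      have := hxκ.trans ((min_le_right _ _).trans (min_le_left _ _)); linarith
    have hx1 : ‖x‖ ≤ 1 := hxκ.trans ((min_le_right _ _).trans (min_le_right _ _))
    have hx0 : 0 < ‖x‖ := norm_pos_iff.2 (sectorRoot_ne_zero hq hξ w)
    have hE := h2 x hxρ
    have hl := h1 x hxρ
    set A := ∑ j : Fin p, infinitesimalCoeff k a j * x ^ (k + (j : ℕ)) with hA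
    set E := 1 + x ^ k * a.eval x with hEdef
    have hξ1 := norm_eq_one_of_isAttracting hq hξ
    have hclose := norm_sectorRoot_sub_le hq hξ (zero_le_one.trans hs3) hw
    rw [← hx] at hclose
    -- At the point `ξ ‖x‖` of the half-line the real part is nonnegative, by the lexicographic
    -- condition; moving from there to `x` costs at most `C' / re w`.
    have hAre : -(C' / w.re) ≤ A.re := by
      have e1 : A.re = ∑ j : Fin p, d j * ‖x‖ ^ (k + (j : ℕ)) + ∑ j : Fin p,
          (infinitesimalCoeff k a j * (x ^ (k + (j : ℕ)) - (ξ * ‖x‖) ^ (k + (j : ℕ)))).re := by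
        rw [hA, Complex.re_sum, ← Finset.sum_add_distrib]
        refine Finset.sum_congr rfl fun j _ => ?_
        rw [mul_sub, Complex.sub_re, mul_pow]
        have : (infinitesimalCoeff k a j * (ξ ^ (k + (j : ℕ)) * (‖x‖ : ℂ) ^ (k + (j : ℕ)))).re =
            d j * ‖x‖ ^ (k + (j : ℕ)) := by
          rw [← mul_assoc, mul_comm (infinitesimalCoeff k a j), ← Complex.ofReal_pow,
            Complex.re_mul_ofReal]
        rw [this]; ring
      have e2 : ∑ j : Fin p, d j * ‖x‖ ^ (k + (j : ℕ)) = ‖x‖ ^ k * ∑ j : Fin p, d j * ‖x‖ ^ (j : ℕ) := by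
        rw [Finset.mul_sum]
        refine Finset.sum_congr rfl fun j _ => ?_
        rw [pow_add]; ring
      have e3 : 0 ≤ ∑ j : Fin p, d j * ‖x‖ ^ (k + (j : ℕ)) := by
        rw [e2]; exact mul_nonneg (by positivity) (ht₀' _ hx0 hxt)
      have e4 : -(C' / w.re) ≤ ∑ j : Fin p,
          (infinitesimalCoeff k a j * (x ^ (k + (j : ℕ)) - (ξ * ‖x‖) ^ (k + (j : ℕ)))).re := by
        rw [hC', Finset.sum_div, ← Finset.sum_neg_distrib]
        refine Finset.sum_le_sum fun j _ => ?_
        have h3 := norm_pow_sub_pow_le_of_norm_le_one hx1 (y := ξ * ‖x‖) (by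
          rw [norm_mul, hξ1, one_mul, Complex.norm_real, norm_norm]; exact hx1) (k + (j : ℕ))
        have h4 : ‖infinitesimalCoeff k a j * (x ^ (k + (j : ℕ)) - (ξ * ‖x‖) ^ (k + (j : ℕ)))‖ ≤
            ‖infinitesimalCoeff k a j‖ * ((k + (j : ℕ) : ℕ) * 2) / w.re := by
          rw [norm_mul, mul_div_assoc, mul_div_assoc]
          refine mul_le_mul_of_nonneg_left (h3.trans ?_) (norm_nonneg _)
          exact mul_le_mul_of_nonneg_left hclose (Nat.cast_nonneg _)
        exact (neg_le_neg h4).trans (neg_le_of_abs_le (Complex.abs_re_le_norm _))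
      rw [e1]; linarith
    have hlre : -(C / w.re) ≤ (Complex.log E - A).re := by
      refine le_trans ?_ (neg_le_of_abs_le (Complex.abs_re_le_norm _))
      refine neg_le_neg (hl.trans ?_)
      rw [norm_pow, div_eq_mul_inv]
      exact mul_le_mul_of_nonneg_left (norm_sectorRoot_pow_le hq hξ hre) hC.le
    rw [Complex.sub_re] at hlre
    have hexp : ‖E⁻¹‖ = Real.exp (-(Complex.log E).re) := by
      rw [← Complex.neg_re, ← Complex.norm_exp, Complex.exp_neg, Complex.exp_log hE]
    rw [mul_inv, norm_mul, norm_inv μ, hμ1, inv_one, one_mul, hexp]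
    set t := (C + C') / w.re with ht
    have ht0 : 0 ≤ t := by positivity
    have ht1 : t ≤ 1 := by
      rw [ht, div_le_one hre]; linarith [hw.1]
    have hle : -(Complex.log E).re ≤ t := by rw [ht, add_div]; linarith
    -- For `0 ≤ t ≤ 1` this gives `exp t ≤ 1 + 2 t`, the origin of the factor `2` in the chosen
    -- constant.
    have h5 := Real.abs_exp_sub_one_le (x := t) (by rwa [abs_of_nonneg ht0])
    rw [abs_of_nonneg ht0] at h5
    have h6 : 2 * (C + C') / w.re = 2 * t := by rw [ht]; ring
    rw [h6]
    linarith [Real.exp_le_exp.2 hle, (abs_le.1 h5).2]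
  -- If `‖μ‖ > 1` the multiplier is expanding near `0` and `c = 0` suffices.
  · have hμ1 : 1 < ‖μ‖ := (Real.log_pos_iff (norm_nonneg _)).1 h0
    have hlim2 : Tendsto (fun x : ℂ => ‖μ * (1 + x ^ k * a.eval x)‖) (𝓝 0) (𝓝 ‖μ‖) := by
      simpa using (hlim.const_mul μ).norm
    obtain ⟨ρ, h1, hρ⟩ := ((eventually_small_of_eventually_nhds
        (hlim2.eventually_const_lt hμ1)).and self_mem_nhdsWithin).exists
    refine ⟨0, le_rfl, ?_⟩
    have hρ2 : 0 < ρ / 2 := half_pos hρ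
    filter_upwards [eventually_norm_sectorRoot_le hq hξ hρ2] with s hs w hw
    have hxρ := hs w hw.1.le
    rw [norm_inv, zero_div, add_zero]
    exact inv_le_one_of_one_le₀ (h1 _ (by linarith)).le

/-- The inverse of the linear part `μ (1 + x ^ k a(x))` of a reduced pair in the fibres. -/
noncomputable def inverseMultiplier (k : ℕ) (μ : ℂ) (a : Polynomial ℂ) (x : ℂ) : ℂ :=
  (μ * (1 + x ^ k * a.eval x))⁻¹

theorem inverseMultiplier_analytic {k : ℕ} (hk : 1 ≤ k) {μ : ℂ} (hμ : μ ≠ 0) (a : Polynomial ℂ) :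
    AnalyticAt ℂ (inverseMultiplier k μ a) 0 ∧
      ∀ᶠ x in 𝓝 (0 : ℂ), μ * (1 + x ^ k * a.eval x) ≠ 0 := by
  have hd : Differentiable ℂ fun x : ℂ => μ * (1 + x ^ k * a.eval x) := by fun_prop
  have h0 : μ * (1 + (0 : ℂ) ^ k * a.eval 0) ≠ 0 := by
    rw [zero_pow (by omega)]; simpa using hμ
  exact ⟨(hd.analyticAt 0).inv h0, hd.continuous.continuousAt.eventually_ne h0⟩

/-! ### The map in the coordinate `w` -/

namespace NormalForm

variable {F : ℂ × ℂ → ℂ × ℂ} {U : Set (ℂ × ℂ)} {k p m L : ℕ} {μ ξ : ℂ} {a γ : Polynomial ℂ}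
  {H r : ℂ × ℂ → ℂ} {C ρ : ℝ}

/-- The new first coordinate `X` has `w`-coordinate `w + 1 + H`. Since `X / x` is close to `1`, no
change of branch occurs and `sectorRoot` returns `X`. -/
theorem eventually_semiconj (N : NormalForm F U k p m μ a γ H r C ρ) (hk : 1 ≤ k)
    (hξ : ξ ^ (k + p) = 1) : ∀ᶠ s in atTop, ∀ w : ℂ, s ≤ w.re → ∀ y : ℂ, ‖y‖ < ρ →
      ‖sectorRoot (k + p) ξ w‖ < ρ ∧
      F (sectorRoot (k + p) ξ w, y + γ.eval (sectorRoot (k + p) ξ w)) =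
        (sectorRoot (k + p) ξ (w + 1 + H (sectorRoot (k + p) ξ w, y)),
          μ * (1 + sectorRoot (k + p) ξ w ^ k * a.eval (sectorRoot (k + p) ξ w)) * y +
            r (sectorRoot (k + p) ξ w, y) +
            γ.eval (sectorRoot (k + p) ξ (w + 1 + H (sectorRoot (k + p) ξ w, y)))) := by
  have hq : k + p ≠ 0 := by omega
  obtain ⟨ε, hε, hu⟩ := Metric.eventually_nhds_iff.1 (eventually_sectorRoot_mul hq hξ)
  have hρ := N.ρ_pos
  have hC := N.C_nonneg
  filter_upwards [eventually_norm_sectorRoot_le hq hξ (half_pos hρ), eventually_gt_atTop 0,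
    eventually_gt_atTop (C / ε)] with s h1 h2 h3 w hw y hy
  have hre : 0 < w.re := h2.trans_le hw
  set x := sectorRoot (k + p) ξ w with hx
  have hx0 : x ≠ 0 := sectorRoot_ne_zero hq hξ w
  have hxρ : ‖x‖ < ρ := (h1 w hw).trans_lt (by linarith)
  refine ⟨hxρ, ?_⟩
  set X := (F (x, y + γ.eval x)).1 with hX
  have hcoord : (((k + p : ℕ) : ℂ) * X ^ (k + p))⁻¹ = w + 1 + H (x, y) := by
    rw [hX, N.coord x y hxρ hy hx0, hx, inv_mul_sectorRoot_pow hq hξ (ne_zero_of_re_pos hre)]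
  have hxn : 0 < ‖x‖ := norm_pos_iff.2 hx0
  have hXx : x * (X / x) = X := by field_simp
  have hquot : dist (X / x) 1 < ε := by
    rw [dist_eq_norm, div_sub_one hx0, norm_div, div_lt_iff₀ hxn]
    refine (N.fst_sub x y hxρ hy).trans_lt ?_
    rw [pow_succ, ← mul_assoc]
    refine mul_lt_mul_of_pos_right ?_ hxn
    have h4 := norm_sectorRoot_pow_le hq hξ hre
    calc C * ‖x‖ ^ (k + p) ≤ C * w.re⁻¹ := mul_le_mul_of_nonneg_left h4 hC
      _ < ε := by
        rw [← div_eq_mul_inv, div_lt_iff₀ hre]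
        rw [div_lt_iff₀ hε] at h3
        nlinarith
  have hroot : sectorRoot (k + p) ξ (w + 1 + H (x, y)) = X := by
    have := hu hquot w hre
    rw [← hx, hXx, hcoord] at this
    exact this
  refine Prod.ext hroot.symm ?_
  rw [N.snd x y, hroot]
  ring

/-- As `‖x‖ ^ (k + p) ≤ 1 / re w`, the contact order `(k + p) (L + 4)` in `x` becomes the exponent
`L + 4` in `1 / re w`, more than the structure requires. All constants are then absorbed by taking
`s` large and thus `x` small. -/
theorem eventually_fibredMap (N : NormalForm F U k p ((k + p) * (L + 4)) μ a γ H r C ρ)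
    (hk : 1 ≤ k) (hμ : μ ≠ 0) (hξ : ξ ^ (k + p) = 1) {c : ℝ} (hc : 0 ≤ c) (hcL : 4 * c + 28 ≤ L)
    (hmult : ∀ᶠ s in atTop, ∀ w ∈ parabolicRegion (k + p) s,
      ‖inverseMultiplier k μ a (sectorRoot (k + p) ξ w)‖ ≤ 1 + c / w.re) :
    ∀ᶠ s in atTop, FibredMap (parabolicRegion (k + p) s)
      (fun w => inverseMultiplier k μ a (sectorRoot (k + p) ξ w))
      (fun w y => H (sectorRoot (k + p) ξ w, y)) (fun w y => r (sectorRoot (k + p) ξ w, y))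
      c s L := by
  have hq : k + p ≠ 0 := by omega
  have hρ := N.ρ_pos
  have hC := N.C_nonneg
  obtain ⟨hEan, hEne⟩ := inverseMultiplier_analytic hk hμ a
  obtain ⟨K, hK, hElip⟩ := hEan.eventually_lipschitz
  obtain ⟨δ, ⟨hδ1, hδ2⟩, hδ0⟩ :=
    ((hElip.and hEan.eventually_differentiableOn).and self_mem_nhdsWithin).exists
  replace hδ0 : 0 < δ := hδ0
  set B : ℝ := 2 ^ ((k + p) * (L + 4) + 1) with hB
  have hB1 : 1 ≤ B := one_le_pow₀ (by norm_num)
  -- In order: room for Cauchy discs of twice the radius inside `ρ`; the domain where `e` is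
  -- controlled; Lipschitz constant at most `1` for `e`; and at most `1 / 2` for the Cauchy estimate
  -- of `r (·, 0)`, whose constant is `B`.
  set κ : ℝ := min (min (ρ / 3) (δ / 2)) (min (K + 1)⁻¹ (2 * (C + 1) * B)⁻¹) with hκ
  have hκ0 : 0 < κ := by positivity
  have hκρ : κ ≤ ρ / 3 := (min_le_left _ _).trans (min_le_left _ _)
  have hκδ : κ ≤ δ / 2 := (min_le_left _ _).trans (min_le_right _ _)
  have hκK : K * κ ≤ 1 := by
    have h : κ ≤ (K + 1)⁻¹ := (min_le_right _ _).trans (min_le_left _ _)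
    calc K * κ ≤ (K + 1) * (K + 1)⁻¹ := by gcongr; linarith
      _ = 1 := mul_inv_cancel₀ (by positivity)
  have hκB : C * B * κ ≤ 1 / 2 := by
    have h : κ ≤ (2 * (C + 1) * B)⁻¹ := (min_le_right _ _).trans (min_le_right _ _)
    calc C * B * κ ≤ (C + 1) * B * (2 * (C + 1) * B)⁻¹ := by gcongr; linarith
      _ = 1 / 2 := by field_simp
  have hκC : C * κ ≤ 1 / 2 := by
    refine le_trans ?_ hκB
    have : C * κ * 1 ≤ C * κ * B := mul_le_mul_of_nonneg_left hB1 (by positivity)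
    linarith
  have hκall := eventually_norm_sectorRoot_le hq hξ hκ0
  filter_upwards [hmult, hκall, eventually_ge_atTop 4, eventually_ge_atTop (((L : ℝ) + 2) / 2),
    eventually_ge_atTop C, eventually_ge_atTop (ρ / 2)⁻¹,
    eventually_add_one_mem_parabolicRegion hq (mul_nonneg zero_le_two hC)] with
    s₀ hm hκs₀ hs4 hsL hsC hsρ hstep
  have hs₀ : 0 < s₀ := by linarith
  have hlt : ∀ w ∈ parabolicRegion (k + p) s₀, s₀ < w.re := fun w hw => hw.1
  have hpos : ∀ w ∈ parabolicRegion (k + p) s₀, 0 < w.re := fun w hw => hs₀.trans (hlt w hw)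
  have hinv1 : ∀ s, s₀ ≤ s → s⁻¹ ≤ 1 := fun s hs => inv_le_one_of_one_le₀ (by linarith)
  have hyρ : ∀ s, s₀ ≤ s → ∀ y : ℂ, ‖y‖ ≤ s⁻¹ ^ (L + 2) → ‖y‖ ≤ s⁻¹ ∧ ‖y‖ < ρ := by
    intro s hs y hy
    have hs' : 0 < s := hs₀.trans_le hs
    have h1 : s⁻¹ ^ (L + 2) ≤ s⁻¹ := pow_le_of_le_one (by positivity) (hinv1 s hs) (by omega)
    refine ⟨hy.trans h1, (hy.trans h1).trans_lt ?_⟩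
    have : s⁻¹ ≤ ρ / 2 := inv_le_of_inv_le₀ (by positivity) (hsρ.trans hs)
    linarith
  have hxκ : ∀ w : ℂ, s₀ ≤ w.re → ‖sectorRoot (k + p) ξ w‖ ≤ κ := hκs₀
  have hxρ : ∀ w : ℂ, s₀ ≤ w.re → ‖sectorRoot (k + p) ξ w‖ < ρ := fun w hw =>
    (hxκ w hw).trans_lt (by linarith)
  have hxpow : ∀ s, s₀ ≤ s → ∀ w : ℂ, s ≤ w.re → ‖sectorRoot (k + p) ξ w‖ ^ (k + p) ≤ s⁻¹ := by
    intro s hs w hw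
    have hs' : 0 < s := hs₀.trans_le hs
    exact (norm_sectorRoot_pow_le hq hξ (hs'.trans_le hw)).trans (by gcongr)
  have hxlip : ∀ s, s₀ ≤ s → ∀ w w' : ℂ, s ≤ w.re → s ≤ w'.re →
      ‖sectorRoot (k + p) ξ w - sectorRoot (k + p) ξ w'‖ ≤ κ * s⁻¹ * ‖w - w'‖ := fun s hs w w' hw hw' =>
    lipschitz_sectorRoot hq (hs₀.trans_le hs) (fun v hv => hκs₀ v (hs.trans hv)) hw hw'
  have hψd : DifferentiableOn ℂ (sectorRoot (k + p) ξ) (parabolicRegion (k + p) s₀) := fun w hw =>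
    (hasDerivAt_sectorRoot hq (hpos w hw)).differentiableAt.differentiableWithinAt
  exact
  { isOpen := isOpen_parabolicRegion _ _
    one_le := hs4
    c_nonneg := hc
    c_le := hcL
    L_le := by linarith
    lt_re := hlt
    mapsTo := by
      intro w hw y hy
      refine hstep w hw _ ?_
      have h1 := hyρ w.re (hlt w hw).le y hy
      have h2 := hxpow w.re (hlt w hw).le w le_rfl
      refine (N.norm_H _ y (hxρ w (hlt w hw).le) h1.2).trans ?_
      rw [div_eq_mul_inv, mul_comm 2 C, mul_assoc]
      exact mul_le_mul_of_nonneg_left (by linarith [h1.1]) hC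
    norm_e := hm
    lip_e := by
      intro w hw w' hw'
      have h1 := hxκ w (hlt w hw).le
      have h2 := hxκ w' (hlt w' hw').le
      refine (hδ1 _ _ (h1.trans_lt (by linarith)) (h2.trans_lt (by linarith))).trans ?_
      have h3 := hxlip s₀ le_rfl w w' (hlt w hw).le (hlt w' hw').le
      calc _ ≤ K * (κ * s₀⁻¹ * ‖w - w'‖) := mul_le_mul_of_nonneg_left h3 hK
        _ = (K * κ) * (s₀⁻¹ * ‖w - w'‖) := by ring
        _ ≤ 1 * (1 * ‖w - w'‖) := by
          refine mul_le_mul hκK ?_ (by positivity) zero_le_one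
          exact mul_le_mul_of_nonneg_right (hinv1 s₀ le_rfl) (norm_nonneg _)
        _ = _ := by ring
    lip_H := by
      intro s hs w _ w' _ hws hws' y y' hy hy'
      have hs' : 0 < s := hs₀.trans_le hs
      refine (N.lip_H _ _ _ _ (hxρ w (hs.trans hws)) (hyρ s hs y hy).2 (hxρ w' (hs.trans hws'))
        (hyρ s hs y' hy').2).trans ?_
      have h3 := hxlip s hs w w' hws hws'
      have h4 : C * ‖y - y'‖ ≤ s * ‖y - y'‖ :=
        mul_le_mul_of_nonneg_right (hsC.trans hs) (norm_nonneg _)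
      have h5 : C * ‖sectorRoot (k + p) ξ w - sectorRoot (k + p) ξ w'‖ ≤ s⁻¹ * ‖w - w'‖ := by
        calc _ ≤ C * (κ * s⁻¹ * ‖w - w'‖) := mul_le_mul_of_nonneg_left h3 hC
          _ = (C * κ) * (s⁻¹ * ‖w - w'‖) := by ring
          _ ≤ 1 * (s⁻¹ * ‖w - w'‖) :=
            mul_le_mul_of_nonneg_right (by linarith) (by positivity)
          _ = _ := one_mul _
      rw [mul_add]
      exact add_le_add h5 h4
    norm_r := by
      intro w hw
      have hre := hpos w hw
      refine (N.norm_r _ (hxρ w (hlt w hw).le)).trans ?_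
      have h2 := hxpow w.re (hlt w hw).le w le_rfl
      have h3 : ‖sectorRoot (k + p) ξ w‖ ^ ((k + p) * (L + 4)) ≤ w.re⁻¹ ^ (L + 3) := by
        rw [pow_mul]
        refine (pow_le_pow_left₀ (by positivity) h2 _).trans ?_
        exact pow_le_pow_of_le_one (by positivity) (hinv1 _ (hlt w hw).le) (by omega)
      rw [pow_succ]
      calc C * (‖sectorRoot (k + p) ξ w‖ ^ ((k + p) * (L + 4)) * ‖sectorRoot (k + p) ξ w‖)
          ≤ C * (w.re⁻¹ ^ (L + 3) * κ) :=
            mul_le_mul_of_nonneg_left (mul_le_mul h3 (hxκ w (hlt w hw).le) (norm_nonneg _)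
              (by positivity)) hC
        _ = (C * κ) * w.re⁻¹ ^ (L + 3) := by ring
        _ ≤ 1 * w.re⁻¹ ^ (L + 3) := mul_le_mul_of_nonneg_right (by linarith) (by positivity)
        _ = _ := one_mul _
    lip_r := by
      intro s hs w _ w' _ hws hws' y y' hy hy'
      have hs' : 0 < s := hs₀.trans_le hs
      set x := sectorRoot (k + p) ξ w with hx
      set x' := sectorRoot (k + p) ξ w' with hx'
      have hxr : ‖x‖ < ρ := hxρ w (hs.trans hws)
      have hxr' : ‖x'‖ < ρ := hxρ w' (hs.trans hws')
      have hl := hxlip s hs w w' hws hws'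
      rw [← hx, ← hx'] at hl
      have h1 : ‖r (x, y) - r (x, y')‖ ≤ s⁻¹ * ‖y - y'‖ := by
        refine (N.lip_r_snd x y y' hxr (hyρ s hs y hy).2 (hyρ s hs y' hy').2).trans ?_
        refine mul_le_mul_of_nonneg_right ?_ (norm_nonneg _)
        rw [pow_succ]
        calc C * (‖x‖ ^ (k + p) * ‖x‖) ≤ C * (s⁻¹ * κ) :=
              mul_le_mul_of_nonneg_left (mul_le_mul (hxpow s hs w hws) (hxκ w (hs.trans hws))
                (norm_nonneg _) (by positivity)) hC
          _ = (C * κ) * s⁻¹ := by ring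
          _ ≤ 1 * s⁻¹ := mul_le_mul_of_nonneg_right (by linarith) (by positivity)
          _ = _ := one_mul _
      have hinvκ : κ * s⁻¹ ≤ κ := mul_le_of_le_one_right hκ0.le (hinv1 s hs)
      have hl' : ‖x - x'‖ ≤ κ * ‖w - w'‖ :=
        hl.trans (mul_le_mul_of_nonneg_right hinvκ (norm_nonneg _))
      have h2 : ‖(r (x, y') - r (x, 0)) - (r (x', y') - r (x', 0))‖ ≤
          1 / 2 * (s⁻¹ ^ (L + 2) * ‖w - w'‖) := by
        refine (N.mixed_r x x' y' hxr hxr' (hyρ s hs y' hy').2).trans ?_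
        calc C * ‖y'‖ * ‖x - x'‖ ≤ C * s⁻¹ ^ (L + 2) * (κ * ‖w - w'‖) :=
              mul_le_mul (mul_le_mul_of_nonneg_left hy' hC) hl' (norm_nonneg _) (by positivity)
          _ = (C * κ) * (s⁻¹ ^ (L + 2) * ‖w - w'‖) := by ring
          _ ≤ _ := mul_le_mul_of_nonneg_right hκC (by positivity)
      have h3 : ‖r (x, 0) - r (x', 0)‖ ≤ 1 / 2 * (s⁻¹ ^ (L + 2) * ‖w - w'‖) := by
        set t := max ‖x‖ ‖x'‖ with ht
        have htκ : t ≤ κ := max_le (hxκ w (hs.trans hws)) (hxκ w' (hs.trans hws'))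
        have ht0 : 0 < t := lt_max_of_lt_left (norm_pos_iff.2 (sectorRoot_ne_zero hq hξ w))
        have htpow : t ^ ((k + p) * (L + 4)) ≤ s⁻¹ ^ (L + 2) := by
          have h : t ^ (k + p) ≤ s⁻¹ := by
            rcases max_choice ‖x‖ ‖x'‖ with h | h
            · rw [ht, h]; exact hxpow s hs w hws
            · rw [ht, h]; exact hxpow s hs w' hws'
          rw [pow_mul]
          refine (pow_le_pow_left₀ (by positivity) h _).trans ?_
          exact pow_le_pow_of_le_one (by positivity) (hinv1 s hs) (by omega)
        have hd : ∀ z : ℂ, ‖z‖ < ρ → DifferentiableAt ℂ (fun z => r (z, 0)) z := fun z hz => by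
          have h : DifferentiableAt ℂ r (z, 0) := N.diff_r _ (norm_prod_lt hz (by simpa using hρ))
          exact h.comp z (differentiableAt_id.prodMk (differentiableAt_const 0))
        refine (lipschitz_of_norm_le_pow hd N.norm_r ht0 (by linarith) (le_max_left _ _)
          (le_max_right _ _)).trans ?_
        calc C * 2 ^ ((k + p) * (L + 4) + 1) * t ^ ((k + p) * (L + 4)) * ‖x - x'‖
            ≤ C * B * s⁻¹ ^ (L + 2) * (κ * ‖w - w'‖) :=
              mul_le_mul (mul_le_mul_of_nonneg_left htpow (by positivity)) hl' (norm_nonneg _)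
                (by positivity)
          _ = (C * B * κ) * (s⁻¹ ^ (L + 2) * ‖w - w'‖) := by ring
          _ ≤ _ := mul_le_mul_of_nonneg_right hκB (by positivity)
      -- The change in `y` is small because of `x ^ (k + p + 1)`. The change in `x` is split into a
      -- mixed difference, which carries `‖y'‖`, and the variation of the defect `r (·, 0)`, which
      -- has high order; each of these two receives half of the allowed constant.
      have e : r (x, y) - r (x', y') = (r (x, y) - r (x, y')) +
          ((r (x, y') - r (x, 0)) - (r (x', y') - r (x', 0))) + (r (x, 0) - r (x', 0)) := by ring
      show ‖r (x, y) - r (x', y')‖ ≤ _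
      rw [e]
      refine (norm_add₃_le).trans ?_
      linarith
    diff_e := fun w hw => by
      have h : DifferentiableAt ℂ (inverseMultiplier k μ a) (sectorRoot (k + p) ξ w) :=
        hδ2 _ ((hxκ w (hlt w hw).le).trans_lt (by linarith))
      exact h.comp_differentiableWithinAt w (hψd w hw)
    diff_comp := by
      intro φ hφ hφb
      have hn : ∀ w ∈ parabolicRegion (k + p) s₀, ‖(sectorRoot (k + p) ξ w, φ w)‖ < ρ :=
        fun w hw => norm_prod_lt (hxρ w (hlt w hw).le) (hyρ _ (hlt w hw).le _ (hφb w hw)).2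
      exact ⟨fun w hw => (N.diff_H _ (hn w hw)).comp_differentiableWithinAt w
          ((hψd w hw).prodMk (hφ w hw)),
        fun w hw => (N.diff_r _ (hn w hw)).comp_differentiableWithinAt w
          ((hψd w hw).prodMk (hφ w hw))⟩ }

end NormalForm

/-! ### Invariant curves with prescribed contact, and their coincidence -/

theorem IsReducedForm.multiplier_ne_zero {F : ℂ × ℂ → ℂ × ℂ} {U : Set (ℂ × ℂ)}
    {Γ : Ideal FormalSeries} {k p : ℕ} {μ : ℂ} {a : Polynomial ℂ} (hF : IsDiffeoGerm F U)
    (hred : IsReducedForm F Γ k p μ a) : μ ≠ 0 := by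
  rintro rfl
  obtain ⟨g, b, -, -, h⟩ := hred.snd_eq
  obtain ⟨T, hT⟩ := hF.invertible
  have h1 : HasFDerivAt (fun z => (F z).2)
      ((ContinuousLinearMap.snd ℂ ℂ ℂ).comp (T : (ℂ × ℂ) →L[ℂ] (ℂ × ℂ))) 0 := hT.snd
  have h2 : HasFDerivAt (fun z => (F z).2) (0 : (ℂ × ℂ) →L[ℂ] ℂ) 0 := by
    refine (hasFDerivAt_const (0 : ℂ) _).congr_of_eventuallyEq ?_
    filter_upwards [h] with z hz
    rw [hz, zero_mul]
  have h3 := congrArg (fun A : (ℂ × ℂ) →L[ℂ] ℂ => A (T.symm (0, 1))) (h1.unique h2)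
  simp at h3

theorem exists_norm_trunc_sub_le (c : PowerSeries ℂ) {n n' : ℕ} (h : n ≤ n') :
    ∃ C : ℝ, 0 ≤ C ∧ ∀ x : ℂ, ‖x‖ ≤ 1 →
      ‖(PowerSeries.trunc n' c).eval x - (PowerSeries.trunc n c).eval x‖ ≤ C * ‖x‖ ^ n := by
  have hdvd : Polynomial.X ^ n ∣ PowerSeries.trunc n' c - PowerSeries.trunc n c := by
    rw [Polynomial.X_pow_dvd_iff]
    intro d hd
    simp [PowerSeries.coeff_trunc, hd, hd.trans_le h]
  obtain ⟨g, hg⟩ := hdvd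
  obtain ⟨C, hC⟩ := (isCompact_closedBall (0 : ℂ) 1).exists_bound_of_continuousOn
    (f := fun x => g.eval x) g.continuous.continuousOn
  refine ⟨max C 0, le_max_right _ _, fun x hx => ?_⟩
  rw [← Polynomial.eval_sub, hg, Polynomial.eval_mul, norm_mul, Polynomial.eval_pow,
    Polynomial.eval_X, norm_pow, mul_comm]
  exact mul_le_mul_of_nonneg_right ((hC x (by simpa using hx)).trans (le_max_left _ _))
    (by positivity)

/-- The curve `w ↦ (ψ w, g w)`, where `ψ` is a branch of the inverse of `x ↦ (q x ^ q)⁻¹`, is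
invariant over the parabolic region of height `s`, and attracts the orbits with contact of order `N`
with the graph of `γ`. -/
structure InvariantGraph (F : ℂ × ℂ → ℂ × ℂ) (U : Set (ℂ × ℂ)) (q : ℕ) (ξ : ℂ) (γ : Polynomial ℂ)
    (s : ℝ) (N : ℕ) (g : ℂ → ℂ) : Prop where
  diff : DifferentiableOn ℂ g (parabolicRegion q s)
  norm_sub : ∀ w ∈ parabolicRegion q s, ‖g w - γ.eval (sectorRoot q ξ w)‖ ≤ w.re⁻¹ ^ N
  mem : ∀ w ∈ parabolicRegion q s, (sectorRoot q ξ w, g w) ∈ U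
  step : ∀ w ∈ parabolicRegion q s, ∃ w' ∈ parabolicRegion q s, w.re + 1 / 2 ≤ w'.re ∧
    F (sectorRoot q ξ w, g w) = (sectorRoot q ξ w', g w')
  unique : ∀ w y : ℕ → ℂ, (∀ n, w n ∈ parabolicRegion q s) →
    (∀ n, ‖y n - γ.eval (sectorRoot q ξ (w n))‖ ≤ (w n).re⁻¹ ^ N) →
    (∀ n, F (sectorRoot q ξ (w n), y n) = (sectorRoot q ξ (w (n + 1)), y (n + 1))) →
    y 0 = g (w 0)

theorem sectorRoot_injOn {q : ℕ} {ξ : ℂ} (hq : q ≠ 0) (hξ : ξ ^ q = 1) {w w' : ℂ} (hw : w ≠ 0)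
    (hw' : w' ≠ 0) (h : sectorRoot q ξ w = sectorRoot q ξ w') : w = w' := by
  rw [← inv_mul_sectorRoot_pow hq hξ hw, h, inv_mul_sectorRoot_pow hq hξ hw']

theorem NormalForm.eventually_invariantGraph {F : ℂ × ℂ → ℂ × ℂ} {U : Set (ℂ × ℂ)} {k p L : ℕ}
    {μ ξ : ℂ} {a γ : Polynomial ℂ} {H r : ℂ × ℂ → ℂ} {C ρ : ℝ}
    (N : NormalForm F U k p ((k + p) * (L + 4)) μ a γ H r C ρ)
    (hk : 1 ≤ k) (hμ : μ ≠ 0) (hξ : ξ ^ (k + p) = 1) {c : ℝ} (hc : 0 ≤ c) (hcL : 4 * c + 28 ≤ L)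
    (hmult : ∀ᶠ s in atTop, ∀ w ∈ parabolicRegion (k + p) s,
      ‖inverseMultiplier k μ a (sectorRoot (k + p) ξ w)‖ ≤ 1 + c / w.re) :
    ∀ᶠ s in atTop, ∃ g, InvariantGraph F U (k + p) ξ γ s (L + 2) g := by
  have hq : k + p ≠ 0 := by omega
  have hρ := N.ρ_pos
  obtain ⟨δ, hδ, hne⟩ := Metric.eventually_nhds_iff.1 (inverseMultiplier_analytic hk hμ a).2
  filter_upwards [N.eventually_fibredMap hk hμ hξ hc hcL hmult, N.eventually_semiconj hk hξ,
    eventually_ge_atTop (ρ / 2)⁻¹, eventually_norm_sectorRoot_le hq hξ (half_pos hδ)] with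
    s D hsemi hsρ hsδ
  obtain ⟨φ, hφ, hfix⟩ := D.exists_fixed
  have hlt : ∀ w ∈ parabolicRegion (k + p) s, s < w.re := fun w hw => hw.1
  have hyρ : ∀ w ∈ parabolicRegion (k + p) s, ∀ y : ℂ, ‖y‖ ≤ w.re⁻¹ ^ (L + 2) → ‖y‖ < ρ := by
    intro w hw y hy
    have hre := D.re_pos hw
    have h4 := D.one_le
    have h1 : w.re⁻¹ ^ (L + 2) ≤ w.re⁻¹ :=
      pow_le_of_le_one (by positivity) (inv_le_one_of_one_le₀ (by linarith [hlt w hw])) (by omega)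
    have h2 : w.re⁻¹ ≤ ρ / 2 := inv_le_of_inv_le₀ (by positivity) (hsρ.trans (hlt w hw).le)
    linarith
  have hE : ∀ w ∈ parabolicRegion (k + p) s,
      μ * (1 + sectorRoot (k + p) ξ w ^ k * a.eval (sectorRoot (k + p) ξ w)) ≠ 0 := by
    intro w hw
    refine hne ?_
    rw [dist_zero_right]
    exact (hsδ w (hlt w hw).le).trans_lt (by linarith)
  have hstep : ∀ w ∈ parabolicRegion (k + p) s, ∀ y : ℂ, ‖y‖ ≤ w.re⁻¹ ^ (L + 2) → _ :=
    fun w hw y hy => (hsemi w (hlt w hw).le y (hyρ w hw y hy))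
  refine ⟨fun w => φ w + γ.eval (sectorRoot (k + p) ξ w), ?_, ?_, ?_, ?_, ?_⟩
  · refine hφ.diff.add ?_
    exact γ.differentiable.comp_differentiableOn fun w hw =>
      (hasDerivAt_sectorRoot hq (D.re_pos hw)).differentiableAt.differentiableWithinAt
  · intro w hw
    rw [add_sub_cancel_right]
    exact hφ.norm_le w hw
  · intro w hw
    exact N.mem _ _ (hstep w hw _ (hφ.norm_le w hw)).1 (hyρ w hw _ (hφ.norm_le w hw))
  · intro w hw
    have hb := hφ.norm_le w hw
    obtain ⟨m1, m2⟩ := D.mapsTo w hw _ hb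
    refine ⟨_, m1, m2, ?_⟩
    rw [(hstep w hw _ hb).2]
    refine Prod.ext rfl ?_
    show _ + _ = _ + _
    congr 1
    have h := hfix w hw
    -- Multiplied by the multiplier, the fixed point equation says that the image of a point of the
    -- graph is the point of the graph over the new `w`.
    rw [graphTransform, inverseMultiplier, inv_mul_eq_iff_eq_mul₀ (hE w hw)] at h
    rw [← h]; ring
  · intro w y hw hy hF
    have hstep' := fun n => (hstep (w n) (hw n) _ (hy n)).2
    simp only [sub_add_cancel, hF] at hstep'
    -- The first coordinates determine the `w`-coordinates because `sectorRoot` is injective; this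
    -- turns an orbit of `F` into one of the fibred map.
    have h1 : ∀ n, w (n + 1) = w n + 1 +
        H (sectorRoot (k + p) ξ (w n), y n - γ.eval (sectorRoot (k + p) ξ (w n))) := by
      intro n
      refine sectorRoot_injOn hq hξ (ne_zero_of_re_pos (D.re_pos (hw (n + 1)))) ?_
        (congrArg Prod.fst (hstep' n))
      exact ne_zero_of_re_pos (D.re_pos (D.mapsTo _ (hw n) _ (hy n)).1)
    have h2 := D.eq_of_orbit hφ hfix hw hy h1 (fun n => by
      rw [inverseMultiplier, eq_inv_mul_iff_mul_eq₀ (hE _ (hw n))]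
      have := congrArg Prod.snd (hstep' n)
      simp only [← h1 n] at this
      rw [this]; ring)
    rw [← h2]; ring

theorem exists_invariantGraph {F : ℂ × ℂ → ℂ × ℂ} {U : Set (ℂ × ℂ)} (hF : IsDiffeoGerm F U)
    {c : PowerSeries ℂ} {k p : ℕ} {μ ξ : ℂ} {a : Polynomial ℂ}
    (hinv : IsInvariantCurve F (Ideal.span {graphEquation c}))
    (hred : IsReducedForm F (Ideal.span {graphEquation c}) k p μ a)
    (hc : ((k + p + 2 : ℕ) : ℕ∞) ≤ c.order) (hξ : IsSaddleDirection k p μ a ξ) :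
    ∃ L₀ : ℕ, ∀ L ≥ L₀, ∀ᶠ s in atTop, ∃ g,
      InvariantGraph F U (k + p) ξ (PowerSeries.trunc ((k + p) * (L + 4) + 1) c) s (L + 2) g := by
  have hμ := hred.multiplier_ne_zero hF
  obtain ⟨b, hb, hmult⟩ := exists_multiplier_bound hred.one_le hμ hξ
  obtain ⟨L₀, hL₀⟩ := exists_nat_ge (4 * b + 28)
  refine ⟨L₀, fun L hL => ?_⟩
  obtain ⟨H, r, C, ρ, N⟩ := exists_normalForm hF hinv hred hc ((k + p) * (L + 4))
  exact N.eventually_invariantGraph hred.one_le hμ hξ.1 hb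
    (hL₀.trans (by exact_mod_cast hL)) hmult

/-- Far to the right, an orbit on the curve of higher contact also satisfies the weaker closeness
condition attached to `L`, so the uniqueness property of `g` places it on the other curve. Thus one
curve inherits all orders of contact. -/
theorem InvariantGraph.eventually_eq {F : ℂ × ℂ → ℂ × ℂ} {U : Set (ℂ × ℂ)} {q : ℕ} {ξ : ℂ}
    (hq : q ≠ 0) (hξ : ξ ^ q = 1) {c : PowerSeries ℂ} {L L' : ℕ} (hL : L < L') {s s' : ℝ}
    {g g' : ℂ → ℂ}
    (G : InvariantGraph F U q ξ (PowerSeries.trunc (q * (L + 4) + 1) c) s (L + 2) g)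
    (G' : InvariantGraph F U q ξ (PowerSeries.trunc (q * (L' + 4) + 1) c) s' (L' + 2) g') :
    ∀ᶠ t in atTop, ∀ w ∈ parabolicRegion q t, g' w = g w := by
  obtain ⟨C, hC, htr⟩ := exists_norm_trunc_sub_le c
    (show q * (L + 4) + 1 ≤ q * (L' + 4) + 1 by gcongr)
  filter_upwards [eventually_ge_atTop s, eventually_ge_atTop s', eventually_ge_atTop (C + 1),
    eventually_norm_sectorRoot_le hq hξ zero_lt_one] with t hs hs' ht h1 w hw
  have hnext : ∀ v : parabolicRegion q t, ∃ v' : parabolicRegion q t,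
      F (sectorRoot q ξ v, g' v) = (sectorRoot q ξ v', g' v') := by
    rintro ⟨v, hv⟩
    obtain ⟨v', hv', hre, hFv⟩ := G'.step v (parabolicRegion_mono q hs' hv)
    have h2 : t < v.re := hv.1
    exact ⟨⟨v', by linarith, hv'.2⟩, hFv⟩
  choose f hf using hnext
  set o : ℕ → parabolicRegion q t := fun n => f^[n] ⟨w, hw⟩ with ho
  refine G.unique (fun n => (o n).1) (fun n => g' (o n).1)
    (fun n => parabolicRegion_mono q hs (o n).2) (fun n => ?_) (fun n => ?_)
  · set v : ℂ := (o n).1 with hv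
    have hvt : v ∈ parabolicRegion q t := (o n).2
    have hre : t < v.re := hvt.1
    have hpos : 0 < v.re := by linarith
    have hx1 := h1 v hre.le
    have e1 := G'.norm_sub v (parabolicRegion_mono q hs' hvt)
    have e2 := htr _ hx1
    have e3 : ‖sectorRoot q ξ v‖ ^ (q * (L + 4) + 1) ≤ v.re⁻¹ ^ (L + 3) := by
      have hpow := norm_sectorRoot_pow_le hq hξ hpos
      have hi1 : v.re⁻¹ ≤ 1 := inv_le_one_of_one_le₀ (by linarith)
      calc _ ≤ ‖sectorRoot q ξ v‖ ^ (q * (L + 4)) :=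
            pow_le_pow_of_le_one (norm_nonneg _) hx1 (by omega)
        _ ≤ v.re⁻¹ ^ (L + 4) := by rw [pow_mul]; exact pow_le_pow_left₀ (by positivity) hpow _
        _ ≤ _ := pow_le_pow_of_le_one (by positivity) hi1 (by omega)
    have e4 : v.re⁻¹ ^ (L' + 2) ≤ v.re⁻¹ ^ (L + 3) :=
      pow_le_pow_of_le_one (by positivity) (inv_le_one_of_one_le₀ (by linarith)) (by omega)
    -- The spare power of `1 / re v` absorbs the constant, as `re v > t ≥ C + 1`.
    have e5 : (C + 1) * v.re⁻¹ ^ (L + 3) ≤ v.re⁻¹ ^ (L + 2) := by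
      rw [pow_succ _ (L + 2), mul_comm, mul_assoc]
      refine mul_le_of_le_one_right (by positivity) ?_
      rw [inv_mul_le_one₀ hpos]; linarith
    have e6 := mul_le_mul_of_nonneg_left e3 hC
    refine (norm_sub_le_norm_sub_add_norm_sub _
      ((PowerSeries.trunc (q * (L' + 4) + 1) c).eval (sectorRoot q ξ v)) _).trans ?_
    linarith
  · have : o (n + 1) = f (o n) := Function.iterate_succ_apply' f n _
    rw [this]
    exact hf (o n)

/-! ### Iterated tangents -/

/-- The sequence of infinitely near points of the formal curve `y = c(x)`. -/
noncomputable def graphTangents (c : PowerSeries ℂ) (n : ℕ) : OnePoint ℂ :=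
  OnePoint.some (PowerSeries.coeff (n + 1) c)

theorem eval_trunc_succ (c : PowerSeries ℂ) (n : ℕ) (x : ℂ) :
    (PowerSeries.trunc (n + 1) c).eval x =
      (PowerSeries.trunc n c).eval x + PowerSeries.coeff n c * x ^ n := by
  rw [PowerSeries.trunc_succ, Polynomial.eval_add, Polynomial.eval_monomial]

theorem mem_iteratedTransform_graphTangents {c : PowerSeries ℂ}
    (hc : PowerSeries.constantCoeff c = 0) (S : Set (ℂ × ℂ)) (n : ℕ) (x y : ℂ) :
    (x, y) ∈ iteratedTransform (graphTangents c) S n ↔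
      (x, x ^ n * y + (PowerSeries.trunc (n + 1) c).eval x) ∈ S := by
  induction n generalizing y with
  | zero =>
    rw [eval_trunc_succ, PowerSeries.trunc_zero', PowerSeries.coeff_zero_eq_constantCoeff_apply, hc]
    simp [iteratedTransform]
  | succ n ih =>
    have h : (x, y) ∈ iteratedTransform (graphTangents c) S (n + 1) ↔
        (x, x * (y + PowerSeries.coeff (n + 1) c)) ∈ iteratedTransform (graphTangents c) S n :=
      Iff.rfl
    rw [h, ih, eval_trunc_succ c (n + 1)]
    ring_nf

theorem mem_blowUpChart_some_iff {c : PowerSeries ℂ} (hc : PowerSeries.constantCoeff c = 0)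
    (S : Set (ℂ × ℂ)) (n : ℕ) (d x y : ℂ) :
    (x, y) ∈ blowUpChart (OnePoint.some d) ⁻¹' iteratedTransform (graphTangents c) S n ↔
      (x, x ^ (n + 1) * (y + d) + (PowerSeries.trunc (n + 1) c).eval x) ∈ S := by
  have h : (x, y) ∈ blowUpChart (OnePoint.some d) ⁻¹' iteratedTransform (graphTangents c) S n ↔
      (x, x * (y + d)) ∈ iteratedTransform (graphTangents c) S n := Iff.rfl
  rw [h, mem_iteratedTransform_graphTangents hc, pow_succ, mul_assoc]

theorem mem_blowUpChart_infty_iff {c : PowerSeries ℂ} (hc : PowerSeries.constantCoeff c = 0)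
    (S : Set (ℂ × ℂ)) (n : ℕ) (x y : ℂ) :
    (x, y) ∈ blowUpChart OnePoint.infty ⁻¹' iteratedTransform (graphTangents c) S n ↔
      (x * y, (x * y) ^ n * y + (PowerSeries.trunc (n + 1) c).eval (x * y)) ∈ S := by
  have h : (x, y) ∈ blowUpChart OnePoint.infty ⁻¹' iteratedTransform (graphTangents c) S n ↔
      (x * y, y) ∈ iteratedTransform (graphTangents c) S n := Iff.rfl
  rw [h, mem_iteratedTransform_graphTangents hc]

theorem zero_mem_closure_prod_iff {A : Set (ℂ × ℂ)} : (0 : ℂ × ℂ) ∈ closure A ↔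
    ∀ ε > 0, ∃ x y : ℂ, ‖x‖ < ε ∧ ‖y‖ < ε ∧ (x, y) ∈ A := by
  rw [Metric.mem_closure_iff]
  refine forall₂_congr fun ε _ => ⟨?_, ?_⟩
  · rintro ⟨⟨x, y⟩, hA, hd⟩
    rw [dist_zero_left, Prod.norm_mk, max_lt_iff] at hd
    exact ⟨x, y, hd.1, hd.2, hA⟩
  · rintro ⟨x, y, hx, hy, hA⟩
    exact ⟨(x, y), hA, by rw [dist_zero_left, Prod.norm_mk]; exact max_lt hx hy⟩

/-- A graph asymptotic to the series `c` has the iterated tangents of the formal curve `y = c(x)`. -/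
theorem hasIteratedTangents_graphOn {c : PowerSeries ℂ} (hc : PowerSeries.constantCoeff c = 0)
    {R : Set ℂ} {Φ : ℂ → ℂ} (h0 : (0 : ℂ) ∉ R) (hcl : (0 : ℂ) ∈ closure R)
    (hΦ : ∀ N : ℕ, ∃ C δ : ℝ, 0 < δ ∧ ∀ x ∈ R, ‖x‖ < δ →
      ‖Φ x - (PowerSeries.trunc N c).eval x‖ ≤ C * ‖x‖ ^ N) :
    HasIteratedTangents (R.graphOn Φ) (graphTangents c) := by
  have hxne : ∀ x ∈ R, x ≠ 0 := fun x hx h => h0 (h ▸ hx)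
  intro n d
  obtain ⟨C, δ, hδ, hC⟩ := hΦ (n + 2)
  -- Two orders beyond `n` are used: one for the coefficient of degree `n + 1`, and one to make the
  -- deviation from it `O(‖x‖)`.
  have hC0 : ∀ x ∈ R, ‖x‖ < δ → ∀ y : ℂ,
      Φ x = x ^ (n + 1) * y + (PowerSeries.trunc (n + 1) c).eval x →
      ‖y - PowerSeries.coeff (n + 1) c‖ ≤ C * ‖x‖ := by
    intro x hx hxδ y hy
    have h := hC x hx hxδ
    have hpos : 0 < ‖x‖ ^ (n + 1) := pow_pos (norm_pos_iff.2 (hxne x hx)) _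
    have e : Φ x - (PowerSeries.trunc (n + 2) c).eval x =
        x ^ (n + 1) * (y - PowerSeries.coeff (n + 1) c) := by
      rw [hy, eval_trunc_succ c (n + 1)]; ring
    rw [e, norm_mul, norm_pow, pow_succ _ (n + 1), ← mul_assoc, mul_comm C, mul_assoc] at h
    exact le_of_mul_le_mul_left h hpos
  rw [zero_mem_closure_prod_iff]
  cases d with
  | coe d =>
    have hmem : ∀ x y : ℂ,
        (x, y) ∈ blowUpChart (d : OnePoint ℂ) ⁻¹' iteratedTransform (graphTangents c) (R.graphOn Φ) n
          ↔ x ∈ R ∧ Φ x = x ^ (n + 1) * (y + d) + (PowerSeries.trunc (n + 1) c).eval x := by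
      intro x y
      refine (mem_blowUpChart_some_iff hc _ n d x y).trans ?_
      simp [Set.graphOn]
    simp only [hmem]
    constructor
    · intro h
      refine congrArg OnePoint.some ?_
      rw [← sub_eq_zero, ← norm_eq_zero]
      refine le_antisymm (le_of_forall_pos_le_add fun η hη => ?_) (norm_nonneg _)
      obtain ⟨x, y, hx, hy, hxR, hxy⟩ := h (min δ (η / (|C| + 1))) (by positivity)
      have h1 := hC0 x hxR (hx.trans_le (min_le_left _ _)) (y + d) hxy
      have h2 : ‖x‖ < η / (|C| + 1) := hx.trans_le (min_le_right _ _)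
      have h3 : ‖y‖ < η / (|C| + 1) := hy.trans_le (min_le_right _ _)
      have h4 : C * ‖x‖ ≤ |C| * (η / (|C| + 1)) :=
        mul_le_mul (le_abs_self C) h2.le (norm_nonneg _) (abs_nonneg _)
      have h5 : |C| * (η / (|C| + 1)) + η / (|C| + 1) = η := by field_simp
      have e : d - PowerSeries.coeff (n + 1) c = (y + d - PowerSeries.coeff (n + 1) c) - y := by ring
      rw [e]
      have := norm_sub_le (y + d - PowerSeries.coeff (n + 1) c) y
      linarith
    · intro h ε hε
      have hd : d = PowerSeries.coeff (n + 1) c := OnePoint.coe_injective h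
      obtain ⟨x, hx, hxn⟩ := Metric.mem_closure_iff.1 hcl (min (min δ ε) (ε / (|C| + 1))) (by positivity)
      rw [dist_zero_left] at hxn
      have hx1 : ‖x‖ < δ := hxn.trans_le ((min_le_left _ _).trans (min_le_left _ _))
      have hx2 : ‖x‖ < ε := hxn.trans_le ((min_le_left _ _).trans (min_le_right _ _))
      have hx3 : ‖x‖ < ε / (|C| + 1) := hxn.trans_le (min_le_right _ _)
      have hxy : Φ x = x ^ (n + 1) * ((Φ x - (PowerSeries.trunc (n + 1) c).eval x) / x ^ (n + 1)
          - d + d) + (PowerSeries.trunc (n + 1) c).eval x := by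
        have := pow_ne_zero (n + 1) (hxne x hx)
        field_simp; ring
      refine ⟨x, (Φ x - (PowerSeries.trunc (n + 1) c).eval x) / x ^ (n + 1) - d, hx2, ?_, hx, hxy⟩
      have h1 := hC0 x hx hx1 _ hxy
      rw [← hd, add_sub_cancel_right] at h1
      refine h1.trans_lt ?_
      calc C * ‖x‖ ≤ |C| * (ε / (|C| + 1)) :=
            mul_le_mul (le_abs_self C) hx3.le (norm_nonneg _) (abs_nonneg _)
        _ < ε := by
          rw [mul_div_assoc', div_lt_iff₀ (by positivity)]; nlinarith [abs_nonneg C]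
  | infty =>
    refine ⟨fun h => ?_, fun h => absurd h.symm (OnePoint.coe_ne_infty _)⟩
    exfalso
    set K : ℝ := |C| * δ + ‖PowerSeries.coeff (n + 1) c‖ with hK
    have hK0 : 0 ≤ K := by positivity
    obtain ⟨x, y, hx, hy, hxy⟩ := h (min (min 1 δ) (K + 1)⁻¹) (by positivity)
    have h2 := (mem_blowUpChart_infty_iff hc (R.graphOn Φ) n x y).1 hxy
    have h3 : x * y ∈ R ∧
        Φ (x * y) = (x * y) ^ n * y + (PowerSeries.trunc (n + 1) c).eval (x * y) := by
      simpa [Set.graphOn] using h2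
    obtain ⟨hR, hΦxy⟩ := h3
    have hne := hxne _ hR
    have hx0 : x ≠ 0 := left_ne_zero_of_mul hne
    have hx1 : ‖x‖ < 1 := hx.trans_le ((min_le_left _ _).trans (min_le_left _ _))
    have hyδ : ‖y‖ < δ := hy.trans_le ((min_le_left _ _).trans (min_le_right _ _))
    have hxyδ : ‖x * y‖ < δ := by
      rw [norm_mul]
      exact (mul_le_of_le_one_left (norm_nonneg _) hx1.le).trans_lt hyδ
    -- In the chart at infinity the slope coordinate is `x⁻¹`. It is bounded along the graph, so `x`
    -- cannot approach `0`.
    have h4 := hC0 _ hR hxyδ x⁻¹ (by rw [hΦxy]; field_simp; ring)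
    have h5 : ‖x⁻¹‖ ≤ K := by
      have e := norm_sub_norm_le x⁻¹ (PowerSeries.coeff (n + 1) c)
      have : C * ‖x * y‖ ≤ |C| * δ :=
        mul_le_mul (le_abs_self C) hxyδ.le (norm_nonneg _) (abs_nonneg _)
      linarith
    have h6 : ‖x‖ < (K + 1)⁻¹ := hx.trans_le (min_le_right _ _)
    rw [norm_inv] at h5
    have h7 : (K + 1) < ‖x‖⁻¹ := by
      rw [lt_inv_comm₀ (by positivity) (norm_pos_iff.2 hx0)]; exact h6
    linarith

/-- The points of a sequence that has the iterated tangents of the formal curve `y = c(x)` approach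
this curve to all orders. -/
theorem tendsto_of_hasIteratedTangents {c : PowerSeries ℂ} (hc : PowerSeries.constantCoeff c = 0)
    {z : ℕ → ℂ × ℂ} (hz : Tendsto z atTop (𝓝 0)) (hx : ∀ᶠ j in atTop, (z j).1 ≠ 0)
    (ht : HasIteratedTangents (range z) (graphTangents c)) (n : ℕ) :
    Tendsto (fun j => ((z j).2 - (PowerSeries.trunc (n + 1) c).eval (z j).1) / (z j).1 ^ n) atTop
      (𝓝 0) := by
  have hz1 : Tendsto (fun j => (z j).1) atTop (𝓝 0) := (continuous_fst.tendsto (0 : ℂ × ℂ)).comp hz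
  have hz2 : Tendsto (fun j => (z j).2) atTop (𝓝 0) := (continuous_snd.tendsto (0 : ℂ × ℂ)).comp hz
  induction n with
  | zero =>
    refine hz2.congr fun j => ?_
    rw [eval_trunc_succ, PowerSeries.trunc_zero', PowerSeries.coeff_zero_eq_constantCoeff_apply, hc]
    simp
  | succ n ih =>
    set t : ℕ → ℂ := fun j =>
      ((z j).2 - (PowerSeries.trunc (n + 1) c).eval (z j).1) / (z j).1 ^ n with htdef
    have hzt : ∀ j, (z j).1 ≠ 0 →
        (z j).1 ^ n * t j + (PowerSeries.trunc (n + 1) c).eval (z j).1 = (z j).2 := by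
      intro j hj
      have := pow_ne_zero n hj
      simp only [htdef]
      field_simp; ring
    -- If the slopes `t j / x j` were unbounded, the transformed points would accumulate at the
    -- origin of the chart at infinity, which is not an iterated tangent.
    have hbdd : ∃ M : ℝ, ∀ᶠ j in atTop, t j / (z j).1 ∈ Metric.closedBall (0 : ℂ) M := by
      have h1 : ¬ (0 : ℂ × ℂ) ∈ closure (blowUpChart OnePoint.infty ⁻¹'
          iteratedTransform (graphTangents c) (range z) n) := by
        rw [ht n OnePoint.infty]
        exact (OnePoint.coe_ne_infty _).symm
      rw [zero_mem_closure_prod_iff] at h1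
      push Not at h1
      obtain ⟨ε, hε, h1⟩ := h1
      refine ⟨ε⁻¹, ?_⟩
      have ih' : ∀ᶠ j in atTop, ‖t j‖ < ε := by
        simpa using ih.eventually (Metric.ball_mem_nhds 0 hε)
      filter_upwards [hx, ih'] with j hj hjt
      rw [mem_closedBall_zero_iff]
      by_cases htj : t j = 0
      · rw [htj]; simp [hε.le]
      by_contra hcon
      push Not at hcon
      have hX : ‖(z j).1 / t j‖ < ε := by
        rw [← inv_div, norm_inv]
        exact inv_lt_of_inv_lt₀ hε hcon
      refine h1 _ _ hX hjt ((mem_blowUpChart_infty_iff hc _ n _ _).2 ⟨j, ?_⟩)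
      rw [div_mul_cancel₀ _ htj, hzt j hj]
    obtain ⟨M, hM⟩ := hbdd
    -- Every cluster value of the bounded slopes is a point of the exceptional divisor in the
    -- closure; there is only one such point, so compactness yields convergence to it.
    have hlim : Tendsto (fun j => t j / (z j).1) atTop (𝓝 (PowerSeries.coeff (n + 1) c)) := by
      refine (isCompact_closedBall (0 : ℂ) M).tendsto_nhds_of_unique_mapClusterPt hM
        fun d _ hd => ?_
      have hcl : (0 : ℂ × ℂ) ∈ closure (blowUpChart (OnePoint.some d) ⁻¹'
          iteratedTransform (graphTangents c) (range z) n) := by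
        rw [zero_mem_closure_prod_iff]
        intro ε hε
        have hx' : ∀ᶠ j in atTop, ‖(z j).1‖ < ε := by
          simpa using hz1.eventually (Metric.ball_mem_nhds 0 hε)
        have hfreq : ∃ᶠ j in atTop, t j / (z j).1 ∈ Metric.ball d ε :=
          mapClusterPt_iff_frequently.1 hd _ (Metric.ball_mem_nhds d hε)
        obtain ⟨j, ⟨hj, hj'⟩, hj0⟩ := ((hfreq.and_eventually hx').and_eventually hx).exists
        refine ⟨(z j).1, t j / (z j).1 - d, hj', by rwa [← dist_eq_norm],
          (mem_blowUpChart_some_iff hc _ n d _ _).2 ⟨j, ?_⟩⟩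
        refine Prod.ext rfl ?_
        show (z j).2 = (z j).1 ^ (n + 1) * (t j / (z j).1 - d + d) +
          (PowerSeries.trunc (n + 1) c).eval (z j).1
        rw [sub_add_cancel, pow_succ, mul_assoc, mul_div_cancel₀ _ hj0, hzt j hj0]
      exact OnePoint.coe_injective ((ht n (OnePoint.some d)).1 hcl)
    have hlim' := hlim.sub_const (PowerSeries.coeff (n + 1) c)
    rw [sub_self] at hlim'
    refine hlim'.congr' ?_
    filter_upwards [hx] with j hj
    rw [eval_trunc_succ c (n + 1), ← hzt j hj]
    field_simp
    ring

/-! ### The petals -/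

/-- The continuous left inverse makes the image homeomorphic to a convex set, which is contractible.
-/
theorem isSimplyConnected_image_of_convex {X Y : Type*} [AddCommGroup X] [Module ℝ X]
    [TopologicalSpace X] [ContinuousAdd X] [ContinuousSMul ℝ X] [TopologicalSpace Y] {s : Set X}
    (hs : Convex ℝ s) (hne : s.Nonempty) {f : X → Y} {g : Y → X} (hf : ContinuousOn f s)
    (hg : ContinuousOn g (f '' s)) (hgf : LeftInvOn g f s) : IsSimplyConnected (f '' s) := by
  have hg' : MapsTo g (f '' s) s := by
    rintro _ ⟨x, hx, rfl⟩; rwa [hgf hx]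
  let e : s ≃ₜ f '' s :=
    { toFun := (mapsTo_image f s).restrict
      invFun := hg'.restrict
      left_inv := fun x => Subtype.ext (hgf x.2)
      right_inv := by
        rintro ⟨_, x, hx, rfl⟩
        exact Subtype.ext (congrArg f (hgf hx))
      continuous_toFun := hf.mapsToRestrict (mapsTo_image f s)
      continuous_invFun := hg.mapsToRestrict hg' }
  have := hs.contractibleSpace hne
  exact e.toHomotopyEquiv.simplyConnectedSpace_iff.1 inferInstance

/-- The petal of height `s` in the direction `ξ`. -/
def petal (q : ℕ) (ξ : ℂ) (s : ℝ) : Set ℂ := sectorRoot q ξ '' parabolicRegion q s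

section Petal

variable {q : ℕ} {ξ : ℂ} {s : ℝ}

theorem parabolicRegion_nonempty (hq : q ≠ 0) (hs : 0 ≤ s) : (parabolicRegion q s).Nonempty :=
  ⟨((s + 1 : ℝ) : ℂ), ofReal_mem_parabolicRegion hq hs (lt_add_one s)⟩

theorem differentiableOn_sectorRoot (hq : q ≠ 0) (hs : 0 ≤ s) :
    DifferentiableOn ℂ (sectorRoot q ξ) (parabolicRegion q s) := fun _ hw =>
  (hasDerivAt_sectorRoot hq (hs.trans_lt hw.1)).differentiableAt.differentiableWithinAt

theorem zero_notMem_petal (hq : q ≠ 0) (hξ : ξ ^ q = 1) : (0 : ℂ) ∉ petal q ξ s := by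
  rintro ⟨w, -, hw⟩
  exact sectorRoot_ne_zero hq hξ w hw

theorem leftInvOn_sectorRoot (hq : q ≠ 0) (hξ : ξ ^ q = 1) (hs : 0 ≤ s) :
    LeftInvOn (fun x : ℂ => ((q : ℂ) * x ^ q)⁻¹) (sectorRoot q ξ) (parabolicRegion q s) :=
  fun _ hw => inv_mul_sectorRoot_pow hq hξ (ne_zero_of_re_pos (hs.trans_lt hw.1))

theorem differentiableOn_inv_mul_pow (hq : q ≠ 0) (hξ : ξ ^ q = 1) :
    DifferentiableOn ℂ (fun x : ℂ => ((q : ℂ) * x ^ q)⁻¹) (petal q ξ s) := by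
  rintro x hx
  have hx0 : x ≠ 0 := fun h => zero_notMem_petal hq hξ (h ▸ hx)
  have hqc : (q : ℂ) ≠ 0 := by exact_mod_cast hq
  refine DifferentiableAt.differentiableWithinAt (DifferentiableAt.inv (by fun_prop) ?_)
  exact mul_ne_zero hqc (pow_ne_zero _ hx0)

/-- The derivative of `sectorRoot` does not vanish, so it is locally open. -/
theorem isOpen_petal (hq : q ≠ 0) (hξ : ξ ^ q = 1) (hs : 0 ≤ s) : IsOpen (petal q ξ s) := by
  rw [isOpen_iff_mem_nhds]
  rintro _ ⟨w, hw, rfl⟩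
  have hre : 0 < w.re := hs.trans_lt hw.1
  have hqc : (q : ℂ) ≠ 0 := by exact_mod_cast hq
  have hnhds := (isOpen_parabolicRegion q s).mem_nhds hw
  have hd := (((differentiableOn_sectorRoot hq hs (ξ := ξ)).analyticAt hnhds)).hasStrictDerivAt
  rw [(hasDerivAt_sectorRoot hq hre).deriv] at hd
  have hne : -(sectorRoot q ξ w * ((q : ℂ) * w)⁻¹) ≠ 0 :=
    neg_ne_zero.2 (mul_ne_zero (sectorRoot_ne_zero hq hξ w)
      (inv_ne_zero (mul_ne_zero hqc (ne_zero_of_re_pos hre))))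
  rw [← hd.map_nhds_eq hne]
  exact image_mem_map hnhds

theorem isSimplyConnected_petal (hq : q ≠ 0) (hξ : ξ ^ q = 1) (hs : 0 ≤ s) :
    IsSimplyConnected (petal q ξ s) :=
  isSimplyConnected_image_of_convex (convex_parabolicRegion q s) (parabolicRegion_nonempty hq hs)
    (differentiableOn_sectorRoot hq hs).continuousOn (differentiableOn_inv_mul_pow hq hξ).continuousOn
    (leftInvOn_sectorRoot hq hξ hs)

theorem exists_ofReal_mul_mem_petal (hq : q ≠ 0) (hξ : ξ ^ q = 1) (hs : 1 ≤ s) :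
    ∃ ε : ℝ, 0 < ε ∧ ∀ t : ℝ, 0 < t → t < ε → (t : ℂ) * ξ ∈ petal q ξ s := by
  have hq0 : (0 : ℝ) < q := by exact_mod_cast Nat.pos_of_ne_zero hq
  have h1q : (1 : ℝ) ≤ q := by exact_mod_cast Nat.one_le_iff_ne_zero.2 hq
  refine ⟨(q * s)⁻¹, by positivity, fun t ht hts => ⟨((((q : ℝ) * t ^ q)⁻¹ : ℝ) : ℂ), ?_, ?_⟩⟩
  · refine ofReal_mem_parabolicRegion hq (by linarith) ?_
    have h2 : (q * s)⁻¹ ≤ 1 := inv_le_one_of_one_le₀ (by nlinarith)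
    have h3 : t ^ q ≤ t := pow_le_of_le_one ht.le (by linarith) hq
    rw [lt_inv_comm₀ (by linarith) (by positivity)]
    have h4 : (q * s)⁻¹ = (q : ℝ)⁻¹ * s⁻¹ := mul_inv _ _
    calc (q : ℝ) * t ^ q ≤ q * t := by gcongr
      _ < q * (q * s)⁻¹ := by gcongr
      _ = s⁻¹ := by rw [h4, mul_inv_cancel_left₀ hq0.ne']
  · have h := sectorRoot_inv_mul_exp_pow hq hξ (l := ((Real.log t : ℝ) : ℂ)) (by
      have := Real.pi_pos
      rw [Complex.ofReal_im, abs_zero]; positivity)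
    rw [← Complex.ofReal_exp, Real.exp_log ht, mul_pow, hξ, one_mul] at h
    push_cast
    rw [h, mul_comm]

theorem zero_mem_closure_petal (hq : q ≠ 0) (hξ : ξ ^ q = 1) (hs : 1 ≤ s) :
    (0 : ℂ) ∈ closure (petal q ξ s) := by
  obtain ⟨ε, hε, h⟩ := exists_ofReal_mul_mem_petal hq hξ hs
  refine Metric.mem_closure_iff.2 fun η hη => ?_
  have hpos : 0 < min ε η / 2 := by positivity
  refine ⟨_, h (min ε η / 2) hpos (by linarith [min_le_left ε η]), ?_⟩
  rw [dist_zero_left, norm_mul, norm_eq_one_of_isAttracting hq hξ, mul_one, Complex.norm_real,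
    Real.norm_of_nonneg hpos.le]
  linarith [min_le_right ε η]

/-- Estimates valid for large `re w` become estimates valid for small `x` in the petal, the form
needed for iterated tangents. -/
theorem petal_small_subset (hq : q ≠ 0) (hξ : ξ ^ q = 1) (hs : 1 ≤ s) (t : ℝ) :
    ∃ δ : ℝ, 0 < δ ∧ ∀ w ∈ parabolicRegion q s, ‖sectorRoot q ξ w‖ < δ →
      w ∈ parabolicRegion q t := by
  have hq0 : (0 : ℝ) < q := by exact_mod_cast Nat.pos_of_ne_zero hq
  set T := max t 1 with hT
  have hT0 : 0 < T := lt_max_of_lt_right one_pos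
  refine ⟨min 1 (2 * q * T)⁻¹, by positivity, fun w hw hx => ⟨?_, hw.2⟩⟩
  have hre : 0 < w.re := by linarith [hw.1]
  have h1 := inv_re_le_norm_sectorRoot_pow hq hξ hs hw
  have h2 : ‖sectorRoot q ξ w‖ ^ q ≤ ‖sectorRoot q ξ w‖ :=
    pow_le_of_le_one (norm_nonneg _) (hx.trans_le (min_le_left _ _)).le hq
  have h3 : ‖sectorRoot q ξ w‖ < (2 * q * T)⁻¹ := hx.trans_le (min_le_right _ _)
  have h4 : w.re⁻¹ < T⁻¹ := by
    calc w.re⁻¹ ≤ 2 * q * ‖sectorRoot q ξ w‖ := h1.trans (by gcongr)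
      _ < 2 * q * (2 * q * T)⁻¹ := by gcongr
      _ = T⁻¹ := by field_simp
  exact (le_max_left t 1).trans_lt ((inv_lt_inv₀ hre hT0).1 h4)

end Petal

/-! ### The graph of a holomorphic function -/

theorem isComplexCurve_graphOn {R : Set ℂ} (hR : IsOpen R) {Φ : ℂ → ℂ}
    (hΦ : DifferentiableOn ℂ Φ R) : IsComplexCurve (R.graphOn Φ) := by
  rintro _ ⟨x, hx, rfl⟩
  refine ⟨Prod.fst ⁻¹' R, fun z => z.2 - Φ z.1, hR.preimage continuous_fst, hx, ?_, ?_, ?_⟩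
  · exact differentiableOn_snd.sub (hΦ.comp differentiableOn_fst fun z hz => hz)
  · have hd : HasFDerivAt Φ (fderiv ℂ Φ x) x :=
      (hΦ.differentiableAt (hR.mem_nhds hx)).hasFDerivAt
    have h : HasFDerivAt (fun z : ℂ × ℂ => z.2 - Φ z.1)
        (ContinuousLinearMap.snd ℂ ℂ ℂ - (fderiv ℂ Φ x).comp (ContinuousLinearMap.fst ℂ ℂ ℂ))
        (x, Φ x) := hasFDerivAt_snd.sub (HasFDerivAt.comp (x, Φ x) (g := Φ) hd hasFDerivAt_fst)
    rw [h.fderiv]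
    intro h0
    have := congrArg (fun A : ℂ × ℂ →L[ℂ] ℂ => A (0, 1)) h0
    simp at this
  · ext ⟨u, v⟩
    constructor
    · rintro ⟨⟨u', hu', huv⟩, hu⟩
      obtain ⟨rfl, rfl⟩ := Prod.mk.inj huv
      exact ⟨hu, sub_self _⟩
    · rintro ⟨hu, huv⟩
      exact ⟨⟨u, hu, Prod.ext rfl (sub_eq_zero.1 huv).symm⟩, hu⟩

/-! ### The invariant graph as a stable curve asymptotic to the formal curve -/

namespace InvariantGraph

variable {F : ℂ × ℂ → ℂ × ℂ} {U : Set (ℂ × ℂ)} {q : ℕ} {ξ : ℂ} {γ : Polynomial ℂ}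
  {c : PowerSeries ℂ} {s : ℝ} {N : ℕ} {g : ℂ → ℂ}

/-- The function on the petal whose graph is the invariant curve. -/
noncomputable def petalFunction (q : ℕ) (g : ℂ → ℂ) (x : ℂ) : ℂ := g (((q : ℂ) * x ^ q)⁻¹)

theorem petalFunction_sectorRoot (hq : q ≠ 0) (hξ : ξ ^ q = 1) (hs : 0 ≤ s) {w : ℂ}
    (hw : w ∈ parabolicRegion q s) : petalFunction q g (sectorRoot q ξ w) = g w :=
  congrArg g (leftInvOn_sectorRoot hq hξ hs hw)

theorem graphOn_petal (hq : q ≠ 0) (hξ : ξ ^ q = 1) (hs : 0 ≤ s) :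
    (petal q ξ s).graphOn (petalFunction q g) =
      (fun w => (sectorRoot q ξ w, g w)) '' parabolicRegion q s := by
  rw [Set.graphOn, petal, image_image]
  exact image_congr fun w hw => Prod.ext rfl (petalFunction_sectorRoot hq hξ hs hw)

theorem differentiableOn_petalFunction (hq : q ≠ 0) (hξ : ξ ^ q = 1) (hs : 0 ≤ s)
    (G : InvariantGraph F U q ξ γ s N g) : DifferentiableOn ℂ (petalFunction q g) (petal q ξ s) := by
  refine G.diff.comp (differentiableOn_inv_mul_pow hq hξ) ?_
  rintro _ ⟨w, hw, rfl⟩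
  rwa [leftInvOn_sectorRoot hq hξ hs hw]

theorem isSimplyConnected_graphOn (hq : q ≠ 0) (hξ : ξ ^ q = 1) (hs : 0 ≤ s)
    (G : InvariantGraph F U q ξ γ s N g) :
    IsSimplyConnected ((petal q ξ s).graphOn (petalFunction q g)) := by
  rw [graphOn_petal hq hξ hs]
  refine isSimplyConnected_image_of_convex (g := fun z : ℂ × ℂ => ((q : ℂ) * z.1 ^ q)⁻¹)
    (convex_parabolicRegion q s) (parabolicRegion_nonempty hq hs)
    ((differentiableOn_sectorRoot hq hs).continuousOn.prodMk G.diff.continuousOn) ?_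
    fun w hw => leftInvOn_sectorRoot hq hξ hs hw
  refine (differentiableOn_inv_mul_pow hq hξ (s := s)).continuousOn.comp continuousOn_fst ?_
  rintro _ ⟨w, hw, rfl⟩
  exact ⟨w, hw, rfl⟩

/-- The curve is asymptotic to the series `c`. -/
theorem eventually_norm_sub_trunc_le (hq : q ≠ 0) (hξ : ξ ^ q = 1) {L : ℕ}
    (G : InvariantGraph F U q ξ (PowerSeries.trunc (q * (L + 4) + 1) c) s (L + 2) g)
    (hall : ∃ L₀ : ℕ, ∀ L ≥ L₀, ∀ᶠ s in atTop, ∃ g,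
      InvariantGraph F U q ξ (PowerSeries.trunc (q * (L + 4) + 1) c) s (L + 2) g) (n : ℕ) :
    ∃ C : ℝ, ∀ᶠ t in atTop, ∀ w ∈ parabolicRegion q t,
      ‖g w - (PowerSeries.trunc n c).eval (sectorRoot q ξ w)‖ ≤ C * ‖sectorRoot q ξ w‖ ^ n := by
  obtain ⟨L₀, hL₀⟩ := hall
  -- `L'` must be admissible, exceed `L` so that the two curves can be compared, and give contact of
  -- order at least `n`.
  set L' := max L₀ (L + 1 + n) with hL'
  have hLn : L + 1 + n ≤ L' := le_max_right _ _
  have hqL : L' + 4 ≤ q * (L' + 4) := Nat.le_mul_of_pos_left _ (Nat.pos_of_ne_zero hq)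
  obtain ⟨s', g', G'⟩ := (hL₀ L' (le_max_left _ _)).exists
  obtain ⟨C, hC, htr⟩ := exists_norm_trunc_sub_le c (show n ≤ q * (L' + 4) + 1 by omega)
  refine ⟨(2 * q) ^ (L' + 2) + C, ?_⟩
  filter_upwards [G.eventually_eq hq hξ (by omega) G', eventually_ge_atTop s',
    eventually_norm_sectorRoot_le hq hξ zero_lt_one, eventually_ge_atTop 1] with
    t heq hs' h1 ht w hw
  have hx1 := h1 w hw.1.le
  have hre : 0 < w.re := by linarith [hw.1]
  have e1 := G'.norm_sub w (parabolicRegion_mono q hs' hw)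
  have e2 := htr _ hx1
  have e3 : w.re⁻¹ ^ (L' + 2) ≤ (2 * q) ^ (L' + 2) * ‖sectorRoot q ξ w‖ ^ n := by
    refine (pow_le_pow_left₀ (by positivity) (inv_re_le_norm_sectorRoot_pow hq hξ ht hw) _).trans ?_
    rw [mul_pow, ← pow_mul]
    refine mul_le_mul_of_nonneg_left ?_ (by positivity)
    refine pow_le_pow_of_le_one (norm_nonneg _) hx1 ?_
    have : L' + 2 ≤ q * (L' + 2) := Nat.le_mul_of_pos_left _ (Nat.pos_of_ne_zero hq)
    omega
  rw [← heq w hw]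
  refine (norm_sub_le_norm_sub_add_norm_sub _
    ((PowerSeries.trunc (q * (L' + 4) + 1) c).eval (sectorRoot q ξ w)) _).trans ?_
  linarith

/-- Along an orbit the real part of `w` increases by at least `1 / 2` at each step, so `x` tends to
`0`, and `y` follows because it is `O(x)`. -/
theorem isStableSet_graphOn (hq : q ≠ 0) (hξ : ξ ^ q = 1) (hs : 0 ≤ s)
    (G : InvariantGraph F U q ξ γ s N g) {C : ℝ}
    (hg : ∀ᶠ t in atTop, ∀ w ∈ parabolicRegion q t, ‖g w‖ ≤ C * ‖sectorRoot q ξ w‖) :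
    IsStableSet F U ((petal q ξ s).graphOn (petalFunction q g)) := by
  rw [graphOn_petal hq hξ hs]
  refine ⟨?_, ?_, ?_⟩
  · rintro _ ⟨w, hw, rfl⟩
    exact G.mem w hw
  · rintro _ ⟨w, hw, rfl⟩
    obtain ⟨w', hw', -, h⟩ := G.step w hw
    exact ⟨w', hw', h.symm⟩
  · rintro _ ⟨w, hw, rfl⟩
    choose! f hfmem hfre hf using G.step
    have hmem : ∀ n : ℕ, f^[n] w ∈ parabolicRegion q s := fun n => by
      induction n with
      | zero => exact hw
      | succ n ih => rw [Function.iterate_succ_apply']; exact hfmem _ ih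
    have hgrow : ∀ n : ℕ, (n : ℝ) / 2 ≤ (f^[n] w).re := fun n => by
      induction n with
      | zero => simpa using (hs.trans_lt hw.1).le
      | succ n ih =>
        rw [Function.iterate_succ_apply']
        have := hfre _ (hmem n)
        push_cast; linarith
    have hiter : ∀ n : ℕ, F^[n] (sectorRoot q ξ w, g w) =
        (sectorRoot q ξ (f^[n] w), g (f^[n] w)) := fun n => by
      induction n with
      | zero => rfl
      | succ n ih =>
        rw [Function.iterate_succ_apply', ih, hf _ (hmem n), ← Function.iterate_succ_apply' f]
    have hre : Tendsto (fun n => (f^[n] w).re) atTop atTop :=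
      tendsto_atTop_mono hgrow (tendsto_natCast_atTop_atTop.atTop_div_const two_pos)
    have hψ : Tendsto (fun n => sectorRoot q ξ (f^[n] w)) atTop (𝓝 0) := by
      rw [Metric.tendsto_nhds]
      intro ε hε
      obtain ⟨t, ht⟩ := (eventually_norm_sectorRoot_le hq hξ (half_pos hε)).exists
      filter_upwards [hre.eventually_ge_atTop t] with n hn
      rw [dist_zero_right]
      exact (ht _ hn).trans_lt (by linarith)
    have hg0 : Tendsto (fun n => g (f^[n] w)) atTop (𝓝 0) := by
      obtain ⟨t, ht⟩ := hg.exists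
      refine squeeze_zero_norm' (a := fun n => C * ‖sectorRoot q ξ (f^[n] w)‖) ?_ ?_
      · filter_upwards [hre.eventually_gt_atTop t] with n hn
        exact ht _ ⟨hn, (hmem n).2⟩
      · simpa using hψ.norm.const_mul C
    simp only [hiter]
    exact hψ.prodMk_nhds hg0

end InvariantGraph

/-- An orbit asymptotic to the curve `y = c(x)` and tangent to the half-line `ξ ℝ⁺`, in the
coordinate `w = (q x ^ q)⁻¹`, is a perturbation of an orbit of the translation by `1`. -/
theorem NormalForm.eventually_mem_parabolicRegion {F : ℂ × ℂ → ℂ × ℂ} {U : Set (ℂ × ℂ)}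
    {k p m : ℕ} {μ ξ : ℂ} {a γ : Polynomial ℂ} {H r : ℂ × ℂ → ℂ} {C ρ : ℝ}
    (N : NormalForm F U k p m μ a γ H r C ρ) (hk : 1 ≤ k) (hξ : ξ ^ (k + p) = 1)
    {z : ℕ → ℂ × ℂ} (hz : ∀ n, z (n + 1) = F (z n)) (hz0 : Tendsto z atTop (𝓝 0))
    (hdir : Tendsto (fun n => (z n).1 / (‖(z n).1‖ : ℂ)) atTop (𝓝 ξ))
    (hclose : ∀ᶠ n in atTop, ‖(z n).2 - γ.eval (z n).1‖ ≤ ‖(z n).1‖ ^ (k + p)) (s : ℝ) :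
    ∀ᶠ n in atTop, (((k + p : ℕ) : ℂ) * (z n).1 ^ (k + p))⁻¹ ∈ parabolicRegion (k + p) s := by
  have hq : k + p ≠ 0 := by omega
  have hq0 : (0 : ℝ) < ((k + p : ℕ) : ℝ) := by exact_mod_cast Nat.pos_of_ne_zero hq
  have h1q : (1 : ℝ) ≤ ((k + p : ℕ) : ℝ) := by exact_mod_cast Nat.one_le_iff_ne_zero.2 hq
  have hξ0 := root_ne_zero hq hξ
  have hC := N.C_nonneg
  have hz1 : Tendsto (fun j => ‖(z j).1‖) atTop (𝓝 0) := by
    simpa using ((continuous_fst.tendsto (0 : ℂ × ℂ)).comp hz0).norm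
  have hx0 : ∀ᶠ n in atTop, (z n).1 ≠ 0 := by
    filter_upwards [hdir.eventually_ne hξ0] with n hn h
    simp [h] at hn
  have hpow : Tendsto (fun j => ‖(z j).1‖ ^ (k + p)) atTop (𝓝 0) := by
    simpa [zero_pow hq] using hz1.pow (k + p)
  refine _root_.eventually_mem_parabolicRegion (C := 2 * C)
    (w := fun n => (((k + p : ℕ) : ℂ) * (z n).1 ^ (k + p))⁻¹) (by positivity) ?_ ?_ s
  · filter_upwards [hx0, hclose, hz1.eventually_lt_const N.ρ_pos,
      hpow.eventually_lt_const N.ρ_pos] with n h1 h2 h3 h4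
    have hco := N.coord (z n).1 ((z n).2 - γ.eval (z n).1) h3 (h2.trans_lt h4) h1
    simp only [sub_add_cancel, Prod.mk.eta, ← hz n] at hco
    rw [hco]
    have e : ∀ A B : ℂ, A + 1 + B - A - 1 = B := fun A B => by ring
    rw [e, norm_inv, div_inv_eq_mul, norm_mul, norm_pow, Complex.norm_natCast]
    refine (N.norm_H _ _ h3 (h2.trans_lt h4)).trans ?_
    have h5 : 0 ≤ ‖(z n).1‖ ^ (k + p) := by positivity
    calc C * (‖(z n).1‖ ^ (k + p) + ‖(z n).2 - γ.eval (z n).1‖)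
        ≤ C * (‖(z n).1‖ ^ (k + p) + ‖(z n).1‖ ^ (k + p)) := by gcongr
      _ = 2 * C * (1 * ‖(z n).1‖ ^ (k + p)) := by ring
      _ ≤ _ := by gcongr
  -- The coordinate `w` is `‖x‖ ^ (-q) / q` times the inverse of `(x / ‖x‖) ^ q`, and the latter
  -- tends to `ξ ^ q = 1`.
  · have hre : Tendsto (fun n => ((((z n).1 / (‖(z n).1‖ : ℂ)) ^ (k + p))⁻¹).re) atTop (𝓝 1) := by
      have h := (hdir.pow (k + p)).inv₀ (pow_ne_zero _ hξ0)
      rw [hξ, inv_one] at h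
      have h' := (Complex.continuous_re.tendsto (1 : ℂ)).comp h
      rwa [Complex.one_re] at h'
    have hpos : ∀ᶠ n in atTop, ‖(z n).1‖ ^ (k + p) ∈ Ioi (0 : ℝ) := by
      filter_upwards [hx0] with n hn
      exact pow_pos (norm_pos_iff.2 hn) _
    have hinf := ((tendsto_nhdsWithin_iff.2 ⟨hpow, hpos⟩).inv_tendsto_nhdsGT_zero).const_mul_atTop
      (inv_pos.2 hq0)
    refine (hinf.atTop_mul_pos one_pos hre).congr' ?_
    filter_upwards [hx0] with n hn
    have hn' : (‖(z n).1‖ : ℂ) ≠ 0 := by exact_mod_cast (norm_pos_iff.2 hn).ne'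
    have e : (((k + p : ℕ) : ℂ) * (z n).1 ^ (k + p))⁻¹ =
        (((((k + p : ℕ) : ℝ)⁻¹ * (‖(z n).1‖ ^ (k + p))⁻¹ : ℝ)) : ℂ) *
          (((z n).1 / (‖(z n).1‖ : ℂ)) ^ (k + p))⁻¹ := by
      have hqc : ((k + p : ℕ) : ℂ) ≠ 0 := by exact_mod_cast hq
      push_cast at hqc ⊢
      rw [div_pow]
      field_simp
    rw [e, Complex.re_ofReal_mul]
    rfl

/-- Iterated tangency gives closeness to the truncation of order `M = (k + p) (L + 4)`, which in the
variable `w` is stronger than the exponent `L + 2`. A tail of the orbit lies in the region, so the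
uniqueness property applies to each of its points taken as a starting point. -/
theorem InvariantGraph.eventually_mem_of_asymptotic {F : ℂ × ℂ → ℂ × ℂ} {U : Set (ℂ × ℂ)}
    {k p L : ℕ} {μ ξ : ℂ} {a : Polynomial ℂ} {c : PowerSeries ℂ} {H r : ℂ × ℂ → ℂ} {C ρ s : ℝ}
    {g : ℂ → ℂ} (hc : PowerSeries.constantCoeff c = 0) (hk : 1 ≤ k) (hξ : ξ ^ (k + p) = 1)
    (hs : 1 ≤ s)
    (N : NormalForm F U k p ((k + p) * (L + 4)) μ a (PowerSeries.trunc ((k + p) * (L + 4) + 1) c)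
      H r C ρ)
    (G : InvariantGraph F U (k + p) ξ (PowerSeries.trunc ((k + p) * (L + 4) + 1) c) s (L + 2) g)
    {z : ℕ → ℂ × ℂ} (hz : ∀ n, z (n + 1) = F (z n)) (hz0 : Tendsto z atTop (𝓝 0))
    (hdir : Tendsto (fun n => (z n).1 / (‖(z n).1‖ : ℂ)) atTop (𝓝 ξ))
    (htan : HasIteratedTangents (range z) (graphTangents c)) :
    ∀ᶠ n in atTop, ∃ w ∈ parabolicRegion (k + p) s, (sectorRoot (k + p) ξ w, g w) = z n := by
  have hq : k + p ≠ 0 := by omega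
  have hroot := eventually_sectorRoot_of_tendsto hq hξ hdir
  have hx0 : ∀ᶠ n in atTop, (z n).1 ≠ 0 := hroot.mono fun n h => h.1
  set M := (k + p) * (L + 4) with hM
  set γ := PowerSeries.trunc (M + 1) c with hγ
  have hz1 : Tendsto (fun j => ‖(z j).1‖) atTop (𝓝 0) := by
    simpa using ((continuous_fst.tendsto (0 : ℂ × ℂ)).comp hz0).norm
  have hclose : ∀ᶠ n in atTop, ‖(z n).2 - γ.eval (z n).1‖ ≤ ‖(z n).1‖ ^ M := by
    have h := (tendsto_of_hasIteratedTangents hc hz0 hx0 htan M).norm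
    rw [norm_zero] at h
    filter_upwards [h.eventually_lt_const one_pos, hx0] with n hn hn0
    have hpos : 0 < ‖(z n).1‖ ^ M := pow_pos (norm_pos_iff.2 hn0) _
    rw [norm_div, norm_pow, div_lt_one hpos] at hn
    exact hn.le
  have hclose' : ∀ᶠ n in atTop, ‖(z n).2 - γ.eval (z n).1‖ ≤ ‖(z n).1‖ ^ (k + p) := by
    filter_upwards [hclose, hz1.eventually_lt_const one_pos] with n h1 h2
    exact h1.trans (pow_le_pow_of_le_one (norm_nonneg _) h2.le (Nat.le_mul_of_pos_right _ (by omega)))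
  obtain ⟨n₀, hn₀⟩ := eventually_atTop.1 ((hroot.and hclose).and
    (N.eventually_mem_parabolicRegion hk hξ hz hz0 hdir hclose' s))
  filter_upwards [eventually_ge_atTop n₀] with n hn
  set w : ℕ → ℂ := fun j => (((k + p : ℕ) : ℂ) * (z (n + j)).1 ^ (k + p))⁻¹ with hw
  have hψ : ∀ j, sectorRoot (k + p) ξ (w j) = (z (n + j)).1 := fun j => (hn₀ (n + j) (by omega)).1.1.2
  have hmem : ∀ j, w j ∈ parabolicRegion (k + p) s := fun j => (hn₀ (n + j) (by omega)).2
  refine ⟨w 0, hmem 0, ?_⟩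
  have hu := G.unique w (fun j => (z (n + j)).2) hmem (fun j => ?_) (fun j => ?_)
  · rw [hψ 0, ← hu]
    rfl
  · have hre : s < (w j).re := (hmem j).1
    have hre0 : 0 < (w j).re := by linarith
    have h1 := (hn₀ (n + j) (by omega)).1.2
    have h2 := norm_sectorRoot_pow_le hq hξ hre0
    rw [hψ] at h2 ⊢
    refine h1.trans ?_
    rw [hM, pow_mul]
    refine (pow_le_pow_left₀ (by positivity) h2 _).trans ?_
    exact pow_le_pow_of_le_one (by positivity) (inv_le_one_of_one_le₀ (by linarith)) (by omega)
  · rw [hψ, hψ]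
    exact (hz (n + j)).symm

theorem mainTheorem6 (F : ℂ × ℂ → ℂ × ℂ) (U : Set (ℂ × ℂ)) (hF : IsDiffeoGerm F U)
    (Γ : Ideal FormalSeries) (hΓ : IsFormalCurve Γ) (hinv : IsInvariantCurve F Γ)
    (k p : ℕ) (μ : ℂ) (a : Polynomial ℂ) (hred : IsReducedForm F Γ k p μ a)
    (ξ : ℂ) (hξ : IsSaddleDirection k p μ a ξ) :
    ∃ (R : Set ℂ) (φ : ℂ → ℂ),
      IsOpen R ∧ IsConnected R ∧ IsSimplyConnected R ∧ (0 : ℂ) ∈ frontier R ∧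
      (∃ ε : ℝ, 0 < ε ∧ ∀ t : ℝ, 0 < t → t < ε → (t : ℂ) * ξ ∈ R) ∧
      DifferentiableOn ℂ φ R ∧
      IsParabolicCurve F U (R.graphOn φ) ∧ IsAsymptoticTo F U (R.graphOn φ) Γ ∧
      ∀ z : ℕ → ℂ × ℂ, (∀ n, z (n + 1) = F (z n)) → IsAsymptoticTo F U (Set.range z) Γ →
        Tendsto (fun n => (z n).1 / (‖(z n).1‖ : ℂ)) atTop (𝓝 ξ) →
        ∀ᶠ n in atTop, z n ∈ R.graphOn φ := by
  obtain ⟨c, hc, hpar⟩ := hred.contact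
  obtain rfl := eq_span_graphEquation hpar
  have hc0 : PowerSeries.constantCoeff c = 0 := by
    rw [← PowerSeries.coeff_zero_eq_constantCoeff_apply]
    exact PowerSeries.coeff_of_lt_order 0 (lt_of_lt_of_le (by exact_mod_cast Nat.succ_pos _) hc)
  have hk := hred.one_le
  have hq : k + p ≠ 0 := by omega
  have hξ1 : ξ ^ (k + p) = 1 := hξ.1
  have hall := exists_invariantGraph hF hinv hred hc hξ
  obtain ⟨L, hL⟩ := id hall
  obtain ⟨s, ⟨g, G⟩, hs⟩ := ((hL L le_rfl).and (eventually_ge_atTop 1)).exists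
  have hs0 : 0 ≤ s := by linarith
  have hasym := G.eventually_norm_sub_trunc_le hq hξ1 hall
  have hopen := isOpen_petal (s := s) hq hξ1 hs0
  have hsc := isSimplyConnected_petal hq hξ1 hs0
  have hdiff := G.differentiableOn_petalFunction hq hξ1 hs0
  have h0 : (0 : ℂ) ∉ petal (k + p) ξ s := zero_notMem_petal hq hξ1
  have h0S : (0 : ℂ × ℂ) ∉ (petal (k + p) ξ s).graphOn (InvariantGraph.petalFunction (k + p) g) := by
    rintro ⟨x, hx, hx0⟩
    have hx' : x = 0 := congrArg Prod.fst hx0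
    exact h0 (hx' ▸ hx)
  have hscS := G.isSimplyConnected_graphOn hq hξ1 hs0
  have hstable : IsStableSet F U
      ((petal (k + p) ξ s).graphOn (InvariantGraph.petalFunction (k + p) g)) := by
    obtain ⟨C, hC⟩ := hasym 1
    refine G.isStableSet_graphOn hq hξ1 hs0 (C := C) ?_
    filter_upwards [hC] with t ht w hw
    simpa [eval_trunc_succ c 0, hc0] using ht w hw
  have htan : HasIteratedTangents
      ((petal (k + p) ξ s).graphOn (InvariantGraph.petalFunction (k + p) g)) (graphTangents c) := by
    refine hasIteratedTangents_graphOn hc0 h0 (zero_mem_closure_petal hq hξ1 hs) fun n => ?_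
    obtain ⟨C, hC⟩ := hasym n
    obtain ⟨t, ht⟩ := hC.exists
    obtain ⟨δ, hδ, hsub⟩ := petal_small_subset hq hξ1 hs t
    refine ⟨C, δ, hδ, ?_⟩
    rintro _ ⟨w, hw, rfl⟩ hwδ
    rw [InvariantGraph.petalFunction_sectorRoot hq hξ1 hs0 hw]
    exact ht w (hsub w hw hwδ)
  refine ⟨petal (k + p) ξ s, InvariantGraph.petalFunction (k + p) g, hopen,
    hsc.isPathConnected.isConnected, hsc, ?_, exists_ofReal_mul_mem_petal hq hξ1 hs, hdiff,
    ⟨hstable, isComplexCurve_graphOn hopen hdiff, hscS.isPathConnected.isConnected, hscS, h0S⟩,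
    ⟨hstable, h0S, _, htan, (isInfinitelyNearSequence_graphEquation hc0 _).2 fun n => rfl⟩, ?_⟩
  · rw [hopen.frontier_eq]
    exact ⟨zero_mem_closure_petal hq hξ1 hs, h0⟩
  · rintro z hz ⟨⟨-, -, hstab⟩, -, t, ht, htΓ⟩ hdir
    -- The sequence of infinitely near points is unique, so the orbit and the curve share it.
    obtain rfl : t = graphTangents c :=
      funext ((isInfinitelyNearSequence_graphEquation hc0 t).1 htΓ)
    have hz0 : Tendsto z atTop (𝓝 0) := by
      refine (hstab (z 0) (mem_range_self 0)).congr fun n => ?_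
      induction n with
      | zero => rfl
      | succ n ih => rw [Function.iterate_succ_apply', ih, hz]
    -- This normal form need not be the one that produced `g`: it serves only to bring the orbit
    -- into the region, and the uniqueness of `g` concerns `F` itself.
    obtain ⟨H, r, C, ρ, N⟩ := exists_normalForm hF hinv hred hc ((k + p) * (L + 4))
    rw [InvariantGraph.graphOn_petal hq hξ1 hs0]
    exact G.eventually_mem_of_asymptotic hc0 hk hξ1 hs N hz hz0 hdir ht
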